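/- Let $\Gamma\subset \mathrm{PSL}(2,\mathbb R)$ be a discrete subgroup of finite covolume, $\mathcal H$ the upper half plane. A function $f:\mathcal H\to\mathbb C$ has moderate growth if $|f(z)|\le C\big((1+|z|^2)/\operatorname{Im} z\big)^N$ for some $C,N$ and all $z\in\mathcal H$. A modular form of weight $k$ over $\Gamma$ is a holomorphic $f$ on $\mathcal H$ of moderate growth with $(cz+d)^{-k}f\big(\frac{az+b}{cz+d}\big)=f(z)$ for all $\begin{pmatrix}a&b\\c&d\end{pmatrix}\in\Gamma$, $z\in\mathcal H$. A quasimodular form of weight $k$ and depth $\le p$ is a holomorphic $f$ on $\mathcal H$ of moderate growth for which there are functions $f_0,\dots,f_p:\mathcal H\to\mathbb C$ with $$(cz+d)^{-k}f\Big(\frac{az+b}{cz+d}\Big)=\sum_{j=0}^{p}f_j(z)\Big(\frac{c}{cz+d}\Big)^j\qquad\text{for all }\begin{pmatrix}a&b\\c&d\end{pmatrix}\in\Gamma,\ z\in\mathcal H .$$ Let $M_k(\Gamma)$ and $\widetilde M_k(\Gamma)$ be the spaces of modular and of quasimodular forms (of any depth) of weight $k$, and $\widetilde M_*(\Gamma)=\bigoplus_{k\ge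 0}\widetilde M_k(\Gamma)$. The operators $D f=df/dz$ (from weight $k$ to weight $k+2$), $Hf=kf$ (for $f$ of weight $k$) and $\delta f=f_1$ (from weight $k$ to weight $k-2$, zero for $k=0,1$) are well defined on $\widetilde M_*(\Gamma)$ and satisfy $[H,D]=2D$, $[H,\delta]=-2\delta$, $[\delta,D]=H$, so that they make it an $\mathfrak{sl}_2(\mathbb C)$-module, in which $\begin{pmatrix}0&1\\0&0\end{pmatrix}$, $\begin{pmatrix}1&0\\0&-1\end{pmatrix}$, $\begin{pmatrix}0&0\\-1&0\end{pmatrix}$ act by $D$, $H$, $\delta$. For $k>0$ let $\mathcal U_k$ be the $\mathfrak{sl}_2(\mathbb C)$-module with basis $(x_j^{(k)})_{j\ge 0}$ and $$Dx_j^{(k)}=x_{j+1}^{(k)},\qquad Hx_j^{(k)}=(k+2j)x_j^{(k)},\qquad \delta x_j^{(k)}=j(k+j-1)x_{j-1}^{(k)}\ (j\ge1),\qquad \delta x_0^{(k)}=0 ;$$ let $\mathcal U_0=\mathbb C$ with the trivial action. Let $\widehat U_2$ be the module with basis $1,\hat x_0,\hat x_1,\dots$ in which $D,H,\delta$ vanish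 on $1$ and act on the $\hat x_j$ by the formulas for $x_j^{(2)}$, except that $\delta\hat x_0=1$; it is an extension of $\mathcal U_2$ by the trivial module $\mathbb C$. On $M_k(\Gamma)\otimes\mathcal U_k$ the algebra $\mathfrak{sl}_2(\mathbb C)$ acts through the second factor. Then either $\delta(\widetilde M_2(\Gamma))=0$ or there is $\phi\in\widetilde M_2(\Gamma)$ with $\delta\phi=1$, and: (i) if $\delta(\widetilde M_2(\Gamma))=0$, there is an isomorphism of $\mathfrak{sl}_2(\mathbb C)$-modules $$\bigoplus_{k\ge0}M_k(\Gamma)\otimes\mathcal U_k\;\cong\;\widetilde M_*(\Gamma)$$ given by $f\otimes x_j^{(k)}\mapsto D^jf$ for $k>0$ and by $f\otimes 1\mapsto f$ for $k=0$; (ii) for every $\phi\in\widetilde M_2(\Gamma)$ with $\delta\phi=1$ there is an isomorphism of $\mathfrak{sl}_2(\mathbb C)$-modules $$\Big(\bigoplus_{k\ge1}M_k(\Gamma)\otimes\mathcal U_k\Big)\oplus\widehat U_2\;\cong\;\widetilde M_*(\Gamma)$$ given by $f\otimes x_j^{(k)}\mapsto D^jf$, $\hat x_j\mapsto D^j\phi$,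 $1\mapsto 1$. (The summand $M_0(\Gamma)\otimes\mathcal U_0$ of constants is the line $\mathbb C\cdot 1\subset\widehat U_2$.) -/

import Mathlib

open UpperHalfPlane MeasureTheory
open scoped MatrixGroups Manifold TensorProduct DirectSum Polynomial

attribute [local instance] LieRing.ofAssociativeRing

noncomputable section

/-! ## Discrete subgroups of `PSL(2, ℝ)` of finite covolume -/

/-- The action of `PSL(2, ℝ)` on the upper half plane by fractional linear transformations,
induced by the one of `SL(2, ℝ)`. -/
instance pslAction : MulAction PSL(2, ℝ) ℍ :=
  MulAction.compHom ℍ <|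
    QuotientGroup.lift (Subgroup.center SL(2, ℝ)) (MulAction.toPermHom SL(2, ℝ) ℍ) (by
      intro g hg
      obtain ⟨r, -, hr⟩ := Matrix.SpecialLinearGroup.mem_center_iff.mp hg
      have h10 : (g : Matrix (Fin 2) (Fin 2) ℝ) 1 0 = 0 := by simp [← hr]
      have h01 : (g : Matrix (Fin 2) (Fin 2) ℝ) 0 1 = 0 := by simp [← hr]
      have h00 : (g : Matrix (Fin 2) (Fin 2) ℝ) 0 0 = r := by simp [← hr]
      have h11 : (g : Matrix (Fin 2) (Fin 2) ℝ) 1 1 = r := by simp [← hr]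
      have hdet := g.det_coe
      rw [Matrix.det_fin_two, h10, h01, h00, h11] at hdet
      have hr0 : (r : ℂ) ≠ 0 := by
        have : r ≠ 0 := by rintro rfl; simp at hdet
        exact_mod_cast this
      ext z
      simp [coe_specialLinearGroup_apply, h10, h01, h00, h11]
      field_simp)

theorem psl_mk_smul (g : SL(2, ℝ)) (z : ℍ) : (QuotientGroup.mk g : PSL(2, ℝ)) • z = g • z := rfl

/-- `Γ ⊆ PSL(2, ℝ)` has finite covolume: it has a fundamental domain in the upper half plane of
finite area for the invariant measure `dx dy / y ^ 2`. -/
def HasFiniteCovolume (Γ : Subgroup PSL(2, ℝ)) : Prop :=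
  ∃ F : Set ℍ, IsFundamentalDomain Γ F (volume : Measure ℍ) ∧ (volume : Measure ℍ) F < ⊤

/-! ## Modular and quasimodular forms -/

/-- Moderate growth: `f` is bounded by a power of `(1 + |z| ^ 2) / Im z`, which is the square of
the Hilbert-Schmidt norm of any matrix in `SL(2, ℝ)` that sends `i` to `z`. -/
def ModerateGrowth (f : ℍ → ℂ) : Prop :=
  ∃ (C : ℝ) (N : ℕ), ∀ z : ℍ, ‖f z‖ ≤ C * ((1 + ‖(z : ℂ)‖ ^ 2) / z.im) ^ N

/-- The factor `c z + d` of `γ = (a b; c d)`. -/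
def autFactor (γ : SL(2, ℝ)) (z : ℍ) : ℂ := (γ 1 0 : ℝ) * (z : ℂ) + (γ 1 1 : ℝ)

/-- `f` is a modular form of weight `k` over `Γ`. The functional equation is imposed for both
matrices that represent an element of `Γ`. -/
structure IsModularForm (Γ : Subgroup PSL(2, ℝ)) (k : ℤ) (f : ℍ → ℂ) : Prop where
  holo : MDifferentiable 𝓘(ℂ) 𝓘(ℂ) f
  growth : ModerateGrowth f
  modular : ∀ γ : SL(2, ℝ), (QuotientGroup.mk γ : PSL(2, ℝ)) ∈ Γ → ∀ z : ℍ,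
    autFactor γ z ^ (-k) * f (γ • z) = f z

/-- The polynomials `P z = ∑ j, f_j(z) X ^ j` have degree at most `p` and satisfy
`(c z + d) ^ (-k) f (γ z) = ∑ j, f_j(z) (c / (c z + d)) ^ j` for all `γ = (a b; c d)` in `Γ`. -/
structure IsExpansion (Γ : Subgroup PSL(2, ℝ)) (k : ℤ) (p : ℕ) (f : ℍ → ℂ) (P : ℍ → ℂ[X]) :
    Prop where
  natDegree_le : ∀ z : ℍ, (P z).natDegree ≤ p
  eval_eq : ∀ γ : SL(2, ℝ), (QuotientGroup.mk γ : PSL(2, ℝ)) ∈ Γ → ∀ z : ℍ,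
    autFactor γ z ^ (-k) * f (γ • z) = (P z).eval ((γ 1 0 : ℝ) / autFactor γ z)

/-- `f` is a quasimodular form of weight `k` and depth at most `p` over `Γ`. -/
structure IsQuasimodularForm (Γ : Subgroup PSL(2, ℝ)) (k : ℤ) (p : ℕ) (f : ℍ → ℂ) : Prop where
  holo : MDifferentiable 𝓘(ℂ) 𝓘(ℂ) f
  growth : ModerateGrowth f
  quasimodular : ∃ P : ℍ → ℂ[X], IsExpansion Γ k p f P

theorem base_one_le (z : ℍ) : 1 ≤ (1 + ‖(z : ℂ)‖ ^ 2) / z.im := by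
  have h1 : z.im ≤ ‖(z : ℂ)‖ := (le_abs_self _).trans (Complex.abs_im_le_norm (z : ℂ))
  rw [le_div_iff₀ z.im_pos]
  nlinarith [sq_nonneg (‖(z : ℂ)‖ - 1)]

theorem ModerateGrowth.const (c : ℂ) : ModerateGrowth (fun _ => c) :=
  ⟨‖c‖, 0, fun z => by simp⟩

theorem ModerateGrowth.add {f g : ℍ → ℂ} (hf : ModerateGrowth f) (hg : ModerateGrowth g) :
    ModerateGrowth (f + g) := by
  obtain ⟨C, N, hC⟩ := hf
  obtain ⟨C', N', hC'⟩ := hg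
  refine ⟨|C| + |C'|, N + N', fun z => ?_⟩
  have hb := base_one_le z
  set b := (1 + ‖(z : ℂ)‖ ^ 2) / z.im
  have h1 : b ^ N ≤ b ^ (N + N') := pow_le_pow_right₀ hb (by omega)
  have h2 : b ^ N' ≤ b ^ (N + N') := pow_le_pow_right₀ hb (by omega)
  have p1 : 0 ≤ b ^ N := by positivity
  have p2 : 0 ≤ b ^ N' := by positivity
  calc ‖(f + g) z‖ ≤ ‖f z‖ + ‖g z‖ := norm_add_le _ _
    _ ≤ C * b ^ N + C' * b ^ N' := add_le_add (hC z) (hC' z)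
    _ ≤ |C| * b ^ (N + N') + |C'| * b ^ (N + N') := by
        gcongr
        · exact le_abs_self C
        · exact le_abs_self C'
    _ = _ := by ring

theorem ModerateGrowth.smul (c : ℂ) {f : ℍ → ℂ} (hf : ModerateGrowth f) :
    ModerateGrowth (c • f) := by
  obtain ⟨C, N, hC⟩ := hf
  refine ⟨‖c‖ * C, N, fun z => ?_⟩
  rw [Pi.smul_apply, norm_smul, mul_assoc]
  exact mul_le_mul_of_nonneg_left (hC z) (norm_nonneg c)

theorem IsModularForm.isQuasimodularForm {Γ : Subgroup PSL(2, ℝ)} {k : ℤ} {f : ℍ → ℂ}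
    (hf : IsModularForm Γ k f) : IsQuasimodularForm Γ k 0 f :=
  ⟨hf.holo, hf.growth, fun z => Polynomial.C (f z), fun z => by simp,
    fun γ hγ z => by simpa using hf.modular γ hγ z⟩

/-- The space `M_k(Γ)` of modular forms of weight `k`. -/
def modForms (Γ : Subgroup PSL(2, ℝ)) (k : ℤ) : Submodule ℂ (ℍ → ℂ) where
  carrier := {f | IsModularForm Γ k f}
  zero_mem' := ⟨mdifferentiable_const, .const 0, by simp⟩
  add_mem' := fun {f g} hf hg => ⟨hf.holo.add hg.holo, hf.growth.add hg.growth, fun γ hγ z => by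
    rw [Pi.add_apply, mul_add, hf.modular γ hγ, hg.modular γ hγ, Pi.add_apply]⟩
  smul_mem' := fun c f hf => ⟨hf.holo.const_smul c, hf.growth.smul c, fun γ hγ z => by
    simp only [Pi.smul_apply, smul_eq_mul]
    rw [mul_left_comm, hf.modular γ hγ]⟩

/-- The space of quasimodular forms of weight `k` (and arbitrary depth). -/
def quasiForms (Γ : Subgroup PSL(2, ℝ)) (k : ℤ) : Submodule ℂ (ℍ → ℂ) where
  carrier := {f | ∃ p : ℕ, IsQuasimodularForm Γ k p f}
  zero_mem' := ⟨0, mdifferentiable_const, .const 0, 0, by simp, by simp⟩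
  add_mem' := by
    rintro f g ⟨p, hf, hf', P, hP, hP'⟩ ⟨q, hg, hg', Q, hQ, hQ'⟩
    refine ⟨max p q, hf.add hg, hf'.add hg', P + Q, fun z => ?_, fun γ hγ z => ?_⟩
    · exact (Polynomial.natDegree_add_le _ _).trans (max_le_max (hP z) (hQ z))
    · rw [Pi.add_apply, mul_add, hP' γ hγ, hQ' γ hγ, Pi.add_apply, Polynomial.eval_add]
  smul_mem' := by
    rintro c f ⟨p, hf, hf', P, hP, hP'⟩
    refine ⟨p, hf.const_smul c, hf'.smul c, c • P, fun z => ?_, fun γ hγ z => ?_⟩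
    · exact (Polynomial.natDegree_smul_le _ _).trans (hP z)
    · simp only [Pi.smul_apply, Polynomial.eval_smul, smul_eq_mul]
      rw [mul_left_comm, hP' γ hγ]

theorem modForms_le_quasiForms (Γ : Subgroup PSL(2, ℝ)) (k : ℤ) :
    modForms Γ k ≤ quasiForms Γ k :=
  fun _ hf => ⟨0, IsModularForm.isQuasimodularForm hf⟩

theorem one_mem_quasiForms (Γ : Subgroup PSL(2, ℝ)) : (fun _ => 1 : ℍ → ℂ) ∈ quasiForms Γ 0 :=
  modForms_le_quasiForms Γ 0 ⟨mdifferentiable_const, .const 1, by simp⟩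

/-- The graded space of quasimodular forms, the direct sum of the spaces of quasimodular forms of
weight `k` over all integers `k ≥ 0`. -/
def QuasiRing (Γ : Subgroup PSL(2, ℝ)) : Type := ⨁ k : ℕ, quasiForms Γ (k : ℤ)

instance (Γ : Subgroup PSL(2, ℝ)) : AddCommGroup (QuasiRing Γ) :=
  inferInstanceAs (AddCommGroup (⨁ k : ℕ, quasiForms Γ (k : ℤ)))

instance (Γ : Subgroup PSL(2, ℝ)) : Module ℂ (QuasiRing Γ) :=
  inferInstanceAs (Module ℂ (⨁ k : ℕ, quasiForms Γ (k : ℤ)))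

/-- The inclusion of the forms of weight `k` in the graded space. -/
def ofWeight {Γ : Subgroup PSL(2, ℝ)} (k : ℕ) : quasiForms Γ (k : ℤ) →ₗ[ℂ] QuasiRing Γ :=
  DirectSum.lof ℂ ℕ (fun k : ℕ => quasiForms Γ (k : ℤ)) k

/-- The derivative `f' = df/dz`. -/
def derivZ (f : ℍ → ℂ) (z : ℍ) : ℂ := deriv (f ∘ ofComplex) (z : ℂ)

/-- `g = δ f` for `f` of weight `k`: `g` is the coefficient `f_1` of `c / (c z + d)` in the
expansion of `(c z + d) ^ (-k) f (γ z)`. -/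
def IsDelta (Γ : Subgroup PSL(2, ℝ)) (k : ℤ) (f g : ℍ → ℂ) : Prop :=
  ∃ (p : ℕ) (P : ℍ → ℂ[X]), IsExpansion Γ k p f P ∧ ∀ z : ℍ, g z = (P z).coeff 1

/-! ## The Lie algebra `sl₂(ℂ)` and its action on quasimodular forms -/

/-- The Lie algebra `sl₂(ℂ)` of complex `2 × 2` matrices of trace zero. -/
abbrev SlTwo : Type := LieAlgebra.SpecialLinear.sl (Fin 2) ℂ

/-- The element `(0 1; 0 0)` of `sl₂(ℂ)`, which acts as `D`. -/
def slD : SlTwo := ⟨!![0, 1; 0, 0], by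
  simp [LieAlgebra.SpecialLinear.sl, Matrix.trace_fin_two]⟩

/-- The element `(1 0; 0 -1)` of `sl₂(ℂ)`, which acts as `H`. -/
def slH : SlTwo := ⟨!![1, 0; 0, -1], by
  simp [LieAlgebra.SpecialLinear.sl, Matrix.trace_fin_two]⟩

/-- The element `(0 0; -1 0)` of `sl₂(ℂ)`, which acts as `δ`. -/
def slDelta : SlTwo := ⟨!![0, 0; -1, 0], by
  simp [LieAlgebra.SpecialLinear.sl, Matrix.trace_fin_two]⟩

/-- The representation of `sl₂(ℂ)` given by operators with `[H, D] = 2 D`, `[H, δ] = -2 δ` and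
`[δ, D] = H`. -/
def slRep {V : Type*} [AddCommGroup V] [Module ℂ V] (D H δ : Module.End ℂ V)
    (hHD : H * D - D * H = (2 : ℂ) • D) (hHδ : H * δ - δ * H = (-2 : ℂ) • δ)
    (hδD : δ * D - D * δ = H) :
    SlTwo →ₗ⁅ℂ⁆ Module.End ℂ V where
  toFun A := A.1 0 0 • H + A.1 0 1 • D - A.1 1 0 • δ
  map_add' A B := by
    simp [add_smul]
    abel
  map_smul' c A := by simp [mul_smul, smul_add, smul_sub]
  map_lie' := by
    intro A B
    have tr : ∀ X : SlTwo, X.1 1 1 = - X.1 0 0 := fun X => by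
      have h : Matrix.trace X.1 = 0 := X.2
      rw [Matrix.trace_fin_two] at h
      linear_combination h
    have h1 : H * D = D * H + (2 : ℂ) • D := by rw [← hHD]; abel
    have h2 : H * δ = δ * H + (-2 : ℂ) • δ := by rw [← hHδ]; abel
    have h3 : δ * D = D * δ + H := by rw [← hδD]; abel
    have e : ∀ i j, (⁅A, B⁆ : SlTwo).1 i j = (A.1 * B.1 - B.1 * A.1) i j := fun i j => rfl
    simp only [e, Ring.lie_def, Matrix.sub_apply, Matrix.mul_apply, Fin.sum_univ_two, tr A, tr B]
    simp only [mul_add, add_mul, mul_sub, sub_mul, smul_mul_assoc, mul_smul_comm, h1, h2, h3,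
      smul_add]
    module

/-- `ρ` is the action of `sl₂(ℂ)` on quasimodular forms: `D` is the derivation `d/dz` and raises
the weight by `2`, `H` multiplies forms of weight `k` by `k`, and `δ` sends `f` to the coefficient
`f_1` of its expansion and lowers the weight by `2` (so that it vanishes in weights `0`, `1`). -/
structure IsQuasimodularAction (Γ : Subgroup PSL(2, ℝ))
    (ρ : SlTwo →ₗ⁅ℂ⁆ Module.End ℂ (QuasiRing Γ)) : Prop where
  D_apply : ∀ (k : ℕ) (f : quasiForms Γ (k : ℤ)),
    ∃ h : derivZ f ∈ quasiForms Γ ((k + 2 : ℕ) : ℤ),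
      ρ slD (ofWeight k f) = ofWeight (k + 2) ⟨derivZ f, h⟩
  H_apply : ∀ (k : ℕ) (f : quasiForms Γ (k : ℤ)),
    ρ slH (ofWeight k f) = (k : ℂ) • ofWeight k f
  delta_apply : ∀ (k : ℕ) (f : quasiForms Γ ((k + 2 : ℕ) : ℤ)) (g : ℍ → ℂ),
    IsDelta Γ ((k + 2 : ℕ) : ℤ) f g →
      ∃ h : g ∈ quasiForms Γ (k : ℤ), ρ slDelta (ofWeight (k + 2) f) = ofWeight k ⟨g, h⟩
  delta_apply_of_lt_two : ∀ (k : ℕ) (_ : k < 2) (f : quasiForms Γ (k : ℤ)) (g : ℍ → ℂ),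
    IsDelta Γ (k : ℤ) f g → g = 0 ∧ ρ slDelta (ofWeight k f) = 0

/-! ## The modules `𝒰_k` and `Û_2` -/

/-- `D x_j = x_{j+1}`, on the space with basis `x_j = Finsupp.single j 1`. -/
def verD : Module.End ℂ (ℕ →₀ ℂ) :=
  Finsupp.linearCombination ℂ fun j => Finsupp.single (j + 1) 1

/-- `H x_j = (k + 2 j) x_j`. -/
def verH (k : ℕ) : Module.End ℂ (ℕ →₀ ℂ) :=
  Finsupp.linearCombination ℂ fun j => ((k : ℂ) + 2 * j) • Finsupp.single j 1

/-- `δ x_j = j (k + j - 1) x_{j-1}` for `j ≥ 1`, and `δ x_0 = 0`. -/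
def verDelta (k : ℕ) : Module.End ℂ (ℕ →₀ ℂ) :=
  Finsupp.linearCombination ℂ fun j => ((j : ℂ) * (k + j - 1)) • Finsupp.single (j - 1) 1

theorem verD_single (j : ℕ) (a : ℂ) :
    verD (Finsupp.single j a) = a • Finsupp.single (j + 1) 1 := by
  simp [verD, -Finsupp.smul_single]

theorem verH_single (k j : ℕ) (a : ℂ) :
    verH k (Finsupp.single j a) = (a * (k + 2 * j)) • Finsupp.single j 1 := by
  simp [verH, -Finsupp.smul_single, smul_smul]

theorem verDelta_single (k j : ℕ) (a : ℂ) :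
    verDelta k (Finsupp.single j a) = (a * (j * (k + j - 1))) • Finsupp.single (j - 1) 1 := by
  simp [verDelta, -Finsupp.smul_single, smul_smul]

theorem verH_verD (k : ℕ) : verH k * verD - verD * verH k = (2 : ℂ) • verD := by
  ext j : 2
  simp only [LinearMap.comp_apply, Finsupp.lsingle_apply, LinearMap.sub_apply, Module.End.mul_apply,
    LinearMap.smul_apply, verD_single, verH_single, map_smul, one_smul, one_mul]
  push_cast
  module

theorem verH_verDelta (k : ℕ) :
    verH k * verDelta k - verDelta k * verH k = (-2 : ℂ) • verDelta k := by
  ext j : 2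
  simp only [LinearMap.comp_apply, Finsupp.lsingle_apply, LinearMap.sub_apply, Module.End.mul_apply,
    LinearMap.smul_apply, verDelta_single, verH_single, map_smul, one_mul]
  cases j with
  | zero => simp
  | succ j =>
    simp only [Nat.add_sub_cancel]
    push_cast
    module

theorem verDelta_verD (k : ℕ) : verDelta k * verD - verD * verDelta k = verH k := by
  ext j : 2
  simp only [LinearMap.comp_apply, Finsupp.lsingle_apply, LinearMap.sub_apply, Module.End.mul_apply,
    verDelta_single, verH_single, verD_single, map_smul, one_mul, one_smul, Nat.add_sub_cancel]
  cases j with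
  | zero => simp
  | succ j =>
    simp only [Nat.add_sub_cancel]
    push_cast
    module

/-- The representation on the space with basis `(x_j)` that defines `𝒰_k` for `k ≥ 1`. -/
def verRep (k : ℕ) : SlTwo →ₗ⁅ℂ⁆ Module.End ℂ (ℕ →₀ ℂ) :=
  slRep verD (verH k) (verDelta k) (verH_verD k) (verH_verDelta k) (verDelta_verD k)

/-- The space of `𝒰_k`: the space with basis `x_0, x_1, …` for `k ≥ 1`, and `ℂ` for `k = 0`. -/
def LowestWeight : ℕ → Type
  | 0 => ℂ
  | _ + 1 => ℕ →₀ ℂ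

instance : ∀ k : ℕ, AddCommGroup (LowestWeight k)
  | 0 => inferInstanceAs (AddCommGroup ℂ)
  | _ + 1 => inferInstanceAs (AddCommGroup (ℕ →₀ ℂ))

instance : ∀ k : ℕ, Module ℂ (LowestWeight k)
  | 0 => inferInstanceAs (Module ℂ ℂ)
  | _ + 1 => inferInstanceAs (Module ℂ (ℕ →₀ ℂ))

/-- The representation of `sl₂(ℂ)` on `𝒰_k`; it is trivial for `k = 0`. -/
def lowestWeightRep : ∀ k : ℕ, SlTwo →ₗ⁅ℂ⁆ Module.End ℂ (LowestWeight k)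
  | 0 => 0
  | k + 1 => verRep (k + 1)

instance (k : ℕ) : LieRingModule SlTwo (LowestWeight k) :=
  LieRingModule.compLieHom (LowestWeight k) (lowestWeightRep k)

instance (k : ℕ) : LieModule ℂ SlTwo (LowestWeight k) :=
  LieModule.compLieHom (LowestWeight k) (lowestWeightRep k)

/-- The vector `x_j` of `𝒰_k`; for `k = 0`, `x_0 = 1` and `x_j = 0` for `j ≥ 1`. -/
def lowestWeightVec : ∀ (k : ℕ) (_ : ℕ), LowestWeight k
  | 0, 0 => (1 : ℂ)
  | 0, _ + 1 => (0 : ℂ)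
  | _ + 1, j => (Finsupp.single j 1 : ℕ →₀ ℂ)

/-- The space `Û_2 = ℂ ⊕ 𝒰_2`, with basis `1, x̂_0, x̂_1, …`. -/
def ExtTwo : Type := ℂ × (ℕ →₀ ℂ)

instance : AddCommGroup ExtTwo := inferInstanceAs (AddCommGroup (ℂ × (ℕ →₀ ℂ)))

instance : Module ℂ ExtTwo := inferInstanceAs (Module ℂ (ℂ × (ℕ →₀ ℂ)))

/-- The basis vector `1` of `Û_2`. -/
def extOne : ExtTwo := ((1 : ℂ), (0 : ℕ →₀ ℂ))

/-- The basis vector `x̂_j` of `Û_2`. -/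
def extVec (j : ℕ) : ExtTwo := ((0 : ℂ), (Finsupp.single j 1 : ℕ →₀ ℂ))

/-- The representation on `Û_2`: the operators `D`, `H`, `δ` vanish on `1` and act on `x̂_j` as they
do on the vector `x_j` of `𝒰_2`, except that `δ x̂_0 = 1`. -/
def extRep : SlTwo →ₗ⁅ℂ⁆ Module.End ℂ (ℂ × (ℕ →₀ ℂ)) :=
  slRep
    ((0 : (ℂ × (ℕ →₀ ℂ)) →ₗ[ℂ] ℂ).prod (verD ∘ₗ LinearMap.snd ℂ ℂ (ℕ →₀ ℂ)))
    ((0 : (ℂ × (ℕ →₀ ℂ)) →ₗ[ℂ] ℂ).prod (verH 2 ∘ₗ LinearMap.snd ℂ ℂ (ℕ →₀ ℂ)))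
    ((Finsupp.lapply 0 ∘ₗ LinearMap.snd ℂ ℂ (ℕ →₀ ℂ)).prod
      (verDelta 2 ∘ₗ LinearMap.snd ℂ ℂ (ℕ →₀ ℂ)))
    (LinearMap.ext fun v => Prod.ext (by simp) (by
      simpa using LinearMap.congr_fun (verH_verD 2) v.2))
    (by
      have h : ∀ w : ℕ →₀ ℂ, (verH 2 w) 0 = 2 * w 0 := fun w => by
        induction w using Finsupp.induction_linear with
        | zero => simp
        | add f g hf hg => simp [hf, hg, mul_add]
        | single j a =>
          rw [verH_single]
          cases j <;> simp [mul_comm]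
      exact LinearMap.ext fun v => Prod.ext (by simp [h]) (by
        simpa using LinearMap.congr_fun (verH_verDelta 2) v.2))
    (by
      have h : ∀ w : ℕ →₀ ℂ, (verD w) 0 = 0 := fun w => by
        induction w using Finsupp.induction_linear with
        | zero => simp
        | add f g hf hg => simp [hf, hg]
        | single j a => simp [verD_single]
      exact LinearMap.ext fun v => Prod.ext (by simp [h]) (by
        simpa using LinearMap.congr_fun (verDelta_verD 2) v.2))

instance : LieRingModule SlTwo ExtTwo :=
  LieRingModule.compLieHom (ℂ × (ℕ →₀ ℂ)) extRep

instance : LieModule ℂ SlTwo ExtTwo :=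
  LieModule.compLieHom (ℂ × (ℕ →₀ ℂ)) extRep

/-- The `sl₂(ℂ)`-module `M_k(Γ) ⊗ 𝒰_k`, with the trivial action on the factor `M_k(Γ)`. -/
abbrev Isotypic (Γ : Subgroup PSL(2, ℝ)) (k : ℕ) : Type :=
  TrivialLieModule ℂ SlTwo (modForms Γ (k : ℤ)) ⊗[ℂ] LowestWeight k

/-- The element `f ⊗ x_j` of `M_k(Γ) ⊗ 𝒰_k`. -/
def isoTensor {Γ : Subgroup PSL(2, ℝ)} (k j : ℕ) (f : modForms Γ (k : ℤ)) : Isotypic Γ k :=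
  (TrivialLieModule.equiv ℂ SlTwo (modForms Γ (k : ℤ))).symm f ⊗ₜ[ℂ] lowestWeightVec k j

/-- A modular form of weight `k`, as a homogeneous element of the graded space of quasimodular
forms. -/
def ofModular {Γ : Subgroup PSL(2, ℝ)} (k : ℕ) (f : modForms Γ (k : ℤ)) : QuasiRing Γ :=
  ofWeight k ⟨f, modForms_le_quasiForms Γ k f.2⟩

end

/-! ## Automorphy factors -/

/-! The representation theory is formal once two facts about Γ are known: at each z the ratio
c/(cz+d) takes infinitely many values, and modular forms of negative weight vanish while those of
weight 0 are constant. Both come straight from the finite covolume, without cusps.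

First fact (`infinite_lowerRatio`). The ratio separates cosets of the upper triangular subgroup.
Were these finitely many in Γ, that subgroup would itself have a fundamental domain of finite area;
but x + iy ↦ x + 2iy commutes with it and halves areas, while all fundamental domains have equal
area. Hence expansions are unique, Lagrange interpolation in c/(cz+d) shows that the f_j are
holomorphic of moderate growth, and the cocycle relation makes f_j quasimodular of weight k − 2j
(`IsExpansion.coeff`).

Second fact (`IsModularForm.exists_eq_of_nonpos`). In weight −m the function u = log(1 + |f|²
y^(−m)) is Γ-invariant, is at most its mean over hyperbolic balls, and is bounded by a linear
function of the distance to i. Integrating the mean value inequality over a fundamental domain of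
finite area, against a cutoff, forces equality (`exists_lintegral_ball_eq`); the case of equality
makes f constant, and zero if m > 0 (`eq_of_integral_le_logHeight`).

Consequences: the top coefficient of a form of depth p is modular of weight k − 2p, so quasimodular
forms of negative weight vanish; the kernel of δ consists of the modular forms; δ sends weight 2 to
constants, whence the dichotomy. Differentiating the expansion gives [δ, D] = H.

Finally, δ is locally nilpotent on both sides, so bijectivity of an intertwining map is decided by
the kernel and the range of δ (`injective_of_intertwining`, `surjective_of_intertwining`). The
kernel is M_k ⊗ x_0 in M_k ⊗ 𝒰_k and ℂ·1 in Û_2. For k ≥ 1 the numbers j(k+j−1), j ≥ 1, are nonzero,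
so δ is onto; the only obstruction is 𝒰_0. It is harmless if δ vanishes on weight 2, and in Û_2 it
disappears because δ x̂_0 = 1. -/

theorem autFactor_ne_zero (γ : SL(2, ℝ)) (z : ℍ) : autFactor γ z ≠ 0 :=
  denom_ne_zero γ z

theorem SL_coe_smul (γ : SL(2, ℝ)) (z : ℍ) :
    ((γ • z : ℍ) : ℂ) = ((γ 0 0 : ℝ) * (z : ℂ) + (γ 0 1 : ℝ)) / autFactor γ z :=
  coe_specialLinearGroup_apply γ z

theorem SL_det_eq (γ : SL(2, ℝ)) : γ 0 0 * γ 1 1 - γ 0 1 * γ 1 0 = 1 := by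
  have := γ.det_coe
  rwa [Matrix.det_fin_two] at this

theorem SL_mul_lower_left (γ δ : SL(2, ℝ)) :
    (γ * δ) 1 0 = γ 1 0 * δ 0 0 + γ 1 1 * δ 1 0 := by
  simp [Matrix.mul_apply, Fin.sum_univ_two]

theorem SL_mul_lower_right (γ δ : SL(2, ℝ)) :
    (γ * δ) 1 1 = γ 1 0 * δ 0 1 + γ 1 1 * δ 1 1 := by
  simp [Matrix.mul_apply, Fin.sum_univ_two]

theorem autFactor_mul (γ δ : SL(2, ℝ)) (z : ℍ) :
    autFactor (γ * δ) z = autFactor γ (δ • z) * autFactor δ z := by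
  have h := autFactor_ne_zero δ z
  rw [autFactor, autFactor, SL_coe_smul, SL_mul_lower_left, SL_mul_lower_right]
  field_simp
  rw [autFactor]
  push_cast
  ring

/-- The quantity `c / (c z + d)`. -/
noncomputable def lowerRatio (γ : SL(2, ℝ)) (z : ℍ) : ℂ := (γ 1 0 : ℝ) / autFactor γ z

/-- The ratio c/(cz+d) is the logarithmic derivative of cz+d, so this is the logarithmic derivative
of `autFactor_mul`; here it is verified by algebra from det δ = 1. -/
theorem lowerRatio_mul (γ δ : SL(2, ℝ)) (z : ℍ) :
    lowerRatio (γ * δ) z = lowerRatio γ (δ • z) * autFactor δ z ^ (-2 : ℤ) + lowerRatio δ z := by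
  have h := autFactor_ne_zero δ z
  have h' := autFactor_ne_zero γ (δ • z)
  have hd : ((δ 0 0 : ℝ) : ℂ) * (δ 1 1 : ℝ) - (δ 0 1 : ℝ) * (δ 1 0 : ℝ) = 1 := by
    exact_mod_cast SL_det_eq δ
  rw [lowerRatio, lowerRatio, lowerRatio, autFactor_mul, SL_mul_lower_left, zpow_neg]
  have e : autFactor γ (δ • z) * autFactor δ z =
      (γ 1 0 : ℝ) * ((δ 0 0 : ℝ) * (z : ℂ) + (δ 0 1 : ℝ)) + (γ 1 1 : ℝ) * autFactor δ z := by
    rw [autFactor, SL_coe_smul]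
    field_simp
  have e2 : autFactor δ z = (δ 1 0 : ℝ) * (z : ℂ) + (δ 1 1 : ℝ) := rfl
  field_simp
  push_cast
  have e' : autFactor γ (δ • z) * autFactor δ z * ((δ 1 0 : ℝ) : ℂ) =
      ((γ 1 0 : ℝ) * ((δ 0 0 : ℝ) * (z : ℂ) + (δ 0 1 : ℝ)) + (γ 1 1 : ℝ) * autFactor δ z) *
        (δ 1 0 : ℝ) := by rw [e]
  linear_combination (-1 : ℂ) * e' + (γ 1 0 : ℝ) * (δ 0 0 : ℝ) * e2 + (γ 1 0 : ℝ) * hd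

/-- The right side does not involve z: elements with distinct ratios at one point have distinct
ratios at every point. -/
theorem lowerRatio_eq_iff (γ δ : SL(2, ℝ)) (z : ℍ) :
    lowerRatio γ z = lowerRatio δ z ↔ (γ * δ⁻¹) 1 0 = 0 := by
  have h := autFactor_ne_zero δ z
  have h' := autFactor_ne_zero γ z
  have e : (γ * δ⁻¹) 1 0 = γ 1 0 * δ 1 1 - γ 1 1 * δ 1 0 := by
    rw [SL_mul_lower_left]
    rw [Matrix.SpecialLinearGroup.SL2_inv_expl]
    change γ 1 0 * δ 1 1 + γ 1 1 * (-δ 1 0) = _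
    ring
  rw [e, lowerRatio, lowerRatio, div_eq_div_iff h' h, autFactor, autFactor, ← Complex.ofReal_inj]
  push_cast
  constructor <;> intro H <;> linear_combination H

theorem SL_im_smul (γ : SL(2, ℝ)) (z : ℍ) : (γ • z).im = z.im / ‖autFactor γ z‖ ^ 2 := by
  have := UpperHalfPlane.im_smul_eq_div_normSq (γ : GL (Fin 2) ℝ) z
  rw [Complex.normSq_eq_norm_sq] at this
  rw [Matrix.SpecialLinearGroup.coeToGL_det, Units.val_one, abs_one, one_mul] at this
  exact this

/-! ## The action of `PSL(2, ℝ)` on the upper half plane -/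

instance : IsIsometricSMul PSL(2, ℝ) ℍ :=
  ⟨fun g => by
    induction g using QuotientGroup.induction_on with
    | H γ => exact isometry_smul ℍ γ⟩

instance : SMulInvariantMeasure SL(2, ℝ) ℍ volume :=
  ⟨fun γ _ hs => measure_preimage_smul_of_nullMeasurableSet (G := GL (Fin 2) ℝ)
    hs.nullMeasurableSet (γ : GL (Fin 2) ℝ)⟩

instance : SMulInvariantMeasure PSL(2, ℝ) ℍ volume :=
  ⟨fun g s hs => by
    induction g using QuotientGroup.induction_on with
    | H γ => exact SMulInvariantMeasure.measure_preimage_smul γ hs⟩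

instance : MeasurableConstSMul PSL(2, ℝ) ℍ :=
  ⟨fun g => (isometry_smul ℍ g).continuous.measurable⟩

instance : MeasurableConstSMul SL(2, ℝ) ℍ :=
  ⟨fun g => (isometry_smul ℍ g).continuous.measurable⟩

instance : SecondCountableTopology SL(2, ℝ) :=
  haveI : SecondCountableTopology (Matrix (Fin 2) (Fin 2) ℝ) :=
    inferInstanceAs (SecondCountableTopology (Fin 2 → Fin 2 → ℝ))
  (Topology.IsInducing.subtypeVal (t := fun A : Matrix (Fin 2) (Fin 2) ℝ => A.det = 1)).secondCountableTopology

instance : SecondCountableTopology PSL(2, ℝ) :=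
  inferInstanceAs (SecondCountableTopology (SL(2, ℝ) ⧸ Subgroup.center SL(2, ℝ)))

/-- Discreteness serves to make Γ countable, as sums over Γ and unions of null sets require. -/
theorem countable_of_discrete (Γ : Subgroup PSL(2, ℝ)) (h : DiscreteTopology Γ) : Countable Γ :=
  TopologicalSpace.separableSpace_iff_countable.mp inferInstance

instance (Γ : Subgroup PSL(2, ℝ)) : IsIsometricSMul Γ ℍ :=
  ⟨fun g => isometry_smul ℍ (g : PSL(2, ℝ))⟩

/-! ## Finitely many cosets of the upper triangular subgroup -/

open scoped Pointwise in
/-- A union of translates of a fundamental domain is a fundamental domain of a subgroup of finite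
index. -/
theorem exists_isFundamentalDomain_of_finite_quotient {G α : Type*} [Group G] [Countable G]
    [MulAction G α] [MeasurableSpace α] {μ : Measure α} [MeasurableConstSMul G α]
    [SMulInvariantMeasure G α μ] {F : Set α} (hF : IsFundamentalDomain G F μ) (hfin : μ F < ⊤)
    (K : Subgroup G) [Finite (G ⧸ K)] :
    ∃ F' : Set α, IsFundamentalDomain K F' μ ∧ μ F' < ⊤ := by
  have := Fintype.ofFinite (G ⧸ K)
  -- The q.out represent the left cosets gK; their inverses represent the cosets Kg, which is what a
  -- domain for K needs.
  refine ⟨⋃ q : G ⧸ K, (q.out)⁻¹ • F, ⟨?_, ?_, ?_⟩, ?_⟩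
  · exact NullMeasurableSet.iUnion fun q => hF.nullMeasurableSet_smul _
  · filter_upwards [hF.ae_covers] with x ⟨g, hg⟩
    have hk : (QuotientGroup.mk g : G ⧸ K).out⁻¹ * g ∈ K := by
      rw [← QuotientGroup.eq, QuotientGroup.out_eq']
    refine ⟨⟨_, hk⟩, Set.mem_iUnion.mpr ⟨QuotientGroup.mk g, ?_⟩⟩
    rw [Subgroup.mk_smul, mul_smul]
    exact Set.smul_mem_smul_set hg
  · intro k k' hkk'
    simp only [Function.onFun, Set.smul_set_iUnion, AEDisjoint.iUnion_left_iff,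
      AEDisjoint.iUnion_right_iff]
    intro q' q
    have : (k : G) * q.out⁻¹ ≠ (k' : G) * q'.out⁻¹ := by
      intro h
      have h' : q'.out = q.out * ((k : G)⁻¹ * k') := by
        rw [← inv_inj, ← mul_right_inj (k' : G), ← h]
        group
      have hq : q = q' := by
        rw [← QuotientGroup.out_eq' q, ← QuotientGroup.out_eq' q']
        refine (QuotientGroup.eq).mpr ?_
        rw [h', inv_mul_cancel_left]
        exact K.mul_mem (K.inv_mem k.2) k'.2
      subst hq
      exact hkk' (Subtype.ext (mul_right_cancel h))
    simpa only [Subgroup.smul_def, smul_smul] using hF.aedisjoint this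
  · refine (measure_iUnion_le _).trans_lt ?_
    simp only [measure_smul]
    rw [tsum_fintype]
    exact ENNReal.sum_lt_top.mpr fun _ _ => hfin

/-- The map `x + i y ↦ x + 2 i y`. -/
noncomputable def vertScale : ℍ ≃ ℍ where
  toFun z := ⟨⟨z.re, 2 * z.im⟩, by simpa using z.im_pos⟩
  invFun z := ⟨⟨z.re, z.im / 2⟩, by simpa using z.im_pos⟩
  left_inv z := by ext; apply Complex.ext <;> simp
  right_inv z := by ext; apply Complex.ext <;> simp; ring

theorem continuous_vertScale_symm : Continuous vertScale.symm := by
  refine isEmbedding_coe.continuous_iff.mpr ?_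
  refine (Complex.equivRealProdCLM.symm.continuous.comp
    (continuous_re.prodMk (continuous_im.div_const 2))).congr fun z => ?_
  apply Complex.ext <;> simp [vertScale]

instance : Measure.IsOpenPosMeasure (volume : Measure ℍ) :=
  ⟨fun U hU hne => by
    rw [volume_eq_lintegral]
    refine (setLIntegral_pos_iff (by fun_prop)).mpr ?_ |>.ne'
    rw [Set.inter_eq_self_of_subset_right]
    · exact (isOpenEmbedding_coe.isOpenMap U hU).measure_pos _ (hne.image _)
    · rintro _ ⟨z, -, rfl⟩
      simp [z.im_ne_zero]⟩

/-- The Jacobian is 2, while the density y^(−2) is divided by 4. -/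
theorem volume_image_vertScale {s : Set ℍ} (hs : MeasurableSet s) :
    volume (vertScale '' s) = 2⁻¹ * volume s := by
  let L : ℂ →L[ℝ] ℂ := LinearMap.toContinuousLinearMap
    (Matrix.toLin Complex.basisOneI Complex.basisOneI !![1, 0; 0, 2])
  have hL : ∀ z : ℂ, L z = ⟨z.re, 2 * z.im⟩ := by
    intro z
    simp [L, Matrix.toLin_apply, Matrix.mulVec, dotProduct, Fin.sum_univ_two]
    apply Complex.ext <;> simp
  have hdet : L.det = 2 := by
    simp [L, ContinuousLinearMap.det, Matrix.det_fin_two]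
  have hinj : Function.Injective L := by
    intro z w h
    rw [hL, hL] at h
    simpa [Complex.ext_iff] using h
  have main := lintegral_image_eq_lintegral_abs_det_fderiv_mul volume
    (measurableEmbedding_coe.measurableSet_image.mpr hs)
    (fun z _ => L.hasFDerivWithinAt) hinj.injOn (fun z ↦ ↑((1 / ‖z.im‖₊) ^ 2 : NNReal))
  have himg : UpperHalfPlane.coe '' (vertScale '' s) = L '' (UpperHalfPlane.coe '' s) := by
    simp only [Set.image_image]
    refine Set.image_congr fun z _ => ?_
    rw [hL]
    rfl
  rw [volume_eq_lintegral, volume_eq_lintegral, himg, main,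
    ← lintegral_const_mul' _ _ (by simp)]
  refine lintegral_congr fun z => ?_
  have h2 : ‖(2 : ℝ)‖₊ = 2 := by ext; simp
  have h3 : ENNReal.ofReal |2| = ((2 : NNReal) : ENNReal) := by simp
  rw [hdet, hL, h3, show (2⁻¹ : ENNReal) = ((2⁻¹ : NNReal) : ENNReal) by simp, ← ENNReal.coe_mul,
    ← ENNReal.coe_mul]
  congr 1
  rw [nnnorm_mul, h2, one_div, one_div, mul_inv, mul_pow]
  field_simp

/-- The subgroup of classes of upper triangular matrices. -/
def upperTriangular : Subgroup PSL(2, ℝ) :=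
  Subgroup.map (QuotientGroup.mk' (Subgroup.center SL(2, ℝ)))
    { carrier := {γ : SL(2, ℝ) | γ 1 0 = 0}
      one_mem' := by simp
      mul_mem' := fun {γ δ} (hγ : γ 1 0 = 0) (hδ : δ 1 0 = 0) => by
        change (γ * δ) 1 0 = 0
        rw [SL_mul_lower_left, hγ, hδ, zero_mul, mul_zero, add_zero]
      inv_mem' := fun {γ} (hγ : γ 1 0 = 0) => by
        change γ⁻¹ 1 0 = 0
        rw [Matrix.SpecialLinearGroup.SL2_inv_expl]
        change -γ 1 0 = 0
        rw [hγ, neg_zero] }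

theorem mk_mem_upperTriangular_iff (γ : SL(2, ℝ)) :
    (QuotientGroup.mk γ : PSL(2, ℝ)) ∈ upperTriangular ↔ γ 1 0 = 0 := by
  constructor
  · rintro ⟨δ, hδ : δ 1 0 = 0, h⟩
    obtain ⟨r, -, hr⟩ := Matrix.SpecialLinearGroup.mem_center_iff.mp
      ((QuotientGroup.eq (s := Subgroup.center SL(2, ℝ))).mp h)
    have h10 : (δ⁻¹ * γ) 1 0 = 0 := by simp [← hr]
    rw [← mul_inv_cancel_left δ γ, SL_mul_lower_left, h10, hδ, zero_mul, mul_zero, add_zero]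
  · exact fun h => ⟨γ, h, rfl⟩

/-- Upper triangular matrices act by z ↦ (az + b)/d, which scales x and y by the same real factor
and translates x only. -/
theorem vertScale_smul (γ : SL(2, ℝ)) (h : γ 1 0 = 0) (z : ℍ) :
    vertScale (γ • z) = γ • vertScale z := by
  have hd := SL_det_eq γ
  rw [h, mul_zero, sub_zero] at hd
  have h1 : γ 1 1 ≠ 0 := by rintro h; simp [h] at hd
  have e : ∀ w : ℍ, ((γ • w : ℍ) : ℂ) = ⟨(γ 0 0 * w.re + γ 0 1) / γ 1 1, γ 0 0 * w.im / γ 1 1⟩ := by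
    intro w
    rw [SL_coe_smul, autFactor, h]
    have : ((γ 1 1 : ℝ) : ℂ) ≠ 0 := by exact_mod_cast h1
    simp only [Complex.ofReal_zero, zero_mul, zero_add]
    apply Complex.ext <;> simp
  ext
  rw [e]
  change (⟨(γ • z : ℍ).re, 2 * (γ • z : ℍ).im⟩ : ℂ) = _
  rw [← coe_re, ← coe_im, e]
  apply Complex.ext <;> simp [vertScale]
  ring

/-- A discrete group of finite covolume contains infinitely many cosets of its upper triangular
subgroup. -/
theorem infinite_quotient_upperTriangular (Γ : Subgroup PSL(2, ℝ)) [Countable Γ]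
    (hcov : HasFiniteCovolume Γ) : Infinite (Γ ⧸ upperTriangular.subgroupOf Γ) := by
  by_contra hfin
  rw [not_infinite_iff_finite] at hfin
  obtain ⟨F, hF, hFfin⟩ := hcov
  obtain ⟨F', hF', hF'fin⟩ :=
    exists_isFundamentalDomain_of_finite_quotient hF hFfin (upperTriangular.subgroupOf Γ)
  have hmeas : Measurable vertScale.symm := continuous_vertScale_symm.measurable
  have hmap : Measure.map vertScale.symm volume = (2⁻¹ : ENNReal) • (volume : Measure ℍ) := by
    ext s hs
    rw [Measure.map_apply hmeas hs, ← Equiv.image_eq_preimage_symm, volume_image_vertScale hs]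
    simp
  have hqmp : Measure.QuasiMeasurePreserving vertScale.symm (volume : Measure ℍ) volume :=
    ⟨hmeas, hmap ▸ Measure.smul_absolutelyContinuous⟩
  have hF'' : IsFundamentalDomain (upperTriangular.subgroupOf Γ) (vertScale '' F')
      (volume : Measure ℍ) := by
    refine hF'.image_of_equiv vertScale hqmp (Equiv.refl _) ?_
    rintro ⟨⟨g, hg⟩, hg'⟩ z
    obtain ⟨γ, rfl⟩ := QuotientGroup.mk_surjective g
    exact vertScale_smul γ ((mk_mem_upperTriangular_iff γ).mp hg') z
  have h1 := hF'.measure_eq hF''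
  -- Both domains have the same area, yet one has half the area of the other; this is impossible for
  -- a positive finite number.
  have h2 : 2⁻¹ * volume F' = volume F' := by
    conv_rhs => rw [h1, Equiv.image_eq_preimage_symm,
      ← Measure.map_apply₀ hmeas.aemeasurable (hmap ▸ hF'.nullMeasurableSet.smul_measure _), hmap]
    simp
  have h0 : volume F' ≠ 0 := hF'.measure_ne_zero (NeZero.ne _)
  have h3 := (ENNReal.mul_eq_right h0 hF'fin.ne).mp h2
  simp at h3

/-- For every point `z`, the ratio `c / (c z + d)` takes infinitely many values on a discrete
group of finite covolume. -/
theorem infinite_lowerRatio (Γ : Subgroup PSL(2, ℝ)) [Countable Γ]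
    (hcov : HasFiniteCovolume Γ) (z : ℍ) :
    {x | ∃ γ : SL(2, ℝ), (QuotientGroup.mk γ : PSL(2, ℝ)) ∈ Γ ∧ lowerRatio γ z = x}.Infinite := by
  have := infinite_quotient_upperTriangular Γ hcov
  let rep : Γ → SL(2, ℝ) := fun g => (QuotientGroup.mk_surjective (g : PSL(2, ℝ))).choose
  have hrep : ∀ g : Γ, (QuotientGroup.mk (rep g) : PSL(2, ℝ)) = g :=
    fun g => (QuotientGroup.mk_surjective (g : PSL(2, ℝ))).choose_spec
  -- `lowerRatio` separates the cosets Bγ of the upper triangular group B, whereas the quotient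
  -- consists of cosets γB; hence the inverse.
  let F : Γ ⧸ upperTriangular.subgroupOf Γ → ℂ := fun q => lowerRatio (rep q.out⁻¹) z
  refine (Set.infinite_range_of_injective (f := F) fun q q' h => ?_).mono ?_
  · have h' := (mk_mem_upperTriangular_iff _).mpr ((lowerRatio_eq_iff _ _ z).mp h)
    rw [QuotientGroup.mk_mul, QuotientGroup.mk_inv, hrep, hrep] at h'
    rw [← QuotientGroup.out_eq' q, ← QuotientGroup.out_eq' q']
    refine QuotientGroup.eq.mpr ?_
    rw [Subgroup.mem_subgroupOf]
    simpa using h'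
  · rintro _ ⟨q, rfl⟩
    exact ⟨_, (hrep _).symm ▸ (q.out⁻¹).2, rfl⟩

/-! ## A Liouville theorem for groups of finite covolume -/

section Liouville

open Filter Topology
open scoped ENNReal

variable {G α : Type*} [Group G] [MulAction G α] [PseudoMetricSpace α] [IsIsometricSMul G α]
  {o : α} {u : α → ℝ} {C N : ℝ}

theorem infDist_orbit_smul (g : G) (x : α) :
    Metric.infDist (g • x) (MulAction.orbit G o) = Metric.infDist x (MulAction.orbit G o) := by
  have h := Metric.infDist_image (isometry_smul α g) (x := x) (t := MulAction.orbit G o)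
  rwa [Set.image_smul, MulAction.smul_orbit] at h

/-- By invariance of u, the point o may be replaced by any point of its orbit, and the infimum
taken. -/
theorem le_of_infDist_orbit (hN : 0 ≤ N) (hu : ∀ (g : G) x, u (g • x) = u x)
    (hle : ∀ x, u x ≤ C + N * dist o x) (x : α) :
    u x ≤ C + N * Metric.infDist x (MulAction.orbit G o) := by
  refine le_of_forall_pos_le_add fun ε hε => ?_
  obtain ⟨_, ⟨g, rfl⟩, hy⟩ := (Metric.infDist_lt_iff (MulAction.nonempty_orbit (M := G) o)).mp
    (lt_add_of_pos_right (Metric.infDist x (MulAction.orbit G o))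
      (show 0 < ε / (N + 1) by positivity))
  have h1 := hle (g⁻¹ • x)
  rw [hu, dist_comm, ← dist_smul g, smul_inv_smul] at h1
  have h2 : N * (ε / (N + 1)) ≤ ε := by
    rw [mul_div_assoc', div_le_iff₀ (by positivity)]
    nlinarith
  nlinarith [mul_le_mul_of_nonneg_left hy.le hN]

variable [Countable G] [MeasurableSpace α] [BorelSpace α]
  {μ : Measure α} [SFinite μ] [SMulInvariantMeasure G α μ] {F : Set α}

/-- Unfolding: write the inner integral as a sum over G of integrals over F, exchange by Tonelli,
and fold back in the other variable. -/
theorem lintegral_lintegral_swap_of_invariant {F : Set α} (hF : IsFundamentalDomain G F μ)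
    {Φ : α → α → ℝ≥0∞} (hΦ : Measurable (Function.uncurry Φ))
    (hinv : ∀ (g : G) x y, Φ (g • x) (g • y) = Φ x y) :
    ∫⁻ x in F, ∫⁻ y, Φ x y ∂μ ∂μ = ∫⁻ y in F, ∫⁻ x, Φ x y ∂μ ∂μ := by
  have hm : ∀ g : G, Measurable fun x : α => g • x :=
    fun g => (isometry_smul α g).continuous.measurable
  have h1 : ∀ g : G, Measurable (Function.uncurry fun x y => Φ (g • x) y) := fun g =>
    hΦ.comp (((hm g).comp measurable_fst).prodMk measurable_snd)
  have h1' : ∀ g : G, Measurable (Function.uncurry fun y x => Φ (g • x) y) := fun g =>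
    hΦ.comp (((hm g).comp measurable_snd).prodMk measurable_fst)
  calc ∫⁻ x in F, ∫⁻ y, Φ x y ∂μ ∂μ
      = ∫⁻ x in F, ∑' g : G, ∫⁻ y in F, Φ (g • x) y ∂μ ∂μ := by
        refine lintegral_congr fun x => ?_
        rw [hF.lintegral_eq_tsum']
        refine tsum_congr fun g => lintegral_congr fun y => ?_
        rw [← hinv g x, smul_inv_smul]
    _ = ∑' g : G, ∫⁻ x in F, ∫⁻ y in F, Φ (g • x) y ∂μ ∂μ :=
        lintegral_tsum fun g => (h1 g).lintegral_prod_right'.aemeasurable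
    _ = ∑' g : G, ∫⁻ y in F, ∫⁻ x in F, Φ (g • x) y ∂μ ∂μ :=
        tsum_congr fun g => lintegral_lintegral_swap (h1 g).aemeasurable
    _ = ∫⁻ y in F, ∑' g : G, ∫⁻ x in F, Φ (g • x) y ∂μ ∂μ :=
        (lintegral_tsum fun g => (h1' g).lintegral_prod_right'.aemeasurable).symm
    _ = ∫⁻ y in F, ∫⁻ x, Φ x y ∂μ ∂μ :=
        lintegral_congr fun y => (hF.lintegral_eq_tsum'' fun x => Φ x y).symm

variable [SecondCountableTopology α]

/-- The defect B − V u is nonnegative, where B is the ball integral. Since the kernel of B is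
symmetric, the integral of the defect over F against a cutoff η_n equals that of u times the defect
of η_n. The cutoff depends on the distance r to the orbit of o with slope 1/(n+1), so its defect is
at most V T/(n+1), and is nonpositive where r ≥ n+1+T. Where r is smaller, u is O(n): the product
stays bounded and tends to 0 pointwise, and F has finite measure. -/
theorem ae_lintegral_ball_eq (hF : IsFundamentalDomain G F μ) (hFfin : μ F < ⊤)
    (hcont : Continuous u) (h0 : ∀ x, 0 ≤ u x) (hC : 0 ≤ C) (hN : 0 ≤ N)
    (hu : ∀ (g : G) x, u (g • x) = u x) (hle : ∀ x, u x ≤ C + N * dist o x)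
    {T : ℝ} (hT : 0 ≤ T) {V : ℝ≥0∞} (hVtop : V ≠ ⊤) (hV : ∀ x, μ (Metric.ball x T) = V)
    (hsub : ∀ x, V * ENNReal.ofReal (u x) ≤ ∫⁻ y in Metric.ball x T, ENNReal.ofReal (u y) ∂μ) :
    ∀ᵐ x ∂μ.restrict F,
      ∫⁻ y in Metric.ball x T, ENNReal.ofReal (u y) ∂μ = V * ENNReal.ofReal (u x) := by
  set r : α → ℝ := fun x => Metric.infDist x (MulAction.orbit G o) with hr
  set U : α → ℝ≥0∞ := fun x => ENNReal.ofReal (u x) with hU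
  set B : α → ℝ≥0∞ := fun x => ∫⁻ y in Metric.ball x T, U y ∂μ with hB
  have hrc : Continuous r := Metric.continuous_infDist_pt _
  have hr0 : ∀ x, 0 ≤ r x := fun x => Metric.infDist_nonneg
  have hrg : ∀ (g : G) x, r (g • x) = r x := infDist_orbit_smul
  have hUm : Measurable U := (ENNReal.continuous_ofReal.comp hcont).measurable
  -- `ENNReal.ofReal` cuts off at 0, so η n is supported in r ≤ n+1.
  let η : ℕ → α → ℝ≥0∞ := fun n x => ENNReal.ofReal (1 - r x / (n + 1))
  have hηm : ∀ n, Measurable (η n) := fun n =>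
    (ENNReal.continuous_ofReal.comp (by fun_prop)).measurable
  let K : α → α → ℝ≥0∞ := fun x y => (Metric.ball x T).indicator 1 y
  have hKm : Measurable (Function.uncurry K) := by
    have : Function.uncurry K = Set.indicator {p : α × α | dist p.2 p.1 < T} 1 := by
      ext ⟨x, y⟩; simp [K, Set.indicator, Function.uncurry]
    rw [this]
    exact measurable_one.indicator
      (isOpen_lt (continuous_snd.dist continuous_fst) continuous_const).measurableSet
  have hKsymm : ∀ x y, K x y = K y x := fun x y => by
    simp [K, Set.indicator, dist_comm]
  have hKg : ∀ (g : G) x y, K (g • x) (g • y) = K x y := fun g x y => by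
    simp [K, Set.indicator, dist_smul]
  have hKint : ∀ x (f : α → ℝ≥0∞), ∫⁻ y, K x y * f y ∂μ = ∫⁻ y in Metric.ball x T, f y ∂μ := by
    intro x f
    rw [← lintegral_indicator Metric.isOpen_ball.measurableSet]
    refine lintegral_congr fun y => ?_
    by_cases hy : y ∈ Metric.ball x T <;> simp [K, hy]
  have hBm : Measurable B := by
    have : B = fun x => ∫⁻ y, K x y * U y ∂μ := funext fun x => (hKint x U).symm
    rw [this]
    exact (hKm.mul (hUm.comp measurable_snd)).lintegral_prod_right'
  have hbound : ∀ x, u x ≤ C + N * r x := le_of_infDist_orbit hN hu hle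
  let E : ℕ → α → ℝ≥0∞ := fun n x =>
    {x | r x < n + 1 + T}.indicator (fun x => U x * ENNReal.ofReal (T / (n + 1))) x
  have hEm : ∀ n, Measurable (E n) := fun n =>
    (hUm.mul_const _).indicator (isOpen_lt hrc continuous_const).measurableSet
  have hswap : ∀ n, ∫⁻ x in F, η n x * B x ∂μ =
      ∫⁻ x in F, U x * ∫⁻ y in Metric.ball x T, η n y ∂μ ∂μ := by
    intro n
    have := lintegral_lintegral_swap_of_invariant hF (Φ := fun x y => η n x * (K x y * U y))
      (((hηm n).comp measurable_fst).mul (hKm.mul (hUm.comp measurable_snd)))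
      (fun g x y => by simp only [η, U, hKg, hrg, hu])
    calc _ = _ := lintegral_congr fun x => by
            rw [show B x = _ from (hKint x U).symm, ← lintegral_const_mul]
            exact (hKm.comp measurable_prodMk_left).mul hUm
      _ = _ := this
      _ = _ := lintegral_congr fun y => by
            rw [← hKint, ← lintegral_const_mul]
            · refine lintegral_congr fun x => ?_
              rw [hKsymm]; ring
            · exact (hKm.comp measurable_prodMk_left).mul (hηm n)
  have hηball : ∀ n x, U x * ∫⁻ y in Metric.ball x T, η n y ∂μ ≤ V * (η n x * U x) + V * E n x := by
    intro n x
    have hn : (0 : ℝ) < n + 1 := by positivity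
    by_cases hx : r x < n + 1 + T
    · have h1 : ∀ y ∈ Metric.ball x T, η n y ≤ η n x + ENNReal.ofReal (T / (n + 1)) := by
        intro y hy
        have h2 : r x ≤ r y + dist x y := Metric.infDist_le_infDist_add_dist
        rw [Metric.mem_ball, dist_comm] at hy
        refine (ENNReal.ofReal_le_ofReal ?_).trans ENNReal.ofReal_add_le
        have : r x / (n + 1) ≤ r y / (n + 1) + T / (n + 1) := by
          rw [← add_div]; gcongr; linarith
        linarith
      calc U x * ∫⁻ y in Metric.ball x T, η n y ∂μ
          ≤ U x * ∫⁻ y in Metric.ball x T, (η n x + ENNReal.ofReal (T / (n + 1))) ∂μ := by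
            exact mul_le_mul_right (setLIntegral_mono measurable_const h1) _
        _ = _ := by
            rw [setLIntegral_const, hV]
            simp only [E, Set.indicator, Set.mem_ofPred_eq, if_pos hx]
            ring
    · have h1 : ∀ y ∈ Metric.ball x T, η n y = 0 := by
        intro y hy
        have h2 : r x ≤ r y + dist x y := Metric.infDist_le_infDist_add_dist
        rw [Metric.mem_ball, dist_comm] at hy
        refine ENNReal.ofReal_of_nonpos ?_
        rw [sub_nonpos, le_div_iff₀ hn]
        linarith
      rw [setLIntegral_congr_fun Metric.isOpen_ball.measurableSet h1]
      simp
  -- Finiteness is needed to subtract integrals in `ℝ≥0∞`; on the support of η n, u is at most C +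
  -- N(n+1).
  have hηU : ∀ n, ∫⁻ x in F, V * (η n x * U x) ∂μ ≠ ⊤ := by
    intro n
    have hn : (0 : ℝ) < n + 1 := by positivity
    have h1 : ∀ x, V * (η n x * U x) ≤ V * ENNReal.ofReal (C + N * (n + 1)) := by
      intro x
      gcongr
      rw [← ENNReal.ofReal_mul' (h0 x)]
      by_cases hx : r x < n + 1
      · refine ENNReal.ofReal_le_ofReal ?_
        have : 1 - r x / (n + 1) ≤ 1 := by
          have : 0 ≤ r x / (n + 1) := div_nonneg (hr0 x) hn.le
          linarith
        nlinarith [h0 x, hbound x, mul_le_mul_of_nonneg_left hx.le hN]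
      · have : 1 - r x / (n + 1) ≤ 0 := by
          rw [sub_nonpos, le_div_iff₀ hn]; linarith
        rw [ENNReal.ofReal_of_nonpos (mul_nonpos_of_nonpos_of_nonneg this (h0 x))]
        exact zero_le
    refine ((lintegral_mono h1).trans_lt ?_).ne
    rw [setLIntegral_const]
    exact ENNReal.mul_lt_top (ENNReal.mul_lt_top hVtop.lt_top ENNReal.ofReal_lt_top) hFfin
  have hdiff : ∀ n, ∫⁻ x in F, η n x * (B x - V * U x) ∂μ ≤ V * ∫⁻ x in F, E n x ∂μ := by
    intro n
    have e : ∀ x, η n x * (B x - V * U x) = η n x * B x - V * (η n x * U x) := by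
      intro x
      rw [ENNReal.mul_sub fun _ _ => ENNReal.ofReal_ne_top, mul_left_comm]
    simp_rw [e]
    rw [lintegral_sub (by fun_prop) (hηU n), hswap, tsub_le_iff_left, ← lintegral_const_mul _ (hEm n),
      ← lintegral_add_left (by fun_prop)]
    · exact lintegral_mono (hηball n)
    · refine Eventually.of_forall fun x => ?_
      calc V * (η n x * U x) = η n x * (V * U x) := by ring
        _ ≤ _ := mul_le_mul_right (hsub x) _
  have hElim : Tendsto (fun n => ∫⁻ x in F, E n x ∂μ) atTop (𝓝 0) := by
    have := tendsto_lintegral_of_dominated_convergence (μ := μ.restrict F) (F := E) (f := 0)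
      -- The dominating constant: (C + N(n+1+T)) · T/(n+1) ≤ T(C + N(1+T)).
      (fun _ => ENNReal.ofReal (T * (C + N * (1 + T)))) hEm ?_ ?_ ?_
    · simpa using this
    · intro n
      refine Eventually.of_forall fun x => ?_
      by_cases hx : r x < n + 1 + T
      · simp only [E, Set.indicator, Set.mem_ofPred_eq, if_pos hx, U]
        rw [← ENNReal.ofReal_mul (h0 x)]
        refine ENNReal.ofReal_le_ofReal ?_
        have hn : (0 : ℝ) < n + 1 := by positivity
        have hn1 : (1 : ℝ) ≤ n + 1 := by simp
        rw [mul_div_assoc', div_le_iff₀ hn, mul_comm, mul_assoc]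
        refine mul_le_mul_of_nonneg_left ?_ hT
        have h1 := mul_le_mul_of_nonneg_left hx.le hN
        have h2 : C ≤ C * (n + 1) := le_mul_of_one_le_right hC hn1
        have h3 : N * T ≤ N * T * (n + 1) := le_mul_of_one_le_right (by positivity) hn1
        nlinarith [hbound x]
      · simp [E, Set.indicator, hx]
    · rw [setLIntegral_const]
      exact (ENNReal.mul_lt_top ENNReal.ofReal_lt_top hFfin).ne
    · refine Eventually.of_forall fun x => ?_
      have h1 : Tendsto (fun n : ℕ => U x * ENNReal.ofReal (T / (n + 1))) atTop (𝓝 0) := by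
        have h2 : Tendsto (fun n : ℕ => ENNReal.ofReal (T / (n + 1))) atTop (𝓝 0) := by
          rw [← ENNReal.ofReal_zero]
          refine (ENNReal.continuous_ofReal.tendsto 0).comp ?_
          have := (tendsto_one_div_add_atTop_nhds_zero_nat (𝕜 := ℝ)).const_mul T
          simpa [div_eq_mul_inv] using this
        simpa using ENNReal.Tendsto.const_mul h2 (Or.inr ENNReal.ofReal_ne_top)
      refine tendsto_of_tendsto_of_tendsto_of_le_of_le tendsto_const_nhds h1
        (fun _ => zero_le) fun n => ?_
      exact Set.indicator_le_self _ (fun x => U x * ENNReal.ofReal (T / (n + 1))) x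
  have hzero : ∀ n, ∫⁻ x in F, η n x * (B x - V * U x) ∂μ = 0 := by
    intro n
    have hVE : Tendsto (fun m => V * ∫⁻ x in F, E m x ∂μ) atTop (𝓝 0) := by
      simpa using ENNReal.Tendsto.const_mul hElim (Or.inr hVtop)
    refine le_antisymm (ge_of_tendsto hVE ?_) zero_le
    -- The cutoffs increase with the index, so the integral for n is at most that for m ≥ n, which
    -- tends to 0.
    filter_upwards [eventually_ge_atTop n] with m hm
    refine le_trans (lintegral_mono fun x => ?_) (hdiff m)
    gcongr
    refine ENNReal.ofReal_le_ofReal (sub_le_sub_left ?_ _)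
    have : (n : ℝ) ≤ m := by exact_mod_cast hm
    exact div_le_div_of_nonneg_left (hr0 x) (by positivity) (by linarith)
  have hae : ∀ᵐ x ∂μ.restrict F, ∀ n, η n x * (B x - V * U x) = 0 := by
    rw [ae_all_iff]
    exact fun n => (lintegral_eq_zero_iff ((hηm n).mul (hBm.sub (hUm.const_mul V)))).mp (hzero n)
  filter_upwards [hae] with x hx
  obtain ⟨n, hn⟩ := exists_nat_gt (r x)
  have hη0 : η n x ≠ 0 := by
    rw [ne_eq, ENNReal.ofReal_eq_zero, not_le, sub_pos, div_lt_one (by positivity)]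
    linarith
  exact le_antisymm (tsub_eq_zero_iff_le.mp ((mul_eq_zero.mp (hx n)).resolve_left hη0)) (hsub x)

/-- For an invariant function `u ≥ 0` of linear growth on a space with a fundamental domain of
finite measure, the inequality between `u` and its averages over balls is an equality for the
balls of integral radius around some point. -/
theorem exists_lintegral_ball_eq [NeZero μ] (hF : IsFundamentalDomain G F μ) (hFfin : μ F < ⊤)
    (hcont : Continuous u) (h0 : ∀ x, 0 ≤ u x) (hC : 0 ≤ C) (hN : 0 ≤ N)
    (hu : ∀ (g : G) x, u (g • x) = u x) (hle : ∀ x, u x ≤ C + N * dist o x)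
    {V : ℕ → ℝ≥0∞} (hVtop : ∀ T, V T ≠ ⊤) (hV : ∀ (T : ℕ) x, μ (Metric.ball x T) = V T)
    (hsub : ∀ (T : ℕ) x,
      V T * ENNReal.ofReal (u x) ≤ ∫⁻ y in Metric.ball x T, ENNReal.ofReal (u y) ∂μ) :
    ∃ x, ∀ T : ℕ,
      ∫⁻ y in Metric.ball x T, ENNReal.ofReal (u y) ∂μ = V T * ENNReal.ofReal (u x) := by
  have h : ∀ᵐ x ∂μ.restrict F, ∀ T : ℕ,
      ∫⁻ y in Metric.ball x T, ENNReal.ofReal (u y) ∂μ = V T * ENNReal.ofReal (u x) :=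
    ae_all_iff.mpr fun T => ae_lintegral_ball_eq hF hFfin hcont h0 hC hN hu hle T.cast_nonneg
      (hVtop T) (hV T) (hsub T)
  have : NeZero (μ.restrict F) := ⟨by
    rw [ne_eq, Measure.restrict_eq_zero]
    exact hF.measure_ne_zero (NeZero.ne μ)⟩
  exact h.exists

end Liouville

/-! ## A sharpened mean value inequality on the unit circle -/

section Circle

open Metric Real ComplexConjugate

/-- A lower bound for `log (1 + ‖b‖ ^ 2)` that touches it at `b = a` to second order; its averages
along circles in the image of a holomorphic function are at least its value at the centre. -/
noncomputable def logMinorant (a b : ℂ) : ℝ :=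
  Real.log (1 + ‖b‖ ^ 2) - ‖b - a‖ ^ 2 / ((1 + ‖a‖ ^ 2) * (1 + ‖b‖ ^ 2))

theorem logMinorant_le (a b : ℂ) : logMinorant a b ≤ Real.log (1 + ‖b‖ ^ 2) :=
  sub_le_self _ (by positivity)

theorem eq_of_log_le_logMinorant {a b : ℂ} (h : Real.log (1 + ‖b‖ ^ 2) ≤ logMinorant a b) :
    b = a := by
  have h1 : ‖b - a‖ ^ 2 / ((1 + ‖a‖ ^ 2) * (1 + ‖b‖ ^ 2)) ≤ 0 := by
    rw [logMinorant] at h; linarith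
  have h2 : ‖b - a‖ ^ 2 / ((1 + ‖a‖ ^ 2) * (1 + ‖b‖ ^ 2)) = 0 :=
    le_antisymm h1 (by positivity)
  rw [div_eq_zero_iff, or_iff_left (by positivity)] at h2
  simpa [sub_eq_zero] using h2

theorem continuous_logMinorant (a : ℂ) : Continuous (logMinorant a) := by
  unfold logMinorant
  refine Continuous.sub (Continuous.log (by fun_prop) fun b => by positivity)
    (Continuous.div (by fun_prop) (by fun_prop) fun b => by positivity)

/-- Lagrange's identity for the vectors (1, a) and (1, b) of ℂ². -/
theorem lagrange_norm_identity (a b : ℂ) :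
    (1 + ‖a‖ ^ 2) * (1 + ‖b‖ ^ 2) = ‖1 + conj a * b‖ ^ 2 + ‖b - a‖ ^ 2 := by
  simp only [← Complex.normSq_eq_norm_sq, Complex.normSq_apply]
  simp
  ring

/-- This is log t ≤ t − 1 for t = ‖1 + āb‖²/((1+‖a‖²)(1+‖b‖²)), because Lagrange's identity computes
1 − t. The left side is a constant plus twice the logarithm of the modulus of a function holomorphic
in b. -/
theorem log_norm_le_logMinorant (a b : ℂ) :
    2 * Real.log ‖1 + conj a * b‖ - Real.log (1 + ‖a‖ ^ 2) ≤ logMinorant a b := by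
  have hid := lagrange_norm_identity a b
  set s := 1 + ‖a‖ ^ 2 with hs
  set t := 1 + ‖b‖ ^ 2 with ht
  have hs1 : 1 ≤ s := by simp [hs]
  have ht1 : 1 ≤ t := by simp [ht]
  have hst : 0 < s * t := by positivity
  have hlog : Real.log (s * t) = Real.log s + Real.log t := Real.log_mul (by positivity) (by positivity)
  change _ ≤ Real.log t - ‖b - a‖ ^ 2 / (s * t)
  by_cases hH : ‖1 + conj a * b‖ = 0
  -- Here `Real.log 0 = 0` replaces −∞, so the case needs an argument: ‖a‖‖b‖ = 1 gives st ≥ 4 > e.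
  · rw [hH, Real.log_zero]
    rw [hH] at hid
    have h1 : ‖b - a‖ ^ 2 / (s * t) = 1 := by
      rw [hid]; simp; rintro h; rw [hid, h] at hst; simp at hst
    have hab : ‖a‖ * ‖b‖ = 1 := by
      have : conj a * b = -1 := by
        rw [norm_eq_zero] at hH; linear_combination hH
      have := congrArg norm this
      simpa using this
    have h4 : 4 ≤ s * t := by
      have : s * t = 1 + ‖a‖ ^ 2 + ‖b‖ ^ 2 + (‖a‖ * ‖b‖) ^ 2 := by rw [hs, ht]; ring
      rw [this, hab]
      nlinarith [sq_nonneg (‖a‖ - ‖b‖)]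
    have h5 : 1 ≤ Real.log (s * t) := by
      rw [Real.le_log_iff_exp_le hst]
      linarith [Real.exp_one_lt_d9]
    linarith
  · have hpos : 0 < ‖1 + conj a * b‖ ^ 2 := by positivity
    have h1 := Real.log_le_sub_one_of_pos (div_pos hpos hst)
    rw [Real.log_div hpos.ne' hst.ne', Real.log_pow, hlog] at h1
    have h2 : ‖1 + conj a * b‖ ^ 2 / (s * t) = 1 - ‖b - a‖ ^ 2 / (s * t) := by
      rw [eq_sub_iff_add_eq, ← add_div, ← hid, div_self hst.ne']
    push_cast at h1
    linarith

/-- By Jensen's formula the average exceeds the central value by the sum of log(1/|u|) over the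
zeros u in the disc. -/
theorem log_norm_le_circleAverage {f : ℂ → ℂ} (hf : AnalyticOnNhd ℂ f (closedBall 0 1))
    (h0 : f 0 ≠ 0) : Real.log ‖f 0‖ ≤ circleAverage (fun z => Real.log ‖f z‖) 0 1 := by
  have h := AnalyticOnNhd.circleAverage_log_norm (R := 1) one_ne_zero (by simpa using hf) h0
  rw [h]
  refine le_add_of_nonneg_left (finsum_nonneg fun u => ?_)
  by_cases hu : u ∈ closedBall (0 : ℂ) |1|
  · refine mul_nonneg
      (mod_cast MeromorphicOn.AnalyticOnNhd.divisor_nonneg (by simpa using hf) u) ?_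
    rw [zero_sub, norm_neg, one_mul, Real.log_inv, neg_nonneg]
    exact Real.log_nonpos (norm_nonneg _) (by simpa using hu)
  · rw [Function.locallyFinsuppWithin.apply_eq_zero_of_notMem _ hu]
    simp

/-- The function 1 + conj(g 0)·g takes the value 1 + ‖g 0‖² at 0, where `log_norm_le_logMinorant` is
an equality; Jensen's inequality applies to it. -/
theorem le_circleAverage_logMinorant {g : ℂ → ℂ} (hg : AnalyticOnNhd ℂ g (closedBall 0 1)) :
    Real.log (1 + ‖g 0‖ ^ 2) ≤ circleAverage (fun z => logMinorant (g 0) (g z)) 0 1 := by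
  have hH : AnalyticOnNhd ℂ (fun z => 1 + conj (g 0) * g z) (closedBall 0 1) :=
    analyticOnNhd_const.add (analyticOnNhd_const.mul hg)
  have h0 : 1 + conj (g 0) * g 0 = ((1 + ‖g 0‖ ^ 2 : ℝ) : ℂ) := by
    rw [← Complex.normSq_eq_conj_mul_self, Complex.normSq_eq_norm_sq]; push_cast; ring
  have hne : (1 + ‖g 0‖ ^ 2 : ℝ) ≠ 0 := by positivity
  have h1 := log_norm_le_circleAverage hH (by rw [h0]; exact_mod_cast hne)
  rw [h0, Complex.norm_real, Real.norm_of_nonneg (by positivity)] at h1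
  have hint : CircleIntegrable (fun z => Real.log ‖1 + conj (g 0) * g z‖) 0 1 :=
    MeromorphicOn.circleIntegrable_log_norm
      (hH.mono (by simpa using sphere_subset_closedBall)).meromorphicOn
  have hcont : ContinuousOn (fun z => logMinorant (g 0) (g z)) (sphere 0 1) :=
    (continuous_logMinorant _).comp_continuousOn (hg.continuousOn.mono sphere_subset_closedBall)
  have hint2 : CircleIntegrable (fun z => 2 * Real.log ‖1 + conj (g 0) * g z‖) 0 1 :=
    hint.const_mul 2
  have h2 : circleAverage (fun z => 2 * Real.log ‖1 + conj (g 0) * g z‖ -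
      Real.log (1 + ‖g 0‖ ^ 2)) 0 1 ≤ circleAverage (fun z => logMinorant (g 0) (g z)) 0 1 :=
    circleAverage_mono (CircleIntegrable.sub hint2 (circleIntegrable_const _ _ _))
      (hcont.circleIntegrable zero_le_one) fun z _ => log_norm_le_logMinorant _ _
  rw [circleAverage_fun_sub hint2 (circleIntegrable_const _ _ _), circleAverage_const] at h2
  have h3 : circleAverage (fun z => 2 * Real.log ‖1 + conj (g 0) * g z‖) 0 1 =
      2 * circleAverage (fun z => Real.log ‖1 + conj (g 0) * g z‖) 0 1 :=
    circleAverage_fun_smul (a := (2 : ℝ))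
  linarith

end Circle

/-! ## Rotations around the point `i` -/

section Rotation

open Metric Real

/-- The rotation around `i` by the angle `θ`. -/
noncomputable def rotI (θ : ℝ) : SL(2, ℝ) :=
  ⟨!![cos (θ / 2), sin (θ / 2); -sin (θ / 2), cos (θ / 2)], by
    rw [Matrix.det_fin_two_of]
    linear_combination cos_sq_add_sin_sq (θ / 2)⟩

theorem continuous_rotI : Continuous rotI := by
  refine Continuous.subtype_mk (continuous_matrix fun i j => ?_) _
  fin_cases i <;> fin_cases j <;> simp <;> fun_prop

/-- The Cayley transform from the upper half plane to the unit disc. -/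
noncomputable def cayley (z : ℍ) : ℂ := (z - Complex.I) / (z + Complex.I)

/-- The inverse of the Cayley transform. -/
noncomputable def cayleyInv (w : ℂ) : ℂ := Complex.I * (1 + w) / (1 - w)

theorem add_I_ne_zero (z : ℍ) : (z : ℂ) + Complex.I ≠ 0 := by
  intro h
  have := congrArg Complex.im h
  simp at this
  linarith [z.im_pos]

theorem cayley_I : cayley I = 0 := by simp [cayley]

theorem one_sub_cayley (z : ℍ) : 1 - cayley z = 2 * Complex.I / (z + Complex.I) := by
  have := add_I_ne_zero z
  rw [cayley]
  field_simp
  ring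

theorem one_sub_cayley_ne_zero (z : ℍ) : 1 - cayley z ≠ 0 := by
  rw [one_sub_cayley]
  exact div_ne_zero (mul_ne_zero two_ne_zero Complex.I_ne_zero) (add_I_ne_zero z)

theorem cayleyInv_cayley (z : ℍ) : cayleyInv (cayley z) = z := by
  have := add_I_ne_zero z
  rw [cayleyInv, one_sub_cayley, cayley]
  have := Complex.I_ne_zero
  field_simp
  ring

theorem one_sub_norm_sq_cayley (z : ℍ) :
    1 - ‖cayley z‖ ^ 2 = z.im * ‖1 - cayley z‖ ^ 2 := by
  have h := add_I_ne_zero z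
  have h' : ‖(z : ℂ) + Complex.I‖ ^ 2 ≠ 0 := by positivity
  rw [one_sub_cayley, cayley, norm_div, norm_div, div_pow, div_pow, mul_div_assoc',
    one_sub_div h', div_left_inj' h']
  simp only [← Complex.normSq_eq_norm_sq, Complex.normSq_apply]
  simp
  ring

theorem norm_cayley_lt_one (z : ℍ) : ‖cayley z‖ < 1 := by
  have h : 0 < 1 - ‖cayley z‖ ^ 2 := by
    rw [one_sub_norm_sq_cayley]
    exact mul_pos z.im_pos (pow_pos (norm_pos_iff.mpr (one_sub_cayley_ne_zero z)) 2)
  nlinarith [norm_nonneg (cayley z)]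

theorem cayleyInv_im_pos {w : ℂ} (hw : ‖w‖ < 1) : 0 < (cayleyInv w).im := by
  have h1 : 1 - w ≠ 0 := by
    intro h
    rw [sub_eq_zero] at h
    simp [← h] at hw
  have h2 : (cayleyInv w).im = (1 - ‖w‖ ^ 2) / ‖1 - w‖ ^ 2 := by
    rw [cayleyInv, Complex.div_im]
    simp only [← Complex.normSq_eq_norm_sq]
    rw [← sub_div]
    congr 1
    simp [Complex.normSq_apply]
    ring
  rw [h2]
  have : ‖w‖ ^ 2 < 1 := by nlinarith [norm_nonneg w]
  have : 0 < 1 - ‖w‖ ^ 2 := by linarith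
  positivity

/-- Up to the automorphy factor, `rotI θ` multiplies z − i by e^(iθ/2) and z + i by e^(−iθ/2). -/
theorem cayley_rotI_smul (θ : ℝ) (z : ℍ) : cayley (rotI θ • z) = circleMap 0 1 θ * cayley z := by
  have h := add_I_ne_zero z
  have h' := add_I_ne_zero (rotI θ • z)
  have hj := autFactor_ne_zero (rotI θ) z
  have e : ((rotI θ • z : ℍ) : ℂ) * autFactor (rotI θ) z =
      Complex.cos (θ / 2) * z + Complex.sin (θ / 2) := by
    rw [SL_coe_smul, div_mul_cancel₀ _ hj]
    simp [rotI]
  have ej : autFactor (rotI θ) z = -Complex.sin (θ / 2) * z + Complex.cos (θ / 2) := by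
    simp [autFactor, rotI]
  have hexp : circleMap 0 1 θ = (Complex.cos (θ / 2) + Complex.sin (θ / 2) * Complex.I) ^ 2 := by
    rw [← Complex.exp_mul_I, ← Complex.exp_nat_mul, circleMap]
    simp
    congr 1; ring
  have hcs := Complex.sin_sq_add_cos_sq (θ / 2)
  rw [cayley, cayley, hexp, ← mul_div_assoc, div_eq_div_iff h' h, ← mul_left_inj' hj]
  have hk : (Complex.cos (θ / 2) + Complex.sin (θ / 2) * Complex.I) *
      (Complex.cos (θ / 2) - Complex.sin (θ / 2) * Complex.I) = 1 := by
    linear_combination hcs - Complex.sin (θ / 2) ^ 2 * Complex.I_sq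
  have hA : ((rotI θ • z : ℍ) - Complex.I) * autFactor (rotI θ) z =
      (Complex.cos (θ / 2) + Complex.sin (θ / 2) * Complex.I) * (z - Complex.I) := by
    linear_combination e - Complex.I * ej + Complex.sin (θ / 2) * Complex.I_sq
  have hB : ((rotI θ • z : ℍ) + Complex.I) * autFactor (rotI θ) z =
      (Complex.cos (θ / 2) - Complex.sin (θ / 2) * Complex.I) * (z + Complex.I) := by
    linear_combination e + Complex.I * ej + Complex.sin (θ / 2) * Complex.I_sq
  linear_combination (z + Complex.I) * hA -
    (Complex.cos (θ / 2) + Complex.sin (θ / 2) * Complex.I) ^ 2 * (z - Complex.I) * hB -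
    (Complex.cos (θ / 2) + Complex.sin (θ / 2) * Complex.I) * (z - Complex.I) *
      (z + Complex.I) * hk

theorem rotI_smul_I (θ : ℝ) : rotI θ • I = I := by
  have h := cayley_rotI_smul θ I
  rw [cayley_I, mul_zero, ← cayley_I] at h
  ext
  rw [← cayleyInv_cayley, h, cayleyInv_cayley]

end Rotation

/-! ## The mean value inequality on the upper half plane -/

section MeanValue

open Metric Real

/-- The function `log (1 + |f| ^ 2 y ^ (-m))`, which is invariant for `f` of weight `-m`. -/
noncomputable def logHeight (m : ℕ) (f : ℍ → ℂ) (z : ℍ) : ℝ :=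
  Real.log (1 + ‖f z‖ ^ 2 / z.im ^ m)

/-- The function `f (z) (1 - w) ^ m` of the disc coordinate `w` of `z`. -/
noncomputable def discForm (m : ℕ) (f : ℍ → ℂ) (z : ℍ) : ℂ := f z * (1 - cayley z) ^ m

theorem logHeight_eq (m : ℕ) (f : ℍ → ℂ) (z : ℍ) :
    logHeight m f z = Real.log (1 + ‖discForm m f z‖ ^ 2 / (1 - ‖cayley z‖ ^ 2) ^ m) := by
  have h : ‖1 - cayley z‖ ≠ 0 := norm_ne_zero_iff.mpr (one_sub_cayley_ne_zero z)
  have := z.im_pos.ne'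
  rw [logHeight, discForm, one_sub_norm_sq_cayley, norm_mul, norm_pow, mul_pow, mul_pow]
  congr 2
  field_simp
  ring

/-- In the disc the height is that of `discForm` with the square of the modulus divided by
(1−|w|²)^m ≤ 1. Equality holds at the centre; the loss elsewhere rules out nonzero forms when m > 0.
-/
theorem log_discForm_le_logHeight (m : ℕ) (f : ℍ → ℂ) (z : ℍ) :
    Real.log (1 + ‖discForm m f z‖ ^ 2) ≤ logHeight m f z := by
  rw [logHeight_eq]
  have h := norm_cayley_lt_one z
  have h1 : 0 < 1 - ‖cayley z‖ ^ 2 := by nlinarith [norm_nonneg (cayley z)]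
  have h2 : (1 - ‖cayley z‖ ^ 2) ^ m ≤ 1 :=
    pow_le_one₀ h1.le (by nlinarith [norm_nonneg (cayley z)])
  refine Real.log_le_log (by positivity) ?_
  gcongr
  rw [le_div_iff₀ (by positivity)]
  exact mul_le_of_le_one_right (by positivity) h2

variable {m : ℕ} {f : ℍ → ℂ}

theorem logHeight_I_le_circle (hf : MDifferentiable 𝓘(ℂ) 𝓘(ℂ) f) (z : ℍ) :
    2 * π * logHeight m f I ≤
      ∫ θ in (0 : ℝ)..2 * π, logMinorant (f I) (discForm m f (rotI θ • z)) := by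
  set w := cayley z with hw
  have hw1 : ‖w‖ < 1 := norm_cayley_lt_one z
  -- `discForm` on the disc, pulled back along ζ ↦ ζw. As |w| < 1, it is holomorphic near the closed
  -- unit disc; the unit circle runs through the rotations of z, and the centre is i.
  let g : ℂ → ℂ := fun ζ => f (ofComplex (cayleyInv (ζ * w))) * (1 - ζ * w) ^ m
  have hopen : IsOpen {ζ : ℂ | ‖ζ * w‖ < 1} := isOpen_lt (by fun_prop) continuous_const
  have hdiff : DifferentiableOn ℂ g {ζ : ℂ | ‖ζ * w‖ < 1} := by
    refine DifferentiableOn.mul ?_ (by fun_prop)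
    have hc : DifferentiableOn ℂ (fun ζ => cayleyInv (ζ * w)) {ζ : ℂ | ‖ζ * w‖ < 1} := by
      unfold cayleyInv
      refine DifferentiableOn.div (by fun_prop) (by fun_prop) fun ζ hζ h => ?_
      rw [sub_eq_zero] at h
      have hζ' : ‖ζ * w‖ < 1 := hζ
      simp [← h] at hζ'
    exact (UpperHalfPlane.mdifferentiable_iff.mp hf).comp hc fun ζ hζ => cayleyInv_im_pos hζ
  have hg : AnalyticOnNhd ℂ g (closedBall 0 1) := by
    refine (hdiff.analyticOnNhd hopen).mono fun ζ hζ => ?_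
    rw [mem_closedBall, dist_zero_right] at hζ
    change ‖ζ * w‖ < 1
    rw [norm_mul]
    nlinarith [norm_nonneg w, norm_nonneg ζ]
  have hrot : ∀ θ : ℝ, g (circleMap 0 1 θ) = discForm m f (rotI θ • z) := by
    intro θ
    simp only [g, discForm, hw, ← cayley_rotI_smul, cayleyInv_cayley, ofComplex_apply]
  have hg0 : g 0 = f I := by
    have : cayleyInv 0 = (I : ℍ) := by rw [← cayley_I, cayleyInv_cayley]
    simp only [g, zero_mul, this, ofComplex_apply, sub_zero, one_pow, mul_one]
  have h := le_circleAverage_logMinorant hg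
  rw [hg0, Real.circleAverage_def, smul_eq_mul, ← div_eq_inv_mul, le_div_iff₀ (by positivity)] at h
  simp only [hrot] at h
  have e : logHeight m f I = Real.log (1 + ‖f I‖ ^ 2) := by simp [logHeight]
  rw [e, mul_comm]
  exact h

theorem continuous_logHeight (hf : Continuous f) : Continuous (logHeight m f) := by
  unfold logHeight
  refine Continuous.log (continuous_const.add (Continuous.div (by fun_prop)
    (continuous_im.pow m) fun z => (pow_pos z.im_pos m).ne')) fun z => ?_
  have := z.im_pos
  positivity

theorem logHeight_nonneg (m : ℕ) (f : ℍ → ℂ) (z : ℍ) : 0 ≤ logHeight m f z := by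
  have := z.im_pos
  exact Real.log_nonneg (le_add_of_nonneg_right (by positivity))

theorem continuous_discForm (hf : Continuous f) : Continuous (discForm m f) := by
  unfold discForm cayley
  refine hf.mul ((continuous_const.sub (Continuous.div ?_ ?_ add_I_ne_zero)).pow m)
  · exact continuous_coe.sub continuous_const
  · exact continuous_coe.add continuous_const

theorem integrableOn_ball {g : ℍ → ℝ} (hg : Continuous g) (x : ℍ) (T : ℝ) :
    IntegrableOn g (ball x T) :=
  (hg.continuousOn.integrableOn_compact (isCompact_closedBall x T)).mono_set ball_subset_closedBall

theorem setIntegral_ball_smul (g : ℍ → ℝ) (γ : SL(2, ℝ)) (x : ℍ) (T : ℝ) :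
    ∫ z in ball x T, g (γ • z) = ∫ z in ball (γ • x) T, g z := by
  have hp : MeasurePreserving (fun z : ℍ => γ • z) volume volume := measurePreserving_smul γ _
  have he : MeasurableEmbedding (fun z : ℍ => γ • z) := measurableEmbedding_const_smul γ
  rw [← hp.setIntegral_preimage_emb he g, preimage_smul_ball, inv_smul_smul]

theorem continuous_rotI_smul {P : ℍ → ℝ} (hP : Continuous P) :
    Continuous (Function.uncurry fun (θ : ℝ) (z : ℍ) => P (rotI θ • z)) :=
  hP.comp ((continuous_rotI.comp continuous_fst).smul continuous_snd)

theorem continuous_integral_rotI {P : ℍ → ℝ} (hP : Continuous P) :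
    Continuous fun z : ℍ => ∫ θ in (0 : ℝ)..2 * π, P (rotI θ • z) := by
  have h : Continuous (Function.uncurry fun (z : ℍ) (θ : ℝ) => P (rotI θ • z)) :=
    hP.comp ((continuous_rotI.comp continuous_snd).smul continuous_fst)
  exact intervalIntegral.continuous_parametric_intervalIntegral_of_continuous' h 0 (2 * π)

theorem integrable_rotI_smul {P : ℍ → ℝ} (hP : Continuous P) (T : ℝ) :
    Integrable (Function.uncurry fun (θ : ℝ) (z : ℍ) => P (rotI θ • z))
      ((volume.restrict (Set.uIoc 0 (2 * π))).prod (volume.restrict (ball I T))) := by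
  rw [Measure.prod_restrict]
  refine ((continuous_rotI_smul hP).continuousOn.integrableOn_compact
    ((isCompact_Icc (a := (0 : ℝ)) (b := 2 * π)).prod (isCompact_closedBall (I : ℍ) T))).mono_set
    (Set.prod_mono ?_ ball_subset_closedBall)
  rw [Set.uIoc_of_le (by positivity)]
  exact Set.Ioc_subset_Icc_self

/-- Rotations around i preserve the ball and the measure; the rest is Fubini. -/
theorem setIntegral_ball_I_eq_integral_rotI {P : ℍ → ℝ} (hP : Continuous P) (T : ℝ) :
    2 * π * ∫ z in ball I T, P z =
      ∫ z in ball I T, ∫ θ in (0 : ℝ)..2 * π, P (rotI θ • z) := by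
  have h1 : ∀ θ : ℝ, ∫ z in ball I T, P (rotI θ • z) = ∫ z in ball I T, P z := fun θ => by
    rw [setIntegral_ball_smul, rotI_smul_I]
  have h2 := intervalIntegral_integral_swap (integrable_rotI_smul hP T)
  simpa only [h1, intervalIntegral.integral_const, sub_zero, smul_eq_mul] using h2

theorem logHeight_I_le_integral_logMinorant (hf : MDifferentiable 𝓘(ℂ) 𝓘(ℂ) f) (T : ℝ) :
    volume.real (ball I T) * logHeight m f I ≤
      ∫ z in ball I T, logMinorant (f I) (discForm m f z) := by
  have hP : Continuous fun z : ℍ => logMinorant (f I) (discForm m f z) :=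
    (continuous_logMinorant _).comp (continuous_discForm hf.continuous)
  have h3 : ∫ _ in ball (I : ℍ) T, 2 * π * logHeight m f I ≤
      ∫ z in ball (I : ℍ) T,
        ∫ θ in (0 : ℝ)..2 * π, logMinorant (f I) (discForm m f (rotI θ • z)) :=
    setIntegral_mono_on (integrableOn_ball continuous_const _ _)
      (integrableOn_ball (continuous_integral_rotI hP) _ _)
      isOpen_ball.measurableSet fun z _ => logHeight_I_le_circle hf z
  rw [setIntegral_const, smul_eq_mul, mul_left_comm] at h3
  replace h3 := h3.trans (setIntegral_ball_I_eq_integral_rotI hP T).ge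
  exact le_of_mul_le_mul_left h3 two_pi_pos

theorem logHeight_I_le_integral (hf : MDifferentiable 𝓘(ℂ) 𝓘(ℂ) f) (T : ℝ) :
    volume.real (ball I T) * logHeight m f I ≤ ∫ z in ball I T, logHeight m f z := by
  refine (logHeight_I_le_integral_logMinorant hf T).trans ?_
  exact setIntegral_mono_on
    (integrableOn_ball ((continuous_logMinorant _).comp (continuous_discForm hf.continuous)) _ _)
    (integrableOn_ball (continuous_logHeight hf.continuous) _ _) isOpen_ball.measurableSet
    fun z _ => (logMinorant_le _ _).trans (log_discForm_le_logHeight m f z)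

/-- The case of equality in the mean value inequality. -/
theorem eq_of_integral_le_logHeight_I (hf : MDifferentiable 𝓘(ℂ) 𝓘(ℂ) f) {T : ℝ}
    (h : ∫ z in ball I T, logHeight m f z ≤ volume.real (ball I T) * logHeight m f I) :
    ∀ z ∈ ball (I : ℍ) T, discForm m f z = f I ∧ logHeight m f z ≤ logHeight m f I := by
  have hP : Continuous fun z : ℍ => logMinorant (f I) (discForm m f z) :=
    (continuous_logMinorant _).comp (continuous_discForm hf.continuous)
  have hL : Continuous (logHeight m f) := continuous_logHeight hf.continuous
  have hle : ∀ z, logMinorant (f I) (discForm m f z) ≤ logHeight m f z := fun z =>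
    (logMinorant_le _ _).trans (log_discForm_le_logHeight m f z)
  -- The height minus its minorant is nonnegative and continuous; the hypothesis and the mean value
  -- inequality squeeze its integral to 0, so it vanishes on the whole ball.
  have h0 : ∫ z in ball (I : ℍ) T, (logHeight m f z - logMinorant (f I) (discForm m f z)) = 0 := by
    refine le_antisymm ?_ (integral_nonneg fun z => sub_nonneg.mpr (hle z))
    rw [integral_sub (integrableOn_ball hL _ _) (integrableOn_ball hP _ _)]
    linarith [logHeight_I_le_integral_logMinorant (m := m) hf T]
  have hae := (setIntegral_eq_zero_iff_of_nonneg_ae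
    (Filter.Eventually.of_forall fun z => sub_nonneg.mpr (hle z))
    (integrableOn_ball (hL.sub hP) _ _)).mp h0
  have heq : Set.EqOn (fun z => logHeight m f z - logMinorant (f I) (discForm m f z)) 0
      (ball (I : ℍ) T) :=
    Measure.eqOn_open_of_ae_eq hae isOpen_ball (hL.sub hP).continuousOn continuousOn_const
  intro z hz
  have h1 : logHeight m f z = logMinorant (f I) (discForm m f z) := sub_eq_zero.mp (heq hz)
  have h2 : discForm m f z = f I :=
    eq_of_log_le_logMinorant ((log_discForm_le_logHeight m f z).trans h1.le)
  refine ⟨h2, ?_⟩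
  rw [h1, h2]
  refine (logMinorant_le _ _).trans (le_of_eq ?_)
  simp [logHeight]

/-- The slash operator of weight `-m`. -/
noncomputable def slashNeg (m : ℕ) (f : ℍ → ℂ) (γ : SL(2, ℝ)) (z : ℍ) : ℂ :=
  autFactor γ z ^ m * f (γ • z)

theorem logHeight_slashNeg (m : ℕ) (f : ℍ → ℂ) (γ : SL(2, ℝ)) (z : ℍ) :
    logHeight m (slashNeg m f γ) z = logHeight m f (γ • z) := by
  have h := norm_ne_zero_iff.mpr (autFactor_ne_zero γ z)
  have := z.im_pos.ne'
  rw [logHeight, logHeight, slashNeg, SL_im_smul, norm_mul, norm_pow, div_pow]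
  congr 2
  field_simp
  ring

theorem mdifferentiable_autFactor (γ : SL(2, ℝ)) :
    MDifferentiable 𝓘(ℂ) 𝓘(ℂ) (autFactor γ) :=
  mdifferentiable_denom (γ : GL (Fin 2) ℝ)

theorem mdifferentiable_comp_smul (hf : MDifferentiable 𝓘(ℂ) 𝓘(ℂ) f) (γ : SL(2, ℝ)) :
    MDifferentiable 𝓘(ℂ) 𝓘(ℂ) fun z : ℍ => f (γ • z) :=
  hf.comp (mdifferentiable_smul (g := (γ : GL (Fin 2) ℝ)) (by simp))

theorem mdifferentiable_slashNeg (hf : MDifferentiable 𝓘(ℂ) 𝓘(ℂ) f) (γ : SL(2, ℝ)) :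
    MDifferentiable 𝓘(ℂ) 𝓘(ℂ) (slashNeg m f γ) :=
  ((mdifferentiable_autFactor γ).pow m).mul (mdifferentiable_comp_smul hf γ)

theorem volume_ball_eq (x : ℍ) (T : ℝ) : volume (ball x T) = volume (ball I T) := by
  rw [← toSL2R_smul_I x, ← Metric.smul_ball, measure_smul]

theorem logHeight_le_integral (hf : MDifferentiable 𝓘(ℂ) 𝓘(ℂ) f) (x : ℍ) (T : ℝ) :
    volume.real (ball I T) * logHeight m f x ≤ ∫ z in ball x T, logHeight m f z := by
  have h := logHeight_I_le_integral (mdifferentiable_slashNeg (m := m) hf x.toSL2R) T (m := m)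
  simpa only [logHeight_slashNeg, setIntegral_ball_smul, toSL2R_smul_I] using h

/-- After moving x to i, `discForm` is a constant a on the ball. At a point with w ≠ 0 the height
bound then reads |a|²/(1−|w|²)^m ≤ |a|², so a = 0 unless m = 0. -/
theorem eq_of_integral_le_logHeight (hf : MDifferentiable 𝓘(ℂ) 𝓘(ℂ) f) {x : ℍ} {T : ℝ}
    (h : ∫ z in ball x T, logHeight m f z ≤ volume.real (ball I T) * logHeight m f x)
    (hT : 1 ≤ T) (z : ℍ) (hz : z ∈ ball x T) : f z = f x ∧ (m ≠ 0 → f z = 0) := by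
  set γ := x.toSL2R
  have hx : γ • (I : ℍ) = x := toSL2R_smul_I x
  have key := eq_of_integral_le_logHeight_I (mdifferentiable_slashNeg (m := m) hf γ) (T := T)
    (m := m) (by simpa only [logHeight_slashNeg, setIntegral_ball_smul, hx] using h)
  have hz' : γ⁻¹ • z ∈ ball (I : ℍ) T := by
    rwa [mem_ball, ← dist_smul γ, smul_inv_smul, hx]
  rcases eq_or_ne m 0 with rfl | hm
  · refine ⟨?_, fun h => absurd rfl h⟩
    simpa [discForm, slashNeg, hx] using (key _ hz').1
  -- The point 2i lies in the ball since its distance to i is log 2 < 1 ≤ T.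
  · have h2i : ∃ w ∈ ball (I : ℍ) T, w ≠ I := by
      refine ⟨⟨2 * Complex.I, by simp⟩, ?_, ?_⟩
      · rw [mem_ball, UpperHalfPlane.dist_of_re_eq (by simp)]
        refine lt_of_lt_of_le ?_ hT
        have h1 : |Real.log 2| < 1 := by
          rw [abs_of_pos (Real.log_pos one_lt_two)]
          linarith [Real.log_two_lt_d9]
        simpa using h1
      · intro h
        have := congrArg UpperHalfPlane.im h
        simp at this
    obtain ⟨w, hw, hwI⟩ := h2i
    have h0 : slashNeg m f γ I = 0 := by
      by_contra hne
      obtain ⟨h1, h2⟩ := key w hw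
      rw [logHeight_eq, h1] at h2
      have hw0 : 0 < ‖cayley w‖ ^ 2 := by
        refine pow_pos (norm_pos_iff.mpr fun h0 => hwI ?_) 2
        ext
        rw [← cayleyInv_cayley, h0, ← cayley_I, cayleyInv_cayley]
      have hw1 : ‖cayley w‖ ^ 2 < 1 := by
        nlinarith [norm_cayley_lt_one w, norm_nonneg (cayley w)]
      have hlt : (1 - ‖cayley w‖ ^ 2) ^ m < 1 := pow_lt_one₀ (by linarith) (by linarith) hm
      have hpos : 0 < (1 - ‖cayley w‖ ^ 2) ^ m := pow_pos (by linarith) m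
      have ha : 0 < ‖slashNeg m f γ I‖ ^ 2 := pow_pos (norm_pos_iff.mpr hne) 2
      rw [logHeight, I_im, one_pow, div_one] at h2
      have h3 := (Real.log_le_log_iff (by positivity) (by positivity)).mp h2
      rw [add_le_add_iff_left, div_le_iff₀ hpos] at h3
      nlinarith
    have hfz : f z = 0 := by
      have := (key _ hz').1
      rw [h0, discForm, slashNeg, smul_inv_smul] at this
      simpa [autFactor_ne_zero, one_sub_cayley_ne_zero] using this
    have hfx : f x = 0 := by
      rw [slashNeg, hx] at h0
      simpa [autFactor_ne_zero] using h0
    exact ⟨hfz.trans hfx.symm, fun _ => hfz⟩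

end MeanValue

/-! ## Modular forms of weight at most zero -/

section NonpositiveWeight

open Metric Real

/-- Moderate growth thus means at most exponential growth in the hyperbolic distance to i, which
turns logarithmic heights into functions of linear growth. -/
theorem base_eq_cosh_dist (z : ℍ) :
    (1 + ‖(z : ℂ)‖ ^ 2) / z.im = 2 * Real.cosh (dist I z) := by
  have := z.im_pos.ne'
  rw [UpperHalfPlane.cosh_dist, Complex.dist_eq, I_im]
  simp only [← Complex.normSq_eq_norm_sq, Complex.normSq_apply]
  simp
  field_simp
  ring

theorem log_base_le_dist (z : ℍ) :
    Real.log ((1 + ‖(z : ℂ)‖ ^ 2) / z.im) ≤ Real.log 2 + dist I z := by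
  have h2 : 2 * Real.cosh (dist I z) ≤ 2 * Real.exp (dist I z) := by
    have := Real.exp_le_exp.mpr (show -dist I z ≤ dist I z by linarith [dist_nonneg (x := I) (y := z)])
    rw [Real.cosh_eq]
    linarith
  rw [base_eq_cosh_dist, ← Real.log_exp (dist I z), ← Real.log_mul (by norm_num) (Real.exp_pos _).ne',
    Real.log_exp]
  exact Real.log_le_log (mul_pos two_pos (Real.cosh_pos _)) h2

theorem inv_im_le_base (z : ℍ) : 1 / z.im ≤ (1 + ‖(z : ℂ)‖ ^ 2) / z.im := by
  have := z.im_pos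
  gcongr
  simp

theorem logHeight_le_dist {f : ℍ → ℂ} (hf : ModerateGrowth f) (m : ℕ) :
    ∃ C N : ℝ, 0 ≤ C ∧ 0 ≤ N ∧ ∀ z, logHeight m f z ≤ C + N * dist I z := by
  obtain ⟨C, N, hC⟩ := hf
  refine ⟨Real.log (1 + C ^ 2) + (2 * N + m : ℕ) * Real.log 2, (2 * N + m : ℕ),
    add_nonneg (Real.log_nonneg (by nlinarith [sq_nonneg C])) (by positivity), by positivity,
    fun z => ?_⟩
  set b := (1 + ‖(z : ℂ)‖ ^ 2) / z.im with hb
  have hb1 : 1 ≤ b := base_one_le z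
  have h1 : ‖f z‖ ^ 2 / z.im ^ m ≤ C ^ 2 * b ^ (2 * N + m) := by
    have h2 : ‖f z‖ ^ 2 ≤ (C * b ^ N) ^ 2 := pow_le_pow_left₀ (norm_nonneg _) (hC z) 2
    have h3 : 1 / z.im ^ m ≤ b ^ m := by
      rw [← one_div_pow]
      exact pow_le_pow_left₀ (one_div_nonneg.mpr z.im_pos.le) (inv_im_le_base z) m
    calc ‖f z‖ ^ 2 / z.im ^ m = ‖f z‖ ^ 2 * (1 / z.im ^ m) := by ring
      _ ≤ (C * b ^ N) ^ 2 * b ^ m := by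
        have := z.im_pos
        gcongr
      _ = _ := by ring
  have h4 : 1 + ‖f z‖ ^ 2 / z.im ^ m ≤ (1 + C ^ 2) * b ^ (2 * N + m) := by
    have := one_le_pow₀ (n := 2 * N + m) hb1
    linarith
  have := z.im_pos
  calc logHeight m f z ≤ Real.log ((1 + C ^ 2) * b ^ (2 * N + m)) :=
        Real.log_le_log (by positivity) h4
    _ = Real.log (1 + C ^ 2) + (2 * N + m : ℕ) * Real.log b := by
        rw [Real.log_mul (by positivity) (by positivity), Real.log_pow]
    _ ≤ Real.log (1 + C ^ 2) + (2 * N + m : ℕ) * (Real.log 2 + dist I z) := by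
        gcongr
        exact log_base_le_dist z
    _ = _ := by ring

variable {Γ : Subgroup PSL(2, ℝ)} [Countable Γ]

/-- The height is invariant and of linear growth, so there is a point x with equality in the mean
value inequality on all balls of integral radius; these balls exhaust the half plane. -/
theorem IsModularForm.exists_eq_of_nonpos (hcov : HasFiniteCovolume Γ) {m : ℕ} {f : ℍ → ℂ}
    (hf : IsModularForm Γ (-m) f) : ∃ x : ℍ, ∀ z, f z = f x ∧ (m ≠ 0 → f z = 0) := by
  obtain ⟨F, hF, hFfin⟩ := hcov
  obtain ⟨C, N, hC, hN, hle⟩ := logHeight_le_dist hf.growth m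
  have hinv : ∀ (g : Γ) z, logHeight m f (g • z) = logHeight m f z := by
    rintro ⟨g, hg⟩ z
    obtain ⟨γ, rfl⟩ := QuotientGroup.mk_surjective g
    have h : slashNeg m f γ = f := funext fun z => by
      have := hf.modular γ hg z
      rwa [neg_neg, zpow_natCast] at this
    change logHeight m f (γ • z) = _
    rw [← logHeight_slashNeg, h]
  have hL : Continuous (logHeight m f) := continuous_logHeight hf.holo.continuous
  have hfin : ∀ T : ℕ, volume (ball (I : ℍ) T) ≠ ⊤ := fun T =>
    (measure_ball_lt_top).ne
  have hlint : ∀ (T : ℕ) (x : ℍ), ∫⁻ y in ball x T, ENNReal.ofReal (logHeight m f y) =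
      ENNReal.ofReal (∫ y in ball x T, logHeight m f y) := fun T x =>
    (ofReal_integral_eq_lintegral_ofReal (integrableOn_ball hL x T)
      (Filter.Eventually.of_forall fun z => logHeight_nonneg m f z)).symm
  have hV : ∀ (T : ℕ) (x : ℍ), volume (ball (I : ℍ) T) * ENNReal.ofReal (logHeight m f x) =
      ENNReal.ofReal (volume.real (ball (I : ℍ) T) * logHeight m f x) := fun T x => by
    rw [ENNReal.ofReal_mul measureReal_nonneg, ofReal_measureReal (hfin T)]
  obtain ⟨x, hx⟩ := exists_lintegral_ball_eq (μ := (volume : Measure ℍ)) (o := I) hF hFfin hL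
    (logHeight_nonneg m f) hC hN hinv hle hfin (fun T x => volume_ball_eq x T) fun T x => by
      rw [hlint, hV]
      exact ENNReal.ofReal_le_ofReal (logHeight_le_integral hf.holo x T)
  refine ⟨x, fun z => ?_⟩
  obtain ⟨n, hn⟩ := exists_nat_gt (dist z x)
  -- The radius n + 1 contains z and is at least 1, as the case of equality requires.
  have h := hx (n + 1)
  rw [hlint, hV, ENNReal.ofReal_eq_ofReal_iff
    (integral_nonneg fun z => logHeight_nonneg m f z)
    (mul_nonneg measureReal_nonneg (logHeight_nonneg m f x))] at h
  exact eq_of_integral_le_logHeight hf.holo h.le (by simp) z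
    (by rw [mem_ball]; push_cast; linarith)

/-- There are no nonzero modular forms of negative weight. -/
theorem IsModularForm.eq_zero_of_neg (hcov : HasFiniteCovolume Γ) {k : ℤ} (hk : k < 0)
    {f : ℍ → ℂ} (hf : IsModularForm Γ k f) : f = 0 := by
  obtain ⟨m, rfl⟩ : ∃ m : ℕ, k = -m := ⟨(-k).toNat, by omega⟩
  obtain ⟨x, hx⟩ := hf.exists_eq_of_nonpos hcov
  exact funext fun z => (hx z).2 (by omega)

/-- Modular forms of weight zero are constant. -/
theorem IsModularForm.exists_eq_const (hcov : HasFiniteCovolume Γ) {f : ℍ → ℂ}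
    (hf : IsModularForm Γ 0 f) : ∃ c : ℂ, f = fun _ => c := by
  obtain ⟨x, hx⟩ := IsModularForm.exists_eq_of_nonpos (m := 0) hcov (by simpa using hf)
  exact ⟨f x, funext fun z => (hx z).1⟩

end NonpositiveWeight

/-! ## Holomorphic functions of moderate growth -/

section Temperate

theorem ModerateGrowth.mul {f g : ℍ → ℂ} (hf : ModerateGrowth f) (hg : ModerateGrowth g) :
    ModerateGrowth (f * g) := by
  obtain ⟨C, N, hC⟩ := hf
  obtain ⟨C', N', hC'⟩ := hg
  refine ⟨C * C', N + N', fun z => ?_⟩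
  rw [Pi.mul_apply, norm_mul, pow_add, mul_mul_mul_comm]
  exact mul_le_mul (hC z) (hC' z) (norm_nonneg _) ((norm_nonneg _).trans (hC z))

theorem ModerateGrowth.coe : ModerateGrowth fun z : ℍ => (z : ℂ) := by
  refine ⟨1, 1, fun z => ?_⟩
  have h1 : z.im ≤ ‖(z : ℂ)‖ := (le_abs_self _).trans (Complex.abs_im_le_norm (z : ℂ))
  rw [one_mul, pow_one, le_div_iff₀ z.im_pos]
  nlinarith [norm_nonneg (z : ℂ)]

theorem base_le_exp_dist (z : ℍ) :
    (1 + ‖(z : ℂ)‖ ^ 2) / z.im ≤ 2 * Real.exp (dist I z) := by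
  have h := log_base_le_dist z
  have hb := base_one_le z
  rw [← Real.log_exp (dist I z), ← Real.log_mul two_ne_zero (Real.exp_pos _).ne'] at h
  exact (Real.log_le_log_iff (by linarith) (by positivity)).mp h

theorem exp_dist_le_base (z : ℍ) : Real.exp (dist I z) ≤ (1 + ‖(z : ℂ)‖ ^ 2) / z.im := by
  have h1 : (1 + ‖(z : ℂ)‖ ^ 2) / z.im = 2 * Real.cosh (dist I z) := base_eq_cosh_dist z
  rw [h1, Real.cosh_eq]
  linarith [Real.exp_pos (-dist I z)]

/-- As γ is an isometry, dist(i, γz) ≤ dist(i, γi) + dist(i, z). -/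
theorem base_smul_le (γ : SL(2, ℝ)) : ∃ K : ℝ, ∀ z : ℍ,
    (1 + ‖((γ • z : ℍ) : ℂ)‖ ^ 2) / (γ • z).im ≤ K * ((1 + ‖(z : ℂ)‖ ^ 2) / z.im) := by
  refine ⟨2 * Real.exp (dist I (γ • (I : ℍ))), fun z => ?_⟩
  refine (base_le_exp_dist _).trans ?_
  rw [mul_assoc]
  gcongr
  calc Real.exp (dist I (γ • z)) ≤ Real.exp (dist I (γ • (I : ℍ)) + dist I z) := by
        rw [Real.exp_le_exp, ← dist_smul γ I z]
        exact dist_triangle _ _ _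
    _ ≤ _ := by
        rw [Real.exp_add]
        gcongr
        exact exp_dist_le_base z

theorem ModerateGrowth.comp_smul {f : ℍ → ℂ} (hf : ModerateGrowth f) (γ : SL(2, ℝ)) :
    ModerateGrowth fun z => f (γ • z) := by
  obtain ⟨C, N, hC⟩ := hf
  obtain ⟨K, hK⟩ := base_smul_le γ
  refine ⟨|C| * K ^ N, N, fun z => (hC _).trans ?_⟩
  rw [mul_assoc, ← mul_pow]
  have := base_one_le (γ • z)
  exact mul_le_mul (le_abs_self C) (pow_le_pow_left₀ (by linarith) (hK z) N)
    (pow_nonneg (by linarith) N) (abs_nonneg C)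

/-- The algebra of holomorphic functions of moderate growth. -/
def temperate : Subalgebra ℂ (ℍ → ℂ) where
  carrier := {f | MDifferentiable 𝓘(ℂ) 𝓘(ℂ) f ∧ ModerateGrowth f}
  mul_mem' := fun hf hg => ⟨hf.1.mul hg.1, hf.2.mul hg.2⟩
  add_mem' := fun hf hg => ⟨hf.1.add hg.1, hf.2.add hg.2⟩
  algebraMap_mem' := fun c => ⟨mdifferentiable_const, .const c⟩

theorem const_mem_temperate (c : ℂ) : (fun _ => c) ∈ temperate :=
  temperate.algebraMap_mem c

theorem comp_smul_mem_temperate {f : ℍ → ℂ} (hf : f ∈ temperate) (γ : SL(2, ℝ)) :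
    (fun z => f (γ • z)) ∈ temperate :=
  ⟨mdifferentiable_comp_smul hf.1 γ, hf.2.comp_smul γ⟩

theorem autFactor_mem_temperate (γ : SL(2, ℝ)) : autFactor γ ∈ temperate :=
  temperate.add_mem (temperate.mul_mem (const_mem_temperate (γ 1 0 : ℝ))
    ⟨mdifferentiable_coe, .coe⟩) (const_mem_temperate (γ 1 1 : ℝ))

/-- A reciprocal of an automorphy factor is a translate of another one, so it too has moderate
growth. -/
theorem autFactor_inv (γ : SL(2, ℝ)) (z : ℍ) : (autFactor γ z)⁻¹ = autFactor γ⁻¹ (γ • z) := by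
  have h := autFactor_mul γ⁻¹ γ z
  rw [inv_mul_cancel] at h
  have h1 : autFactor 1 z = 1 := by simp [autFactor]
  exact (eq_inv_of_mul_eq_one_left (h.symm.trans h1)).symm

theorem autFactor_inv_mem_temperate (γ : SL(2, ℝ)) :
    (fun z => (autFactor γ z)⁻¹) ∈ temperate := by
  simp only [autFactor_inv]
  exact comp_smul_mem_temperate (autFactor_mem_temperate γ⁻¹) γ

theorem autFactor_zpow_mem_temperate (γ : SL(2, ℝ)) (k : ℤ) :
    (fun z => autFactor γ z ^ k) ∈ temperate := by
  cases k with
  | ofNat n =>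
    simp only [Int.ofNat_eq_natCast, zpow_natCast]
    exact temperate.pow_mem (autFactor_mem_temperate γ) n
  | negSucc n =>
    simp only [zpow_negSucc, ← inv_pow]
    exact temperate.pow_mem (autFactor_inv_mem_temperate γ) (n + 1)

theorem lowerRatio_mem_temperate (γ : SL(2, ℝ)) : lowerRatio γ ∈ temperate :=
  temperate.mul_mem (const_mem_temperate (γ 1 0 : ℝ)) (autFactor_inv_mem_temperate γ)

/-- The difference of the ratios is a nonzero constant over the product of the two automorphy
factors; its inverse is therefore a polynomial in z. -/
theorem lowerRatio_sub_inv_mem_temperate {γ δ : SL(2, ℝ)} (h : (γ * δ⁻¹) 1 0 ≠ 0) :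
    (fun z => (lowerRatio γ z - lowerRatio δ z)⁻¹) ∈ temperate := by
  have e : (γ * δ⁻¹) 1 0 = γ 1 0 * δ 1 1 - γ 1 1 * δ 1 0 := by
    rw [SL_mul_lower_left, Matrix.SpecialLinearGroup.SL2_inv_expl]
    change γ 1 0 * δ 1 1 + γ 1 1 * (-δ 1 0) = _
    ring
  have hc : (((γ 1 0 * δ 1 1 - γ 1 1 * δ 1 0 : ℝ)) : ℂ) ≠ 0 := by
    rw [← e]; exact_mod_cast h
  have : (fun z => (lowerRatio γ z - lowerRatio δ z)⁻¹) =
      (fun _ => (((γ 1 0 * δ 1 1 - γ 1 1 * δ 1 0 : ℝ)) : ℂ)⁻¹) * (autFactor γ * autFactor δ) := by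
    funext z
    have h1 := autFactor_ne_zero γ z
    have h2 := autFactor_ne_zero δ z
    have h3 : lowerRatio γ z - lowerRatio δ z =
        ((γ 1 0 * δ 1 1 - γ 1 1 * δ 1 0 : ℝ) : ℂ) / (autFactor γ z * autFactor δ z) := by
      rw [lowerRatio, lowerRatio, div_sub_div _ _ h1 h2]
      congr 1
      rw [autFactor, autFactor]
      push_cast
      ring
    rw [h3, inv_div, Pi.mul_apply, Pi.mul_apply, div_eq_inv_mul]
  rw [this]
  exact temperate.mul_mem (const_mem_temperate _)
    (temperate.mul_mem (autFactor_mem_temperate γ) (autFactor_mem_temperate δ))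

/-- The ring of families of polynomials with temperate coefficients. -/
def temperatePoly : Subring (ℍ → ℂ[X]) where
  carrier := {P | ∀ n, (fun z => (P z).coeff n) ∈ temperate}
  mul_mem' := fun {P Q} hP hQ n => by
    have : (fun z => ((P * Q) z).coeff n) =
        ∑ x ∈ Finset.HasAntidiagonal.antidiagonal n, (fun z => (P z).coeff x.1) * fun z => (Q z).coeff x.2 := by
      funext z
      rw [Pi.mul_apply, Polynomial.coeff_mul, Finset.sum_apply]
      rfl
    rw [this]
    exact temperate.sum_mem fun x _ => temperate.mul_mem (hP x.1) (hQ x.2)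
  one_mem' := fun n => by
    simp only [Pi.one_apply, Polynomial.coeff_one]
    exact const_mem_temperate _
  add_mem' := fun {P Q} hP hQ n => by
    simp only [Pi.add_apply, Polynomial.coeff_add]
    exact temperate.add_mem (hP n) (hQ n)
  zero_mem' := fun n => by
    simp only [Pi.zero_apply, Polynomial.coeff_zero]
    exact const_mem_temperate 0
  neg_mem' := fun {P} hP n => by
    simp only [Pi.neg_apply, Polynomial.coeff_neg]
    exact temperate.neg_mem (hP n)

theorem C_mem_temperatePoly {f : ℍ → ℂ} (hf : f ∈ temperate) :
    (fun z => Polynomial.C (f z)) ∈ temperatePoly := fun n => by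
  simp only [Polynomial.coeff_C]
  by_cases h : n = 0
  · simpa [h] using hf
  · simpa [h] using const_mem_temperate 0

theorem X_mem_temperatePoly : (fun _ => Polynomial.X : ℍ → ℂ[X]) ∈ temperatePoly :=
  fun _ => const_mem_temperate _

theorem interpolate_mem_temperatePoly {ι : Type*} [DecidableEq ι] (s : Finset ι)
    (γ : ι → SL(2, ℝ)) (hγ : ∀ i j, i ≠ j → (γ i * (γ j)⁻¹) 1 0 ≠ 0) {r : ι → ℍ → ℂ}
    (hr : ∀ i, r i ∈ temperate) :
    (fun z => Lagrange.interpolate s (fun i => lowerRatio (γ i) z) fun i => r i z) ∈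
      temperatePoly := by
  have : (fun z => Lagrange.interpolate s (fun i => lowerRatio (γ i) z) fun i => r i z) =
      ∑ i ∈ s, (fun z => Polynomial.C (r i z)) * ∏ j ∈ s.erase i,
        ((fun z => Polynomial.C (lowerRatio (γ i) z - lowerRatio (γ j) z)⁻¹) *
          ((fun _ => Polynomial.X) - fun z => Polynomial.C (lowerRatio (γ j) z))) := by
    funext z
    rw [Lagrange.interpolate_apply, Finset.sum_apply]
    refine Finset.sum_congr rfl fun i _ => ?_
    rw [Pi.mul_apply, Finset.prod_apply]
    rfl
  rw [this]
  refine temperatePoly.sum_mem fun i _ => temperatePoly.mul_mem (C_mem_temperatePoly (hr i))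
    (temperatePoly.prod_mem fun j hj => temperatePoly.mul_mem (C_mem_temperatePoly ?_)
      (temperatePoly.sub_mem X_mem_temperatePoly
        (C_mem_temperatePoly (lowerRatio_mem_temperate _))))
  exact lowerRatio_sub_inv_mem_temperate (hγ i j (Finset.ne_of_mem_erase hj).symm)

/-- The derivative of a holomorphic function of moderate growth. -/
theorem hasDerivAt_derivZ {f : ℍ → ℂ} (hf : MDifferentiable 𝓘(ℂ) 𝓘(ℂ) f) (z : ℍ) :
    HasDerivAt (f ∘ ofComplex) (derivZ f z) z :=
  (UpperHalfPlane.mdifferentiableAt_iff.mp (hf z)).hasDerivAt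

/-- Cauchy's estimate on the circle of radius y/2 around z: there |w|² ≤ (9/4)|z|² and Im w ≥ y/2,
so the base grows at most by the factor 5, and the factor 1/y is bounded by the base. -/
theorem derivZ_mem_temperate {f : ℍ → ℂ} (hf : f ∈ temperate) : derivZ f ∈ temperate := by
  have hd := UpperHalfPlane.mdifferentiable_iff.mp hf.1
  refine ⟨?_, ?_⟩
  · rw [UpperHalfPlane.mdifferentiable_iff]
    refine (hd.deriv isOpen_upperHalfPlaneSet).congr fun z hz => ?_
    simp only [Function.comp_apply, derivZ, ofComplex_apply_of_im_pos hz]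
  · obtain ⟨C, N, hC⟩ := hf.2
    refine ⟨|C| * 5 ^ N * 2, N + 1, fun z => ?_⟩
    have hz := z.im_pos
    set b := (1 + ‖(z : ℂ)‖ ^ 2) / z.im with hb
    have hb1 : 1 ≤ b := base_one_le z
    have him : ∀ w ∈ Metric.closedBall (z : ℂ) (z.im / 2), z.im / 2 ≤ w.im := by
      intro w hw
      rw [Metric.mem_closedBall, Complex.dist_eq] at hw
      have := (Complex.abs_im_le_norm _).trans hw
      rw [Complex.sub_im, abs_le, coe_im] at this
      linarith
    have hbound : ∀ w ∈ Metric.sphere (z : ℂ) (z.im / 2),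
        ‖(f ∘ ofComplex) w‖ ≤ |C| * (5 * b) ^ N := by
      intro w hw
      have hw1 := him w (Metric.sphere_subset_closedBall hw)
      have hw0 : 0 < w.im := by linarith
      have h1 : ‖w‖ ≤ 3 / 2 * ‖(z : ℂ)‖ := by
        have h2 : z.im ≤ ‖(z : ℂ)‖ := (le_abs_self _).trans (Complex.abs_im_le_norm (z : ℂ))
        have h3 : ‖w - z‖ = z.im / 2 := by rwa [Metric.mem_sphere, Complex.dist_eq] at hw
        have h4 := norm_add_le (z : ℂ) (w - z)
        rw [add_sub_cancel, h3] at h4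
        linarith
      have h5 : (1 + ‖w‖ ^ 2) / w.im ≤ 5 * b := by
        rw [hb, mul_div_assoc', div_le_div_iff₀ hw0 hz]
        have h6 : ‖w‖ ^ 2 ≤ 9 / 4 * ‖(z : ℂ)‖ ^ 2 := by
          nlinarith [norm_nonneg w, norm_nonneg (z : ℂ)]
        have h7 : (1 + ‖w‖ ^ 2) * z.im ≤ (1 + 9 / 4 * ‖(z : ℂ)‖ ^ 2) * z.im := by gcongr
        have h8 : 5 * (1 + ‖(z : ℂ)‖ ^ 2) * (z.im / 2) ≤ 5 * (1 + ‖(z : ℂ)‖ ^ 2) * w.im := by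
          gcongr
        nlinarith [mul_nonneg (sq_nonneg ‖(z : ℂ)‖) hz.le]
      have h9 := hC (ofComplex w)
      rw [ofComplex_apply_of_im_pos hw0] at h9
      rw [Function.comp_apply, ofComplex_apply_of_im_pos hw0]
      refine h9.trans (mul_le_mul (le_abs_self C) (pow_le_pow_left₀ ?_ h5 N) ?_ (abs_nonneg C))
      · exact div_nonneg (by positivity) hw0.le
      · exact pow_nonneg (div_nonneg (by positivity) hw0.le) _
    have hdiff : DiffContOnCl ℂ (f ∘ ofComplex) (Metric.ball (z : ℂ) (z.im / 2)) := by
      refine DifferentiableOn.diffContOnCl_ball (U := {z : ℂ | 0 < z.im}) hd fun w hw => ?_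
      have := him w hw
      change 0 < w.im
      linarith
    refine (Complex.norm_deriv_le_of_forall_mem_sphere_norm_le (by positivity) hdiff hbound).trans ?_
    have h10 : 1 / z.im ≤ b := inv_im_le_base z
    calc |C| * (5 * b) ^ N / (z.im / 2) = |C| * 5 ^ N * 2 * b ^ N * (1 / z.im) := by
          rw [mul_pow]; field_simp
      _ ≤ |C| * 5 ^ N * 2 * b ^ N * b := by gcongr
      _ = _ := by ring

end Temperate

/-! ## Expansions of quasimodular forms -/

section Expansion

variable {Γ : Subgroup PSL(2, ℝ)} {k : ℤ} {p : ℕ} {f : ℍ → ℂ} {P : ℍ → ℂ[X]}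

theorem polynomial_eq_of_eval_lowerRatio [Countable Γ] (hcov : HasFiniteCovolume Γ) (z : ℍ)
    {A B : ℂ[X]} (h : ∀ γ : SL(2, ℝ), (QuotientGroup.mk γ : PSL(2, ℝ)) ∈ Γ →
      A.eval (lowerRatio γ z) = B.eval (lowerRatio γ z)) : A = B := by
  refine Polynomial.eq_of_infinite_eval_eq A B ((infinite_lowerRatio Γ hcov z).mono ?_)
  rintro _ ⟨γ, hγ, rfl⟩
  exact h γ hγ

theorem IsExpansion.coeff_zero (h : IsExpansion Γ k p f P) : (fun z => (P z).coeff 0) = f := by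
  funext z
  have := h.eval_eq 1 (one_mem Γ) z
  simpa [autFactor, Polynomial.coeff_zero_eq_eval_zero] using this.symm

theorem IsExpansion.unique [Countable Γ] (hcov : HasFiniteCovolume Γ)
    (h : IsExpansion Γ k p f P) {q : ℕ} {Q : ℍ → ℂ[X]} (h' : IsExpansion Γ k q f Q) : P = Q :=
  funext fun z => polynomial_eq_of_eval_lowerRatio hcov z fun γ hγ =>
    (h.eval_eq γ hγ z).symm.trans (h'.eval_eq γ hγ z)

theorem IsExpansion.mono (h : IsExpansion Γ k p f P) {q : ℕ}
    (hq : ∀ z, (P z).natDegree ≤ q) : IsExpansion Γ k q f P :=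
  ⟨hq, h.eval_eq⟩

/-- Expanding f(γδz) at δz by γ and at z by γδ gives the same value for all γ in Γ; by
`lowerRatio_mul` the two polynomials agree at infinitely many ratios. -/
theorem IsExpansion.comp_eq [Countable Γ] (hcov : HasFiniteCovolume Γ)
    (h : IsExpansion Γ k p f P) {δ : SL(2, ℝ)} (hδ : (QuotientGroup.mk δ : PSL(2, ℝ)) ∈ Γ)
    (z : ℍ) : Polynomial.C (autFactor δ z ^ (-k)) * P (δ • z) =
      ((P z).comp (Polynomial.X + Polynomial.C (lowerRatio δ z))).comp
        (Polynomial.C (autFactor δ z ^ (-2 : ℤ)) * Polynomial.X) := by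
  refine polynomial_eq_of_eval_lowerRatio hcov (δ • z) fun γ hγ => ?_
  have h1 := h.eval_eq γ hγ (δ • z)
  have h2 := h.eval_eq (γ * δ) (mul_mem hγ hδ) z
  change _ = Polynomial.eval (lowerRatio γ (δ • z)) _ at h1
  change _ = Polynomial.eval (lowerRatio (γ * δ) z) _ at h2
  rw [autFactor_mul, mul_zpow, mul_smul, lowerRatio_mul, mul_right_comm, h1] at h2
  simp only [Polynomial.eval_mul, Polynomial.eval_C, Polynomial.eval_comp, Polynomial.eval_add,
    Polynomial.eval_X]
  rw [mul_comm, h2, mul_comm (lowerRatio γ (δ • z))]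

/-- Compare coefficients of X^m in `comp_eq`: by Taylor's formula a shift of the variable produces
the Hasse derivative, and scaling X by the factor to the power −2 lowers the weight by 2m. -/
theorem IsExpansion.coeff [Countable Γ] (hcov : HasFiniteCovolume Γ)
    (h : IsExpansion Γ k p f P) (m : ℕ) :
    IsExpansion Γ (k - 2 * m) (p - m) (fun z => (P z).coeff m)
      fun z => Polynomial.hasseDeriv m (P z) := by
  refine ⟨fun z => (Polynomial.natDegree_hasseDeriv_le _ _).trans
    (Nat.sub_le_sub_right (h.natDegree_le z) m), fun γ hγ z => ?_⟩
  have hj := autFactor_ne_zero γ z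
  have h1 := congrArg (fun A => Polynomial.coeff A m) (h.comp_eq hcov hγ z)
  simp only [Polynomial.coeff_C_mul, Polynomial.comp_C_mul_X_coeff] at h1
  rw [← Polynomial.taylor_apply, Polynomial.taylor_coeff] at h1
  change _ = Polynomial.eval (lowerRatio γ z) _
  have e : autFactor γ z ^ (-(k - 2 * m)) =
      autFactor γ z ^ (-k) * (autFactor γ z ^ (2 * m : ℤ)) := by
    rw [← zpow_add₀ hj]; ring_nf
  have e2 : (autFactor γ z ^ (-2 : ℤ)) ^ m * autFactor γ z ^ (2 * m : ℤ) = 1 := by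
    rw [← zpow_natCast, ← zpow_mul, ← zpow_add₀ hj]
    simp
  rw [e, mul_right_comm, h1, mul_assoc, e2, mul_one]

/-- For p+1 fixed elements γ of Γ the values of P z at their ratios are temperate in z, and P z is
recovered by interpolation. The γ are chosen with distinct ratios at i; by `lowerRatio_eq_iff` the
nodes stay distinct at every z. -/
theorem IsExpansion.mem_temperatePoly [Countable Γ] (hcov : HasFiniteCovolume Γ)
    (h : IsExpansion Γ k p f P) (hf : f ∈ temperate) : P ∈ temperatePoly := by
  obtain ⟨s, hs, hcard⟩ := (infinite_lowerRatio Γ hcov I).exists_subset_card_eq (p + 1)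
  have hs' : ∀ x : s, ∃ γ : SL(2, ℝ), (QuotientGroup.mk γ : PSL(2, ℝ)) ∈ Γ ∧
      lowerRatio γ I = x := fun x => hs x.2
  choose γ hγ using hs'
  have hne : ∀ i j : s, i ≠ j → (γ i * (γ j)⁻¹) 1 0 ≠ 0 := by
    intro i j hij h0
    rw [← lowerRatio_eq_iff _ _ I, (hγ i).2, (hγ j).2] at h0
    exact hij (Subtype.ext h0)
  have hP : P = fun z => Lagrange.interpolate Finset.univ (fun i : s => lowerRatio (γ i) z)
      fun i : s => autFactor (γ i) z ^ (-k) * f (γ i • z) := by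
    funext z
    refine Lagrange.eq_interpolate_of_eval_eq _ ?_ ?_ ?_
    · intro i _ j _ hij
      by_contra hne'
      exact hne i j hne' ((lowerRatio_eq_iff _ _ z).mp hij)
    · refine lt_of_le_of_lt (Polynomial.degree_le_of_natDegree_le (h.natDegree_le z)) ?_
      rw [Finset.card_univ, Fintype.card_coe, hcard]
      exact_mod_cast Nat.lt_succ_self p
    · exact fun i _ => (h.eval_eq (γ i) (hγ i).1 z).symm
  rw [hP]
  exact interpolate_mem_temperatePoly Finset.univ γ hne
    (r := fun i z => autFactor (γ i) z ^ (-k) * f (γ i • z)) fun i =>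
    temperate.mul_mem (autFactor_zpow_mem_temperate _ _) (comp_smul_mem_temperate hf _)

theorem IsQuasimodularForm.mem_temperate (hf : IsQuasimodularForm Γ k p f) : f ∈ temperate :=
  ⟨hf.holo, hf.growth⟩

theorem IsQuasimodularForm.coeff [Countable Γ] (hcov : HasFiniteCovolume Γ)
    (hf : IsQuasimodularForm Γ k p f) (hP : IsExpansion Γ k p f P) (m : ℕ) :
    IsQuasimodularForm Γ (k - 2 * m) (p - m) fun z => (P z).coeff m :=
  have h := hP.mem_temperatePoly hcov hf.mem_temperate m
  ⟨h.1, h.2, _, hP.coeff hcov m⟩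

theorem IsQuasimodularForm.isModularForm (hf : IsQuasimodularForm Γ k 0 f) :
    IsModularForm Γ k f := by
  obtain ⟨P, hP⟩ := hf.quasimodular
  refine ⟨hf.holo, hf.growth, fun γ hγ z => ?_⟩
  rw [hP.eval_eq γ hγ z, Polynomial.eq_C_of_natDegree_le_zero (hP.natDegree_le z),
    Polynomial.eval_C]
  exact congrFun hP.coeff_zero z

/-- There are no nonzero quasimodular forms of negative weight. -/
theorem IsQuasimodularForm.eq_zero_of_neg [Countable Γ] (hcov : HasFiniteCovolume Γ)
    (hk : k < 0) (hf : IsQuasimodularForm Γ k p f) : f = 0 := by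
  induction p with
  | zero => exact hf.isModularForm.eq_zero_of_neg hcov hk
  | succ p ih =>
    obtain ⟨P, hP⟩ := hf.quasimodular
    -- The top coefficient has depth 0 and weight k − 2(p+1) < 0, so it vanishes and the depth
    -- drops.
    have h := hf.coeff hcov hP (p + 1)
    rw [Nat.sub_self] at h
    have h0 := h.isModularForm.eq_zero_of_neg hcov (by omega)
    refine ih ⟨hf.holo, hf.growth, P, hP.mono fun z => ?_⟩
    refine Polynomial.natDegree_le_iff_coeff_eq_zero.mpr fun n hn => ?_
    rcases Nat.lt_or_eq_of_le (Nat.succ_le_of_lt hn) with h1 | h1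
    · exact Polynomial.coeff_eq_zero_of_natDegree_lt ((hP.natDegree_le z).trans_lt h1)
    · rw [← h1]
      exact congrFun h0 z

/-- The expansion of f_1 is the derivative of P. If f_1 = 0, uniqueness gives P' = 0, so P is
constant in X. -/
theorem IsQuasimodularForm.isModularForm_of_coeff_one [Countable Γ] (hcov : HasFiniteCovolume Γ)
    (hf : IsQuasimodularForm Γ k p f) (hP : IsExpansion Γ k p f P)
    (h1 : ∀ z, (P z).coeff 1 = 0) : IsModularForm Γ k f := by
  have h := hP.coeff hcov 1
  have h' : IsExpansion Γ (k - 2 * (1 : ℕ)) 0 (fun z => (P z).coeff 1) fun _ => 0 :=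
    ⟨fun z => by simp, fun γ hγ z => by simp [h1]⟩
  have e := h.unique hcov h'
  have hd : ∀ z, (P z).natDegree ≤ 0 := fun z => by
    have := congrFun e z
    rw [Polynomial.hasseDeriv_one] at this
    exact (Polynomial.derivative_eq_zero.mp this).le
  exact IsQuasimodularForm.isModularForm ⟨hf.holo, hf.growth, P, hP.mono hd⟩

/-! ## Derivatives -/

theorem derivZ_eq_of_hasDerivAt {f : ℍ → ℂ} {z : ℍ} {a : ℂ}
    (h : HasDerivAt (f ∘ ofComplex) a z) : derivZ f z = a :=
  h.deriv

theorem hasDerivAt_autFactor (γ : SL(2, ℝ)) (z : ℍ) :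
    HasDerivAt (autFactor γ ∘ ofComplex) (γ 1 0 : ℝ) z := by
  have h : HasDerivAt (fun w : ℂ => ((γ 1 0 : ℝ) : ℂ) * w + (γ 1 1 : ℝ)) (γ 1 0 : ℝ) z := by
    simpa using ((hasDerivAt_id (z : ℂ)).const_mul ((γ 1 0 : ℝ) : ℂ)).add_const ((γ 1 1 : ℝ) : ℂ)
  refine h.congr_of_eventuallyEq ?_
  filter_upwards [isOpen_upperHalfPlaneSet.mem_nhds z.im_pos] with w hw
  rw [Function.comp_apply, autFactor, ofComplex_apply_of_im_pos hw]

theorem hasDerivAt_lowerRatio (γ : SL(2, ℝ)) (z : ℍ) :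
    HasDerivAt (lowerRatio γ ∘ ofComplex) (-lowerRatio γ z ^ 2) z := by
  have h := (hasDerivAt_const (z : ℂ) ((γ 1 0 : ℝ) : ℂ)).div (hasDerivAt_autFactor γ z)
    (by simpa using autFactor_ne_zero γ z)
  refine h.congr_deriv ?_
  simp [lowerRatio]
  ring

theorem hasDerivAt_comp_smul {f : ℍ → ℂ} (hf : MDifferentiable 𝓘(ℂ) 𝓘(ℂ) f) (γ : SL(2, ℝ))
    (z : ℍ) : HasDerivAt ((fun z : ℍ => f (γ • z)) ∘ ofComplex)
      (autFactor γ z ^ (-2 : ℤ) * derivZ f (γ • z)) z := by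
  have h1 := (hasStrictDerivAt_smul (g := (γ : GL (Fin 2) ℝ)) (by simp) z).hasDerivAt
  have h2 : HasDerivAt (f ∘ ofComplex) (derivZ f (γ • z))
      (((γ : GL (Fin 2) ℝ) • ofComplex (z : ℂ) : ℍ) : ℂ) := by
    rw [ofComplex_apply]
    exact hasDerivAt_derivZ hf (γ • z)
  have h3 := h2.comp (z : ℂ) h1
  refine (h3.congr_deriv ?_).congr_of_eventuallyEq ?_
  · have : (denom (γ : GL (Fin 2) ℝ) z) = autFactor γ z := rfl
    simp [this, zpow_neg]
    rw [mul_comm]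
  · refine Filter.Eventually.of_forall fun w => ?_
    simp only [Function.comp_apply, ofComplex_apply]
    rfl

/-- Differentiate the functional equation in z. With j = cz + d and X = c/j one has (γz)' = j^(−2),
j' = jX and X' = −X²; the power j^(−k) accounts for kXP and the powers of X for −X²P'. The bound p +
2 on the degree is not sharp. -/
theorem IsExpansion.derivZ [Countable Γ] (hcov : HasFiniteCovolume Γ)
    (h : IsExpansion Γ k p f P) (hf : f ∈ temperate) :
    IsExpansion Γ (k + 2) (p + 2) (derivZ f) fun z =>
      (∑ j ∈ Finset.range (p + 1), Polynomial.monomial j (derivZ (fun z => (P z).coeff j) z)) +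
        (Polynomial.C (k : ℂ) * Polynomial.X * P z -
          Polynomial.X ^ 2 * Polynomial.derivative (P z)) := by
  refine ⟨fun z => ?_, fun γ hγ z => ?_⟩
  · refine (Polynomial.natDegree_add_le _ _).trans (max_le ?_
      ((Polynomial.natDegree_sub_le _ _).trans (max_le ?_ ?_)))
    · refine Polynomial.natDegree_sum_le_of_forall_le _ _ fun j hj => ?_
      have := Finset.mem_range.mp hj
      exact (Polynomial.natDegree_monomial_le _).trans (by omega)
    · have := h.natDegree_le z
      refine Polynomial.natDegree_mul_le.trans ?_
      have h2 := Polynomial.natDegree_C_mul_X_pow_le (k : ℂ) 1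
      rw [pow_one] at h2
      omega
    · have := h.natDegree_le z
      have h1 := Polynomial.natDegree_derivative_le (P z)
      refine Polynomial.natDegree_mul_le.trans ?_
      rw [Polynomial.natDegree_X_pow]
      omega
  · have hj := autFactor_ne_zero γ z
    have hPt := h.mem_temperatePoly hcov hf
    have hL := (((hasDerivAt_zpow (-k) (autFactor γ z) (Or.inl hj)).comp_of_eq (z : ℂ)
      (hasDerivAt_autFactor γ z) (by simp)).mul (hasDerivAt_comp_smul hf.1 γ z))
    have hR := HasDerivAt.fun_sum (u := Finset.range (p + 1)) fun j _ =>
      (hasDerivAt_derivZ (hPt j).1 z).mul ((hasDerivAt_lowerRatio γ z).pow j)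
    have hLR := hL.unique (hR.congr_of_eventuallyEq (Filter.Eventually.of_forall fun w => ?_))
    · simp only [Function.comp_apply, ofComplex_apply, Pi.pow_apply] at hLR
      change _ = Polynomial.eval (lowerRatio γ z) _
      have h1 : _ = Polynomial.eval (lowerRatio γ z) _ := h.eval_eq γ hγ z
      have h2 : (Polynomial.derivative (P z)).eval (lowerRatio γ z) =
          ∑ i ∈ Finset.range (p + 1), (P z).coeff i * i * lowerRatio γ z ^ (i - 1) := by
        rw [Polynomial.derivative_eval, Polynomial.sum_over_range' _ (by simp) (p + 1)
          (Nat.lt_succ_of_le (h.natDegree_le z))]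
      have h3 : autFactor γ z ^ (-k - 1) * (γ 1 0 : ℝ) =
          autFactor γ z ^ (-k) * lowerRatio γ z := by
        rw [zpow_sub_one₀ hj, lowerRatio]
        ring
      have h4 : autFactor γ z ^ (-(k + 2)) =
          autFactor γ z ^ (-k) * autFactor γ z ^ (-2 : ℤ) := by
        rw [← zpow_add₀ hj]
        ring_nf
      have h5 : ∑ i ∈ Finset.range (p + 1), (_root_.derivZ (fun z => (P z).coeff i) z *
            lowerRatio γ z ^ i + (P z).coeff i *
              (i * lowerRatio γ z ^ (i - 1) * -lowerRatio γ z ^ 2)) =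
          (∑ i ∈ Finset.range (p + 1), _root_.derivZ (fun z => (P z).coeff i) z *
            lowerRatio γ z ^ i) - lowerRatio γ z ^ 2 *
              ∑ i ∈ Finset.range (p + 1), (P z).coeff i * i * lowerRatio γ z ^ (i - 1) := by
        rw [Finset.mul_sum, ← Finset.sum_sub_distrib]
        refine Finset.sum_congr rfl fun i _ => ?_
        ring
      simp only [Polynomial.eval_add, Polynomial.eval_finsetSum, Polynomial.eval_monomial,
        Polynomial.eval_sub, Polynomial.eval_mul, Polynomial.eval_C, Polynomial.eval_X,
        Polynomial.eval_pow]
      rw [h2, h4, ← h1, mul_assoc]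
      rw [h5] at hLR
      push_cast at hLR
      linear_combination hLR + k * f (γ • z) * h3
    · have h1 := h.eval_eq γ hγ (ofComplex w)
      rw [Polynomial.eval_eq_sum_range' (Nat.lt_succ_of_le (h.natDegree_le _))] at h1
      exact h1

theorem IsExpansion.derivZ_coeff_one (h : IsExpansion Γ k p f P) (z : ℍ) :
    ((∑ j ∈ Finset.range (p + 1), Polynomial.monomial j (_root_.derivZ (fun z => (P z).coeff j) z)) +
        (Polynomial.C (k : ℂ) * Polynomial.X * P z -
          Polynomial.X ^ 2 * Polynomial.derivative (P z))).coeff 1 =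
      _root_.derivZ (fun z => (P z).coeff 1) z + k * f z := by
  have h0 : (P z).coeff 0 = f z := congrFun h.coeff_zero z
  have h1 : (∑ j ∈ Finset.range (p + 1),
      Polynomial.monomial j (_root_.derivZ (fun z => (P z).coeff j) z)).coeff 1 =
      _root_.derivZ (fun z => (P z).coeff 1) z := by
    simp only [Polynomial.finsetSum_coeff, Polynomial.coeff_monomial]
    rw [Finset.sum_ite_eq' (Finset.range (p + 1)) 1]
    split_ifs with hp
    · rfl
    -- For p = 0 the sum has no term of degree 1, but then f_1 = 0 as well.
    · have : (fun z => (P z).coeff 1) = fun _ => 0 := funext fun z =>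
        Polynomial.coeff_eq_zero_of_natDegree_lt ((h.natDegree_le z).trans_lt (by
          rw [Finset.mem_range] at hp; omega))
      rw [this]
      symm
      exact derivZ_eq_of_hasDerivAt (hasDerivAt_const _ _)
  rw [Polynomial.coeff_add, h1, Polynomial.coeff_sub, mul_assoc, Polynomial.coeff_C_mul,
    show (1 : ℕ) = 0 + 1 from rfl, Polynomial.coeff_X_mul, h0, pow_two, mul_assoc,
    Polynomial.coeff_X_mul, Polynomial.coeff_X_mul_zero, sub_zero]

theorem IsQuasimodularForm.derivZ [Countable Γ] (hcov : HasFiniteCovolume Γ)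
    (hf : IsQuasimodularForm Γ k p f) : IsQuasimodularForm Γ (k + 2) (p + 2) (derivZ f) := by
  obtain ⟨P, hP⟩ := hf.quasimodular
  have h := derivZ_mem_temperate hf.mem_temperate
  exact ⟨h.1, h.2, _, hP.derivZ hcov hf.mem_temperate⟩

end Expansion

/-! ## The operator `δ` -/

section Delta

variable {Γ : Subgroup PSL(2, ℝ)} [Countable Γ] {k : ℤ} {f g : ℍ → ℂ}

theorem IsDelta.unique (hcov : HasFiniteCovolume Γ) {g' : ℍ → ℂ} (h : IsDelta Γ k f g)
    (h' : IsDelta Γ k f g') : g = g' := by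
  obtain ⟨p, P, hP, hg⟩ := h
  obtain ⟨q, Q, hQ, hg'⟩ := h'
  funext z
  rw [hg, hg', hP.unique hcov hQ]

omit [Countable Γ] in
theorem exists_isDelta (hf : f ∈ quasiForms Γ k) : ∃ g, IsDelta Γ k f g := by
  obtain ⟨p, hf⟩ := hf
  obtain ⟨P, hP⟩ := hf.quasimodular
  exact ⟨_, p, P, hP, fun z => rfl⟩

theorem IsDelta.mem_quasiForms (hcov : HasFiniteCovolume Γ) (hf : f ∈ quasiForms Γ k)
    (h : IsDelta Γ k f g) : g ∈ quasiForms Γ (k - 2) := by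
  obtain ⟨p, hf⟩ := hf
  obtain ⟨q, P, hP, hg⟩ := h
  have hf' : IsQuasimodularForm Γ k q f := ⟨hf.holo, hf.growth, P, hP⟩
  have := hf'.coeff hcov hP 1
  rw [← funext hg] at this
  exact ⟨_, by simpa using this⟩

omit [Countable Γ] in
theorem IsDelta.add {f' g' : ℍ → ℂ} (h : IsDelta Γ k f g) (h' : IsDelta Γ k f' g') :
    IsDelta Γ k (f + f') (g + g') := by
  obtain ⟨p, P, hP, hg⟩ := h
  obtain ⟨q, Q, hQ, hg'⟩ := h'
  refine ⟨max p q, P + Q, ⟨fun z => ?_, fun γ hγ z => ?_⟩, fun z => ?_⟩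
  · exact (Polynomial.natDegree_add_le _ _).trans
      (max_le_max (hP.natDegree_le z) (hQ.natDegree_le z))
  · rw [Pi.add_apply, mul_add, hP.eval_eq γ hγ, hQ.eval_eq γ hγ, Pi.add_apply,
      Polynomial.eval_add]
  · rw [Pi.add_apply, Pi.add_apply, Polynomial.coeff_add, hg, hg']

omit [Countable Γ] in
theorem IsDelta.smul (c : ℂ) (h : IsDelta Γ k f g) : IsDelta Γ k (c • f) (c • g) := by
  obtain ⟨p, P, hP, hg⟩ := h
  refine ⟨p, c • P, ⟨fun z => ?_, fun γ hγ z => ?_⟩, fun z => ?_⟩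
  · exact (Polynomial.natDegree_smul_le _ _).trans (hP.natDegree_le z)
  · simp only [Pi.smul_apply, Polynomial.eval_smul, smul_eq_mul]
    rw [mul_left_comm, hP.eval_eq γ hγ]
  · rw [Pi.smul_apply, Pi.smul_apply, Polynomial.coeff_smul, hg]

theorem IsDelta.eq_zero_of_lt_two (hcov : HasFiniteCovolume Γ) (hk : k < 2)
    (hf : f ∈ quasiForms Γ k) (h : IsDelta Γ k f g) : g = 0 := by
  obtain ⟨p, hg⟩ := h.mem_quasiForms hcov hf
  exact hg.eq_zero_of_neg hcov (by omega)

/-- The kernel of `δ` consists of the modular forms. -/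
theorem IsDelta.mem_modForms (hcov : HasFiniteCovolume Γ) (hf : f ∈ quasiForms Γ k)
    (h : IsDelta Γ k f 0) : f ∈ modForms Γ k := by
  obtain ⟨p, hf⟩ := hf
  obtain ⟨q, P, hP, hg⟩ := h
  have hf' : IsQuasimodularForm Γ k q f := ⟨hf.holo, hf.growth, P, hP⟩
  exact hf'.isModularForm_of_coeff_one hcov hP fun z => (hg z).symm

omit [Countable Γ] in
theorem isDelta_zero_of_mem_modForms (hf : f ∈ modForms Γ k) : IsDelta Γ k f 0 := by
  have h : IsModularForm Γ k f := hf
  exact ⟨0, fun z => Polynomial.C (f z), ⟨fun z => by simp,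
    fun γ hγ z => by simpa using h.modular γ hγ z⟩, fun z => by simp⟩

/-- The commutation relation between `δ` and the derivative. -/
theorem IsDelta.derivZ (hcov : HasFiniteCovolume Γ) (hf : f ∈ quasiForms Γ k)
    (h : IsDelta Γ k f g) : IsDelta Γ (k + 2) (derivZ f) (derivZ g + (k : ℂ) • f) := by
  obtain ⟨p, hf⟩ := hf
  obtain ⟨q, P, hP, hg⟩ := h
  refine ⟨_, _, hP.derivZ hcov hf.mem_temperate, fun z => ?_⟩
  rw [hP.derivZ_coeff_one, ← funext hg]
  rfl

theorem derivZ_mem_quasiForms (hcov : HasFiniteCovolume Γ) (hf : f ∈ quasiForms Γ k) :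
    _root_.derivZ f ∈ quasiForms Γ (k + 2) := by
  obtain ⟨p, hf⟩ := hf
  exact ⟨_, hf.derivZ hcov⟩

omit [Countable Γ] in
theorem mdifferentiable_of_mem_quasiForms (hf : f ∈ quasiForms Γ k) :
    MDifferentiable 𝓘(ℂ) 𝓘(ℂ) f := by
  obtain ⟨p, hf⟩ := hf
  exact hf.holo

/-- Here δf has weight −2, hence vanishes, so f is modular of weight 0. -/
theorem mem_quasiForms_zero (hcov : HasFiniteCovolume Γ) (hf : f ∈ quasiForms Γ 0) :
    ∃ c : ℂ, f = fun _ => c := by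
  obtain ⟨g, hg⟩ := exists_isDelta hf
  rw [hg.eq_zero_of_lt_two hcov two_pos hf] at hg
  exact IsModularForm.exists_eq_const hcov (hg.mem_modForms hcov hf)

end Delta

/-! ## The operators on the graded space of quasimodular forms -/

section Operators

variable (Γ : Subgroup PSL(2, ℝ)) [Countable Γ] (hcov : HasFiniteCovolume Γ)

/-- The derivative as a map from weight `k` to weight `k + 2`. -/
noncomputable def derivWeight (k : ℕ) : quasiForms Γ (k : ℤ) →ₗ[ℂ] quasiForms Γ ((k + 2 : ℕ) : ℤ) where
  toFun f := ⟨derivZ f, by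
    have := derivZ_mem_quasiForms hcov f.2
    simpa using this⟩
  map_add' f g := Subtype.ext <| funext fun z => derivZ_eq_of_hasDerivAt
    ((hasDerivAt_derivZ (mdifferentiable_of_mem_quasiForms f.2) z).add
      (hasDerivAt_derivZ (mdifferentiable_of_mem_quasiForms g.2) z))
  map_smul' c f := Subtype.ext <| funext fun z => derivZ_eq_of_hasDerivAt
    ((hasDerivAt_derivZ (mdifferentiable_of_mem_quasiForms f.2) z).const_smul c)

omit [Countable Γ] in
theorem cast_add_two_sub_two (k : ℕ) : ((k + 2 : ℕ) : ℤ) - 2 = k := by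
  push_cast
  ring

/-- The operator `δ` as a map from weight `k + 2` to weight `k`. -/
noncomputable def deltaWeight (k : ℕ) :
    quasiForms Γ ((k + 2 : ℕ) : ℤ) →ₗ[ℂ] quasiForms Γ (k : ℤ) where
  toFun f := ⟨(exists_isDelta f.2).choose, by
    have := (exists_isDelta f.2).choose_spec.mem_quasiForms hcov f.2
    rwa [cast_add_two_sub_two] at this⟩
  map_add' f g := Subtype.ext <| (exists_isDelta (f + g).2).choose_spec.unique hcov
    ((exists_isDelta f.2).choose_spec.add (exists_isDelta g.2).choose_spec)
  map_smul' c f := Subtype.ext <| (exists_isDelta (c • f).2).choose_spec.unique hcov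
    ((exists_isDelta f.2).choose_spec.smul c)

theorem isDelta_deltaWeight (k : ℕ) (f : quasiForms Γ ((k + 2 : ℕ) : ℤ)) :
    IsDelta Γ ((k + 2 : ℕ) : ℤ) f (deltaWeight Γ hcov k f) :=
  (exists_isDelta f.2).choose_spec

variable {Γ}

omit [Countable Γ] in
theorem QuasiRing.hom_ext {V : Type*} [AddCommGroup V] [Module ℂ V] {A B : QuasiRing Γ →ₗ[ℂ] V}
    (h : ∀ k (f : quasiForms Γ ((k : ℕ) : ℤ)), A (ofWeight k f) = B (ofWeight k f)) : A = B :=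
  DirectSum.linearMap_ext ℂ fun k => LinearMap.ext fun f => h k f

/-- The linear map on the graded space with given restrictions to each weight. -/
noncomputable def QuasiRing.lift {V : Type*} [AddCommGroup V] [Module ℂ V]
    (A : ∀ k : ℕ, quasiForms Γ (k : ℤ) →ₗ[ℂ] V) : QuasiRing Γ →ₗ[ℂ] V :=
  DirectSum.toModule ℂ ℕ V A

omit [Countable Γ] in
theorem QuasiRing.lift_ofWeight {V : Type*} [AddCommGroup V] [Module ℂ V]
    (A : ∀ k : ℕ, quasiForms Γ (k : ℤ) →ₗ[ℂ] V) (k : ℕ) (f : quasiForms Γ (k : ℤ)) :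
    QuasiRing.lift A (ofWeight k f) = A k f :=
  DirectSum.toModule_lof (M := fun k : ℕ => quasiForms Γ (k : ℤ)) ℂ k f

/-- The component of weight `k`. -/
noncomputable def QuasiRing.proj (k : ℕ) : QuasiRing Γ →ₗ[ℂ] quasiForms Γ (k : ℤ) :=
  DirectSum.component ℂ ℕ (fun k : ℕ => quasiForms Γ (k : ℤ)) k

omit [Countable Γ] in
theorem QuasiRing.proj_ofWeight (k : ℕ) (f : quasiForms Γ (k : ℤ)) :
    QuasiRing.proj k (ofWeight k f) = f :=
  DirectSum.component.lof_self (M := fun k : ℕ => quasiForms Γ (k : ℤ)) ℂ k f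

omit [Countable Γ] in
theorem QuasiRing.proj_ofWeight_of_ne {k l : ℕ} (h : k ≠ l) (f : quasiForms Γ (k : ℤ)) :
    QuasiRing.proj l (ofWeight k f) = 0 :=
  DirectSum.of_eq_of_ne (β := fun k : ℕ => quasiForms Γ (k : ℤ)) k l f h.symm

omit [Countable Γ] in
theorem QuasiRing.mem_of_proj_mem (R : Submodule ℂ (QuasiRing Γ)) (v : QuasiRing Γ)
    (h : ∀ k, ofWeight k (QuasiRing.proj k v) ∈ R) : v ∈ R := by
  classical
  let v' : ⨁ k : ℕ, quasiForms Γ (k : ℤ) := v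
  have e : ∑ i ∈ v'.support, DirectSum.of (fun k : ℕ => quasiForms Γ (k : ℤ)) i (v' i) = v' :=
    DirectSum.sum_support_of v'
  change v' ∈ R
  rw [← e]
  exact R.sum_mem fun i _ => h i

omit [Countable Γ] in
theorem QuasiRing.induction {p : QuasiRing Γ → Prop} (v : QuasiRing Γ) (h0 : p 0)
    (hadd : ∀ v w, p v → p w → p (v + w)) (h : ∀ k f, p (ofWeight k f)) : p v :=
  DirectSum.induction_on v h0 h hadd

/-- The derivation `D` of the graded space. -/
noncomputable def opD : Module.End ℂ (QuasiRing Γ) :=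
  QuasiRing.lift fun k => ofWeight (k + 2) ∘ₗ derivWeight Γ hcov k

/-- The operator that multiplies forms of weight `k` by `k`. -/
noncomputable def opH : Module.End ℂ (QuasiRing Γ) :=
  QuasiRing.lift fun k => (k : ℂ) • ofWeight k

/-- The operator `δ` on the graded space. -/
noncomputable def opDelta : Module.End ℂ (QuasiRing Γ) :=
  QuasiRing.lift fun
    | 0 => 0
    | 1 => 0
    | k + 2 => ofWeight k ∘ₗ deltaWeight Γ hcov k

theorem opD_ofWeight (k : ℕ) (f : quasiForms Γ (k : ℤ)) :
    opD hcov (ofWeight k f) = ofWeight (k + 2) (derivWeight Γ hcov k f) :=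
  QuasiRing.lift_ofWeight _ k f

omit [Countable Γ] in
theorem opH_ofWeight (k : ℕ) (f : quasiForms Γ (k : ℤ)) :
    opH (ofWeight k f) = (k : ℂ) • ofWeight k f :=
  QuasiRing.lift_ofWeight _ k f

theorem opDelta_ofWeight_add_two (k : ℕ) (f : quasiForms Γ ((k + 2 : ℕ) : ℤ)) :
    opDelta hcov (ofWeight (k + 2) f) = ofWeight k (deltaWeight Γ hcov k f) :=
  QuasiRing.lift_ofWeight _ (k + 2) f

theorem opDelta_ofWeight_of_lt_two {k : ℕ} (hk : k < 2) (f : quasiForms Γ (k : ℤ)) :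
    opDelta hcov (ofWeight k f) = 0 := by
  match k, hk with
  | 0, _ => exact QuasiRing.lift_ofWeight _ 0 f
  | 1, _ => exact QuasiRing.lift_ofWeight _ 1 f

theorem opH_opD : opH * opD hcov - opD hcov * opH = (2 : ℂ) • opD hcov := by
  refine QuasiRing.hom_ext fun k f => ?_
  simp only [LinearMap.sub_apply, Module.End.mul_apply, LinearMap.smul_apply, opD_ofWeight,
    opH_ofWeight, map_smul]
  push_cast
  module

theorem opH_opDelta : opH * opDelta hcov - opDelta hcov * opH = (-2 : ℂ) • opDelta hcov := by
  refine QuasiRing.hom_ext fun k f => ?_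
  simp only [LinearMap.sub_apply, Module.End.mul_apply, LinearMap.smul_apply, opH_ofWeight,
    map_smul]
  rcases lt_or_ge k 2 with hk | hk
  · simp [opDelta_ofWeight_of_lt_two hcov hk]
  · obtain ⟨k, rfl⟩ := Nat.exists_eq_add_of_le' hk
    rw [opDelta_ofWeight_add_two, opH_ofWeight]
    push_cast
    module

/-- In weights 0 and 1, where δ is set to zero, the relation still holds because the coefficient f_1
has negative weight and vanishes. -/
theorem opDelta_opD : opDelta hcov * opD hcov - opD hcov * opDelta hcov = opH := by
  refine QuasiRing.hom_ext fun k f => ?_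
  simp only [LinearMap.sub_apply, Module.End.mul_apply, opH_ofWeight, opD_ofWeight,
    opDelta_ofWeight_add_two]
  obtain ⟨g, hg⟩ := exists_isDelta f.2
  have h1 := (hg.derivZ hcov f.2)
  rw [show (k : ℤ) + 2 = ((k + 2 : ℕ) : ℤ) by push_cast; ring] at h1
  have h2 := (isDelta_deltaWeight Γ hcov k (derivWeight Γ hcov k f)).unique hcov h1
  rcases lt_or_ge k 2 with hk | hk
  · rw [opDelta_ofWeight_of_lt_two hcov hk, map_zero, sub_zero, ← map_smul]
    congr 1
    refine Subtype.ext (h2.trans ?_)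
    rw [hg.eq_zero_of_lt_two hcov (by omega) f.2]
    have : derivZ 0 = 0 := funext fun z => derivZ_eq_of_hasDerivAt (hasDerivAt_const _ _)
    rw [this, zero_add]
    simp
  · obtain ⟨k, rfl⟩ := Nat.exists_eq_add_of_le' hk
    have h3 := (isDelta_deltaWeight Γ hcov k f).unique hcov hg
    rw [opDelta_ofWeight_add_two, opD_ofWeight, ← map_sub, ← map_smul]
    congr 1
    refine Subtype.ext ?_
    rw [Submodule.coe_sub, h2, ← h3]
    change derivZ _ + _ - derivZ _ = _
    rw [add_sub_cancel_left]
    simp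

/-- The action of `sl₂(ℂ)` on quasimodular forms. -/
noncomputable def quasiRep : SlTwo →ₗ⁅ℂ⁆ Module.End ℂ (QuasiRing Γ) :=
  slRep (opD hcov) opH (opDelta hcov) (opH_opD hcov) (opH_opDelta hcov) (opDelta_opD hcov)

omit [Countable Γ] in
theorem slRep_apply {V : Type*} [AddCommGroup V] [Module ℂ V] {D H δ : Module.End ℂ V}
    (hHD : H * D - D * H = (2 : ℂ) • D) (hHδ : H * δ - δ * H = (-2 : ℂ) • δ)
    (hδD : δ * D - D * δ = H) (A : SlTwo) (v : V) :
    slRep D H δ hHD hHδ hδD A v = A.1 0 0 • H v + A.1 0 1 • D v - A.1 1 0 • δ v := rfl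

theorem quasiRep_slD : quasiRep hcov slD = opD hcov :=
  LinearMap.ext fun v => by rw [quasiRep, slRep_apply]; simp [slD]

theorem quasiRep_slH : quasiRep hcov slH = opH :=
  LinearMap.ext fun v => by rw [quasiRep, slRep_apply]; simp [slH]

theorem quasiRep_slDelta : quasiRep hcov slDelta = opDelta hcov :=
  LinearMap.ext fun v => by rw [quasiRep, slRep_apply]; simp [slDelta]

theorem isQuasimodularAction_quasiRep : IsQuasimodularAction Γ (quasiRep hcov) where
  D_apply k f := ⟨(derivWeight Γ hcov k f).2, by rw [quasiRep_slD, opD_ofWeight]; rfl⟩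
  H_apply k f := by rw [quasiRep_slH, opH_ofWeight]
  delta_apply k f g hg := by
    have e := (isDelta_deltaWeight Γ hcov k f).unique hcov hg
    subst e
    exact ⟨(deltaWeight Γ hcov k f).2, by rw [quasiRep_slDelta, opDelta_ofWeight_add_two]⟩
  delta_apply_of_lt_two k hk f g hg :=
    ⟨hg.eq_zero_of_lt_two hcov (by omega) f.2, by
      rw [quasiRep_slDelta, opDelta_ofWeight_of_lt_two hcov hk]⟩

end Operators

/-! ## Intertwining maps and locally nilpotent operators -/

section LocallyNilpotent

variable {S V : Type*} [AddCommGroup S] [Module ℂ S] [AddCommGroup V] [Module ℂ V]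

/-- Local nilpotency is expressed by a submodule, so that it can be checked on generators. -/
theorem mem_maxGenEigenspace_zero {d : Module.End ℂ S} {s : S} :
    s ∈ d.maxGenEigenspace 0 ↔ ∃ n : ℕ, (d ^ n) s = 0 := by
  simp [Module.End.mem_maxGenEigenspace]

theorem mem_maxGenEigenspace_zero_of_apply {d : Module.End ℂ S} {s : S}
    (h : d s ∈ d.maxGenEigenspace 0) : s ∈ d.maxGenEigenspace 0 := by
  obtain ⟨n, hn⟩ := mem_maxGenEigenspace_zero.1 h
  exact mem_maxGenEigenspace_zero.2 ⟨n + 1, by rwa [pow_succ, Module.End.mul_apply]⟩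

/-- A map that intertwines a locally nilpotent `d` with `e` is injective if it is so on the kernel
of `d`. -/
theorem injective_of_intertwining {d : Module.End ℂ S} {e : Module.End ℂ V} (Φ : S →ₗ[ℂ] V)
    (hΦ : ∀ s, Φ (d s) = e (Φ s)) (hd : ∀ s, s ∈ d.maxGenEigenspace 0)
    (hker : ∀ s, d s = 0 → Φ s = 0 → s = 0) : Function.Injective Φ := by
  rw [injective_iff_map_eq_zero]
  have key : ∀ (n : ℕ) (s : S), (d ^ n) s = 0 → Φ s = 0 → s = 0 := by
    intro n
    induction n with
    | zero => exact fun s hs _ => hs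
    | succ n ih =>
      intro s hs h0
      rw [pow_succ, Module.End.mul_apply] at hs
      exact hker s (ih (d s) hs (by rw [hΦ, h0, map_zero])) h0
  intro s h0
  obtain ⟨n, hn⟩ := mem_maxGenEigenspace_zero.1 (hd s)
  exact key n s hn h0

/-- A map that intertwines `d` with a locally nilpotent `e` is surjective if its range contains the
kernel of `e` and if `s` is in the range of `d` whenever `Φ s` is in the range of `e`. -/
theorem surjective_of_intertwining {d : Module.End ℂ S} {e : Module.End ℂ V} (Φ : S →ₗ[ℂ] V)
    (hΦ : ∀ s, Φ (d s) = e (Φ s)) (he : ∀ v, v ∈ e.maxGenEigenspace 0)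
    (hker : ∀ v, e v = 0 → ∃ s, Φ s = v) (hlift : ∀ s v, Φ s = e v → ∃ s', d s' = s) :
    Function.Surjective Φ := by
  have key : ∀ (n : ℕ) (v : V), (e ^ n) v = 0 → ∃ s, Φ s = v := by
    intro n
    induction n with
    | zero => exact fun v hv => ⟨0, by rw [map_zero]; exact hv.symm⟩
    | succ n ih =>
      intro v hv
      rw [pow_succ, Module.End.mul_apply] at hv
      obtain ⟨s, hs⟩ := ih (e v) hv
      obtain ⟨s', rfl⟩ := hlift s v hs
      -- The vectors v and Φ s' have the same image under e, so they differ by an element of its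
      -- kernel.
      obtain ⟨t, ht⟩ := hker (v - Φ s') (by rw [map_sub, ← hΦ, hs, sub_self])
      exact ⟨t + s', by rw [map_add, ht, sub_add_cancel]⟩
  intro v
  obtain ⟨n, hn⟩ := mem_maxGenEigenspace_zero.1 (he v)
  exact key n v hn

end LocallyNilpotent

/-! ## Lowest weight vectors -/

section LowestWeightVectors

variable {V : Type*} [AddCommGroup V] [Module ℂ V] {D H δ : Module.End ℂ V}

theorem apply_pow_of_commutator (hHD : H * D - D * H = (2 : ℂ) • D) {v : V} {κ : ℂ}
    (hv : H v = κ • v) (j : ℕ) : H ((D ^ j) v) = (κ + 2 * j) • (D ^ j) v := by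
  induction j with
  | zero => simpa using hv
  | succ j ih =>
    have h := LinearMap.congr_fun hHD ((D ^ j) v)
    simp only [LinearMap.sub_apply, Module.End.mul_apply, LinearMap.smul_apply, ih, map_smul] at h
    rw [pow_succ', Module.End.mul_apply, eq_add_of_sub_eq h]
    push_cast
    module

/-- Moving δ past each D adds the H-eigenvalue met there; the sum of κ + 2i for 0 ≤ i ≤ j is
(j+1)(κ+j). -/
theorem lowering_pow_succ (hHD : H * D - D * H = (2 : ℂ) • D) (hδD : δ * D - D * δ = H) {v : V}
    {κ : ℂ} (hv : H v = κ • v) (j : ℕ) :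
    δ ((D ^ (j + 1)) v) = (D ^ (j + 1)) (δ v) + (((j : ℂ) + 1) * (κ + j)) • (D ^ j) v := by
  induction j with
  | zero =>
    have h := LinearMap.congr_fun hδD v
    simp only [LinearMap.sub_apply, Module.End.mul_apply, hv] at h
    simp [← h]
  | succ j ih =>
    have h := LinearMap.congr_fun hδD ((D ^ (j + 1)) v)
    simp only [LinearMap.sub_apply, Module.End.mul_apply, ih,
      apply_pow_of_commutator hHD hv] at h
    rw [pow_succ' D (j + 1), Module.End.mul_apply, eq_add_of_sub_eq h, map_add, map_smul,
      ← Module.End.mul_apply D, ← Module.End.mul_apply D, ← pow_succ' D j]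
    push_cast
    module

/-- The linear map that sends `x_j` to `D ^ j v`, as a function of `v`. -/
noncomputable def orbitMap (D : Module.End ℂ V) : V →ₗ[ℂ] (ℕ →₀ ℂ) →ₗ[ℂ] V :=
  (Finsupp.linearCombination ℂ fun j : ℕ => D ^ j : (ℕ →₀ ℂ) →ₗ[ℂ] V →ₗ[ℂ] V).flip

theorem orbitMap_single (v : V) (j : ℕ) (a : ℂ) :
    orbitMap D v (Finsupp.single j a) = a • (D ^ j) v := by
  simp [orbitMap]

theorem orbitMap_verD (v : V) (w : ℕ →₀ ℂ) : orbitMap D v (verD w) = D (orbitMap D v w) := by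
  induction w using Finsupp.induction_linear with
  | zero => simp
  | add f g hf hg => simp only [map_add, hf, hg]
  | single j a =>
    rw [verD_single, map_smul, orbitMap_single, orbitMap_single, map_smul, pow_succ', one_smul,
      Module.End.mul_apply]

theorem orbitMap_verH (hHD : H * D - D * H = (2 : ℂ) • D) {v : V} {k : ℕ}
    (hv : H v = (k : ℂ) • v) (w : ℕ →₀ ℂ) : orbitMap D v (verH k w) = H (orbitMap D v w) := by
  induction w using Finsupp.induction_linear with
  | zero => simp
  | add f g hf hg => simp only [map_add, hf, hg]
  | single j a =>
    rw [verH_single, map_smul, orbitMap_single, orbitMap_single, map_smul,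
      apply_pow_of_commutator hHD hv, one_smul, smul_smul]

/-- The operator `δ` on the image of `𝒰_k`, up to a term that vanishes if `δ v = 0`. -/
theorem orbitMap_verDelta (hHD : H * D - D * H = (2 : ℂ) • D) (hδD : δ * D - D * δ = H)
    {v : V} {k : ℕ} (hv : H v = (k : ℂ) • v) (hδ : D (δ v) = 0) (w : ℕ →₀ ℂ) :
    w 0 • δ v + orbitMap D v (verDelta k w) = δ (orbitMap D v w) := by
  induction w using Finsupp.induction_linear with
  | zero => simp
  | add f g hf hg =>
    rw [map_add, map_add, map_add, map_add, ← hf, ← hg, Finsupp.add_apply]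
    module
  | single j a =>
    rw [verDelta_single, map_smul, orbitMap_single, orbitMap_single, map_smul, one_smul]
    cases j with
    | zero => simp
    | succ j =>
      rw [lowering_pow_succ hHD hδD hv, pow_succ D j, Module.End.mul_apply, hδ]
      simp only [Nat.add_sub_cancel, map_zero]
      rw [Finsupp.single_eq_of_ne (by simp)]
      push_cast
      module

end LowestWeightVectors

/-! ## The modules `M_k(Γ) ⊗ 𝒰_k` -/

section IsotypicModules

variable {Γ : Subgroup PSL(2, ℝ)}

theorem lie_tmul_of_trivial {k : ℕ} (X : SlTwo) (m : TrivialLieModule ℂ SlTwo (modForms Γ (k : ℤ)))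
    (u : LowestWeight k) : ⁅X, m ⊗ₜ[ℂ] u⁆ = m ⊗ₜ[ℂ] (lowestWeightRep k X u) := by
  rw [TensorProduct.LieModule.lie_tmul_right, trivial_lie_zero, TensorProduct.zero_tmul, zero_add]
  rfl

/-- The space `𝒰_0` is `ℂ`. -/
def scalarEquiv : ℂ ≃ₗ[ℂ] LowestWeight 0 := LinearEquiv.refl ℂ ℂ

/-- The space `𝒰_k` for `k ≥ 1` is the space with basis `x_0, x_1, …`. -/
noncomputable def verEquiv (k : ℕ) : (ℕ →₀ ℂ) ≃ₗ[ℂ] LowestWeight (k + 1) :=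
  LinearEquiv.refl ℂ (ℕ →₀ ℂ)

theorem lowestWeightRep_zero (X : SlTwo) (u : LowestWeight 0) : lowestWeightRep 0 X u = 0 := rfl

theorem lowestWeightRep_verEquiv (k : ℕ) (X : SlTwo) (w : ℕ →₀ ℂ) :
    lowestWeightRep (k + 1) X (verEquiv k w) = verEquiv k (verRep (k + 1) X w) := rfl

theorem lowestWeightVec_zero_zero : lowestWeightVec 0 0 = scalarEquiv 1 := rfl

theorem lowestWeightVec_zero_succ (j : ℕ) : lowestWeightVec 0 (j + 1) = 0 := rfl

theorem lowestWeightVec_succ (k j : ℕ) :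
    lowestWeightVec (k + 1) j = verEquiv k (Finsupp.single j 1) := rfl

theorem verRep_slDelta (k : ℕ) (w : ℕ →₀ ℂ) : verRep k slDelta w = verDelta k w := by
  rw [verRep, slRep_apply]
  simp [slDelta]

/-- The lowering operator on `M_k(Γ) ⊗ 𝒰_k`. -/
theorem lie_slDelta_tmul (k : ℕ) (m : TrivialLieModule ℂ SlTwo (modForms Γ ((k + 1 : ℕ) : ℤ)))
    (w : ℕ →₀ ℂ) :
    (⁅slDelta, m ⊗ₜ[ℂ] verEquiv k w⁆ : Isotypic Γ (k + 1)) =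
      m ⊗ₜ[ℂ] verEquiv k (verDelta (k + 1) w) := by
  rw [lie_tmul_of_trivial, lowestWeightRep_verEquiv, verRep_slDelta]

theorem lie_isotypic_zero (X : SlTwo) (t : Isotypic Γ 0) : ⁅X, t⁆ = 0 := by
  induction t using TensorProduct.induction_on with
  | zero => simp
  | add x y hx hy => rw [lie_add, hx, hy, add_zero]
  | tmul m u => rw [lie_tmul_of_trivial, lowestWeightRep_zero, TensorProduct.tmul_zero]

theorem exists_isoTensor_zero (t : Isotypic Γ 0) : ∃ f, t = isoTensor 0 0 f := by
  induction t using TensorProduct.induction_on with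
  | zero => exact ⟨0, by simp [isoTensor]⟩
  | add x y hx hy =>
    obtain ⟨f, rfl⟩ := hx
    obtain ⟨g, rfl⟩ := hy
    exact ⟨f + g, by simp only [isoTensor, map_add, TensorProduct.add_tmul]⟩
  | tmul m u =>
    obtain ⟨c, rfl⟩ := scalarEquiv.surjective u
    refine ⟨c • TrivialLieModule.equiv ℂ SlTwo _ m, ?_⟩
    rw [isoTensor, map_smul, LinearEquiv.symm_apply_apply, TensorProduct.smul_tmul,
      lowestWeightVec_zero_zero, ← map_smul, smul_eq_mul, mul_one]

/-- The coordinates of an element of `M_k(Γ) ⊗ 𝒰_k`. -/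
noncomputable def isoCoord (k : ℕ) : Isotypic Γ (k + 1) ≃ₗ[ℂ]
    (ℕ →₀ TrivialLieModule ℂ SlTwo (modForms Γ ((k + 1 : ℕ) : ℤ))) :=
  TensorProduct.finsuppScalarRight ℂ ℂ _ ℕ

theorem isoCoord_tmul (k : ℕ) (m : TrivialLieModule ℂ SlTwo (modForms Γ ((k + 1 : ℕ) : ℤ)))
    (w : ℕ →₀ ℂ) (j : ℕ) : isoCoord k (m ⊗ₜ[ℂ] verEquiv k w) j = w j • m :=
  TensorProduct.finsuppScalarRight_apply_tmul_apply _ _ _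

theorem verDelta_apply (k : ℕ) (w : ℕ →₀ ℂ) (j : ℕ) :
    verDelta k w j = (((j : ℂ) + 1) * (k + j)) * w (j + 1) := by
  induction w using Finsupp.induction_linear with
  | zero => simp
  | add f g hf hg => simp only [map_add, Finsupp.add_apply, hf, hg, mul_add]
  | single i a =>
    rw [verDelta_single]
    cases i with
    | zero => simp
    | succ i =>
      simp only [Nat.add_sub_cancel, Finsupp.smul_apply, Finsupp.single_apply, add_left_inj]
      split_ifs with h
      · subst h
        push_cast
        simp only [smul_eq_mul]
        ring
      · simp

theorem isoCoord_lie_slDelta (k : ℕ) (t : Isotypic Γ (k + 1)) (j : ℕ) :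
    isoCoord k ⁅slDelta, t⁆ j =
      (((j : ℂ) + 1) * ((k + 1 : ℕ) + j)) • isoCoord k t (j + 1) := by
  induction t using TensorProduct.induction_on with
  | zero => simp
  | add x y hx hy =>
    rw [lie_add, map_add, Finsupp.add_apply, hx, hy, map_add (isoCoord k), Finsupp.add_apply,
      smul_add]
  | tmul m u =>
    obtain ⟨w, rfl⟩ := (verEquiv k).surjective u
    rw [lie_slDelta_tmul, isoCoord_tmul, isoCoord_tmul, verDelta_apply, smul_smul]

/-- Positivity of the weight k + 1 matters here: in weight 0 the factor for j = 0 would vanish. -/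
theorem coeff_ne_zero (k j : ℕ) : (((j : ℂ) + 1) * ((k + 1 : ℕ) + j)) ≠ 0 := by
  have : (((j : ℂ) + 1) * ((k + 1 : ℕ) + j)) = (((j + 1) * (k + 1 + j) : ℕ) : ℂ) := by
    push_cast
    ring
  rw [this]
  exact_mod_cast (by positivity)

/-- The vectors in `M_k(Γ) ⊗ 𝒰_k` that are annihilated by `δ` are those in `M_k(Γ) ⊗ x_0`. -/
theorem exists_isoTensor_of_lie_slDelta {k : ℕ} {t : Isotypic Γ k} (h : ⁅slDelta, t⁆ = 0) :
    ∃ f, t = isoTensor k 0 f := by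
  cases k with
  | zero => exact exists_isoTensor_zero t
  | succ k =>
    refine ⟨TrivialLieModule.equiv ℂ SlTwo _ (isoCoord k t 0), (isoCoord k).injective ?_⟩
    ext1 j
    rw [isoTensor, LinearEquiv.symm_apply_apply, lowestWeightVec_succ, isoCoord_tmul]
    cases j with
    | zero => rw [Finsupp.single_eq_same, one_smul]
    | succ j =>
      have h1 := isoCoord_lie_slDelta k t j
      rw [h, map_zero, Finsupp.zero_apply] at h1
      rw [(smul_eq_zero.1 h1.symm).resolve_left (coeff_ne_zero k j),
        Finsupp.single_eq_of_ne (by simp)]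
      exact (zero_smul ℂ (isoCoord k t 0)).symm

theorem verDelta_surjective (k : ℕ) : Function.Surjective (verDelta (k + 1)) := by
  intro w
  induction w using Finsupp.induction_linear with
  | zero => exact ⟨0, map_zero _⟩
  | add f g hf hg =>
    obtain ⟨f, rfl⟩ := hf
    obtain ⟨g, rfl⟩ := hg
    exact ⟨f + g, map_add _ _ _⟩
  | single j a =>
    refine ⟨Finsupp.single (j + 1) (a / (((j : ℂ) + 1) * ((k + 1 : ℕ) + j))), ?_⟩
    rw [verDelta_single, Nat.add_sub_cancel, Finsupp.smul_single, smul_eq_mul, mul_one]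
    congr 1
    have := coeff_ne_zero k j
    push_cast at this ⊢
    rw [show (k : ℂ) + 1 + (j + 1) - 1 = k + 1 + j by ring, div_mul_cancel₀ _ this]

theorem exists_lie_slDelta_eq {k : ℕ} (t : Isotypic Γ (k + 1)) :
    ∃ s : Isotypic Γ (k + 1), ⁅slDelta, s⁆ = t := by
  induction t using TensorProduct.induction_on with
  | zero => exact ⟨0, lie_zero _⟩
  | add x y hx hy =>
    obtain ⟨x, rfl⟩ := hx
    obtain ⟨y, rfl⟩ := hy
    exact ⟨x + y, lie_add _ _ _⟩
  | tmul m u =>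
    obtain ⟨w, rfl⟩ := (verEquiv k).surjective u
    obtain ⟨w, rfl⟩ := verDelta_surjective k w
    exact ⟨m ⊗ₜ[ℂ] verEquiv k w, lie_slDelta_tmul k m w⟩

theorem verDelta_pow (k : ℕ) (w : ℕ →₀ ℂ) : ∃ n, ((verDelta k) ^ n) w = 0 := by
  rw [← mem_maxGenEigenspace_zero]
  induction w using Finsupp.induction_linear with
  | zero => exact Submodule.zero_mem _
  | add f g hf hg => exact Submodule.add_mem _ hf hg
  | single j a =>
    induction j generalizing a with
    | zero =>
      refine mem_maxGenEigenspace_zero_of_apply ?_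
      rw [verDelta_single]
      simp
    | succ j ih =>
      refine mem_maxGenEigenspace_zero_of_apply ?_
      rw [verDelta_single]
      exact Submodule.smul_mem _ _ (ih 1)

theorem isotypic_mem_maxGenEigenspace (k : ℕ) (t : Isotypic Γ k) :
    t ∈ (LieModule.toEnd ℂ SlTwo (Isotypic Γ k) slDelta).maxGenEigenspace 0 := by
  cases k with
  | zero =>
    refine mem_maxGenEigenspace_zero_of_apply ?_
    rw [LieModule.toEnd_apply_apply, lie_isotypic_zero]
    exact Submodule.zero_mem _
  | succ k =>
    induction t using TensorProduct.induction_on with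
    | zero => exact Submodule.zero_mem _
    | add x y hx hy => exact Submodule.add_mem _ hx hy
    | tmul m u =>
      obtain ⟨w, rfl⟩ := (verEquiv k).surjective u
      obtain ⟨n, hn⟩ := verDelta_pow (k + 1) w
      rw [mem_maxGenEigenspace_zero]
      refine ⟨n, ?_⟩
      have key : ∀ (n : ℕ) (w : ℕ →₀ ℂ),
          (LieModule.toEnd ℂ SlTwo (Isotypic Γ (k + 1)) slDelta ^ n) (m ⊗ₜ[ℂ] verEquiv k w) =
            m ⊗ₜ[ℂ] verEquiv k ((verDelta (k + 1) ^ n) w) := by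
        intro n
        induction n with
        | zero => exact fun w => rfl
        | succ n ih =>
          intro w
          rw [pow_succ', Module.End.mul_apply, ih, LieModule.toEnd_apply_apply, lie_slDelta_tmul,
            pow_succ', Module.End.mul_apply]
      rw [key, hn, map_zero, TensorProduct.tmul_zero]

end IsotypicModules

/-! ## Intertwining maps out of `𝒰_k` and `Û_2` -/

section LowestWeightMaps

variable {V : Type*} [AddCommGroup V] [Module ℂ V] {D H δ : Module.End ℂ V}
  (hHD : H * D - D * H = (2 : ℂ) • D) (hHδ : H * δ - δ * H = (-2 : ℂ) • δ)
  (hδD : δ * D - D * δ = H)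

theorem slRep_zero {v : V} (hD : D v = 0) (hH : H v = 0) (hδ : δ v = 0) (X : SlTwo) :
    slRep D H δ hHD hHδ hδD X v = 0 := by
  rw [slRep_apply, hD, hH, hδ]
  simp

theorem orbitMap_verRep {v : V} {k : ℕ} (hv : H v = (k : ℂ) • v) (hδ : δ v = 0) (X : SlTwo)
    (w : ℕ →₀ ℂ) :
    orbitMap D v (verRep k X w) = slRep D H δ hHD hHδ hδD X (orbitMap D v w) := by
  have h := orbitMap_verDelta hHD hδD hv (by rw [hδ, map_zero]) w
  rw [hδ, smul_zero, zero_add] at h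
  rw [verRep, slRep_apply, slRep_apply, map_sub, map_add, map_smul, map_smul, map_smul,
    orbitMap_verD, orbitMap_verH hHD hv, h]

/-- The linear map `𝒰_k → V` that sends the lowest weight vector to `v` and commutes with `D`,
as a function of `v`. -/
noncomputable def lowestWeightMap (D : Module.End ℂ V) : ∀ k : ℕ, V →ₗ[ℂ] LowestWeight k →ₗ[ℂ] V
  | 0 => ((Algebra.lsmul ℂ ℂ V).toLinearMap.flip).compl₂ scalarEquiv.symm.toLinearMap
  | k + 1 => (orbitMap D).compl₂ (verEquiv k).symm.toLinearMap

theorem lowestWeightMap_zero (v : V) (c : ℂ) : lowestWeightMap D 0 v (scalarEquiv c) = c • v := rfl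

theorem lowestWeightMap_succ (k : ℕ) (v : V) (w : ℕ →₀ ℂ) :
    lowestWeightMap D (k + 1) v (verEquiv k w) = orbitMap D v w := rfl

/-- The space of `Û_2` is the sum of `ℂ` and of the space with basis `x̂_0, x̂_1, …`. -/
noncomputable def extEquiv : (ℂ × (ℕ →₀ ℂ)) ≃ₗ[ℂ] ExtTwo := LinearEquiv.refl ℂ (ℂ × (ℕ →₀ ℂ))

theorem lie_extEquiv (X : SlTwo) (w : ℂ × (ℕ →₀ ℂ)) :
    (⁅X, extEquiv w⁆ : ExtTwo) = extEquiv (extRep X w) := rfl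

theorem extRep_apply (X : SlTwo) (w : ℂ × (ℕ →₀ ℂ)) :
    extRep X w = (-(X.1 1 0 * w.2 0), verRep 2 X w.2) := by
  rw [extRep, slRep_apply, verRep, slRep_apply]
  exact Prod.ext (by simp) (by simp)

/-- The linear map `Û_2 → V` that sends `1` to `u` and `x̂_j` to `D ^ j v`. -/
noncomputable def extMap (D : Module.End ℂ V) (u v : V) : ExtTwo →ₗ[ℂ] V :=
  ((LinearMap.toSpanSingleton ℂ V u).coprod (orbitMap D v)) ∘ₗ extEquiv.symm.toLinearMap

theorem extMap_extEquiv (u v : V) (w : ℂ × (ℕ →₀ ℂ)) :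
    extMap D u v (extEquiv w) = w.1 • u + orbitMap D v w.2 := rfl

/-- The term w 0 • δ v left over by `orbitMap_verDelta` is w 0 • u, which matches δ x̂_0 = 1. -/
theorem extMap_lie {u v : V} (hDu : D u = 0) (hHu : H u = 0) (hδu : δ u = 0)
    (hv : H v = (2 : ℂ) • v) (hδv : δ v = u) (X : SlTwo) (w : ExtTwo) :
    extMap D u v ⁅X, w⁆ = slRep D H δ hHD hHδ hδD X (extMap D u v w) := by
  obtain ⟨w, rfl⟩ := extEquiv.surjective w
  have h := orbitMap_verDelta (k := 2) hHD hδD (by simpa using hv) (by rw [hδv, hDu]) w.2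
  rw [lie_extEquiv, extMap_extEquiv, extMap_extEquiv, map_add, map_smul,
    slRep_zero hHD hHδ hδD hDu hHu hδu, smul_zero, zero_add, slRep_apply, ← orbitMap_verD,
    ← orbitMap_verH (k := 2) hHD (by simpa using hv), ← h, hδv, extRep_apply, verRep, slRep_apply,
    map_sub, map_add, map_smul, map_smul, map_smul]
  module

end LowestWeightMaps

/-! ### The lowering operator on `Û_2`. -/

section ExtensionModule

theorem lie_slDelta_extEquiv (w : ℂ × (ℕ →₀ ℂ)) :
    (⁅slDelta, extEquiv w⁆ : ExtTwo) = extEquiv (w.2 0, verDelta 2 w.2) := by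
  rw [lie_extEquiv, extRep, slRep_apply]
  simp [slDelta]

theorem verDelta_eq_zero {k : ℕ} {w : ℕ →₀ ℂ} (h : verDelta (k + 1) w = 0) (j : ℕ) :
    w (j + 1) = 0 := by
  have h1 := verDelta_apply (k + 1) w j
  rw [h, Finsupp.zero_apply] at h1
  exact (mul_eq_zero.1 h1.symm).resolve_left (coeff_ne_zero k j)

/-- In contrast with 𝒰_2, the vector x̂_0 is not killed by δ, so only the line of constants remains.
-/
theorem exists_smul_extOne {w : ExtTwo} (h : ⁅slDelta, w⁆ = 0) : ∃ c : ℂ, w = c • extOne := by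
  obtain ⟨⟨c, w⟩, rfl⟩ := extEquiv.surjective w
  rw [lie_slDelta_extEquiv, LinearEquiv.map_eq_zero_iff, Prod.mk_eq_zero] at h
  have hw : w = 0 := by
    ext j
    cases j with
    | zero => exact h.1
    | succ j => exact verDelta_eq_zero h.2 j
  refine ⟨c, ?_⟩
  subst hw
  change extEquiv (c, 0) = c • extEquiv (1, 0)
  rw [← map_smul]
  simp

theorem exists_lie_slDelta_ext_eq (t : ExtTwo) : ∃ s : ExtTwo, ⁅slDelta, s⁆ = t := by
  obtain ⟨⟨c, w⟩, rfl⟩ := extEquiv.surjective t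
  obtain ⟨u, hu⟩ := verDelta_surjective 1 w
  -- `verDelta` does not see the coefficient at x̂_0, which can thus be set to c to produce the
  -- constant.
  refine ⟨extEquiv (0, u + Finsupp.single 0 (c - u 0)), ?_⟩
  rw [lie_slDelta_extEquiv]
  congr 1
  refine Prod.ext (by simp) ?_
  rw [map_add, verDelta_single]
  simpa using hu

theorem ext_mem_maxGenEigenspace (t : ExtTwo) :
    t ∈ (LieModule.toEnd ℂ SlTwo ExtTwo slDelta).maxGenEigenspace 0 := by
  -- Once the second component is exhausted, a multiple of 1 is left, and one more δ kills it.
  have key : ∀ (n : ℕ) (c : ℂ) (w : ℕ →₀ ℂ), (verDelta 2 ^ n) w = 0 →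
      extEquiv (c, w) ∈ (LieModule.toEnd ℂ SlTwo ExtTwo slDelta).maxGenEigenspace 0 := by
    intro n
    induction n with
    | zero =>
      intro c w hw
      refine mem_maxGenEigenspace_zero_of_apply ?_
      have hw : w = 0 := hw
      rw [LieModule.toEnd_apply_apply, lie_slDelta_extEquiv, hw, Finsupp.zero_apply,
        map_zero, Prod.mk_zero_zero, map_zero]
      exact Submodule.zero_mem _
    | succ n ih =>
      intro c w hw
      refine mem_maxGenEigenspace_zero_of_apply ?_
      rw [LieModule.toEnd_apply_apply, lie_slDelta_extEquiv]
      exact ih _ _ (by rwa [pow_succ, Module.End.mul_apply] at hw)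
  obtain ⟨⟨c, w⟩, rfl⟩ := extEquiv.surjective t
  obtain ⟨n, hn⟩ := verDelta_pow 2 w
  exact key n c w hn

end ExtensionModule

/-! ## The structure of the space of quasimodular forms -/

section Structure

variable {Γ : Subgroup PSL(2, ℝ)}

/-- The inclusion of the modular forms of weight `k`. -/
noncomputable def modularMap (k : ℕ) : modForms Γ (k : ℤ) →ₗ[ℂ] QuasiRing Γ :=
  ofWeight k ∘ₗ Submodule.inclusion (modForms_le_quasiForms Γ k)

theorem proj_ofModular (k : ℕ) (f : modForms Γ (k : ℤ)) :
    (QuasiRing.proj k (ofModular k f) : ℍ → ℂ) = f := by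
  rw [ofModular, QuasiRing.proj_ofWeight]

variable [Countable Γ] (hcov : HasFiniteCovolume Γ)

theorem opD_ofWeight_zero (f : quasiForms Γ ((0 : ℕ) : ℤ)) : opD hcov (ofWeight 0 f) = 0 := by
  obtain ⟨c, hc⟩ := mem_quasiForms_zero hcov f.2
  have : derivWeight Γ hcov 0 f = 0 := Subtype.ext <| funext fun z =>
    derivZ_eq_of_hasDerivAt (by rw [hc]; exact hasDerivAt_const _ _)
  rw [opD_ofWeight, this, map_zero]

theorem opDelta_ofModular (k : ℕ) (f : modForms Γ (k : ℤ)) :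
    opDelta hcov (ofModular k f) = 0 := by
  rw [ofModular]
  rcases lt_or_ge k 2 with hk | hk
  · rw [opDelta_ofWeight_of_lt_two hcov hk]
  · obtain ⟨k, rfl⟩ := Nat.exists_eq_add_of_le' hk
    rw [opDelta_ofWeight_add_two]
    have := (isDelta_deltaWeight Γ hcov k ⟨f, modForms_le_quasiForms Γ _ f.2⟩).unique hcov
      (isDelta_zero_of_mem_modForms f.2)
    rw [show deltaWeight Γ hcov k ⟨f, modForms_le_quasiForms Γ _ f.2⟩ = 0 from Subtype.ext this,
      map_zero]

theorem proj_opDelta (k : ℕ) (v : QuasiRing Γ) :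
    QuasiRing.proj k (opDelta hcov v) = deltaWeight Γ hcov k (QuasiRing.proj (k + 2) v) := by
  refine LinearMap.congr_fun (f := QuasiRing.proj k ∘ₗ opDelta hcov)
    (g := deltaWeight Γ hcov k ∘ₗ QuasiRing.proj (k + 2)) (QuasiRing.hom_ext fun l f => ?_) v
  rw [LinearMap.comp_apply, LinearMap.comp_apply]
  rcases lt_or_ge l 2 with hl | hl
  · rw [opDelta_ofWeight_of_lt_two hcov hl, QuasiRing.proj_ofWeight_of_ne (by omega), map_zero,
      map_zero]
  · obtain ⟨l, rfl⟩ := Nat.exists_eq_add_of_le' hl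
    rw [opDelta_ofWeight_add_two]
    by_cases h : l = k
    · subst h
      rw [QuasiRing.proj_ofWeight, QuasiRing.proj_ofWeight]
    · rw [QuasiRing.proj_ofWeight_of_ne h, QuasiRing.proj_ofWeight_of_ne (by omega), map_zero]

/-- The components of an element of the kernel of `δ` are modular forms. -/
theorem exists_ofModular_of_opDelta_eq_zero {v : QuasiRing Γ} (hv : opDelta hcov v = 0) (k : ℕ) :
    ∃ f, ofWeight k (QuasiRing.proj k v) = ofModular k f := by
  suffices h : (QuasiRing.proj k v : ℍ → ℂ) ∈ modForms Γ (k : ℤ) from ⟨⟨_, h⟩, rfl⟩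
  obtain ⟨g, hg⟩ := exists_isDelta (QuasiRing.proj k v).2
  suffices h : g = 0 by
    subst h
    exact hg.mem_modForms hcov (QuasiRing.proj k v).2
  rcases lt_or_ge k 2 with hk | hk
  · exact hg.eq_zero_of_lt_two hcov (by omega) (QuasiRing.proj k v).2
  · obtain ⟨k, rfl⟩ := Nat.exists_eq_add_of_le' hk
    have h := proj_opDelta hcov k v
    rw [hv, map_zero] at h
    rw [hg.unique hcov (isDelta_deltaWeight Γ hcov k _), ← h]
    rfl

theorem mem_maxGenEigenspace_opDelta (v : QuasiRing Γ) :
    v ∈ (opDelta hcov).maxGenEigenspace 0 := by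
  refine QuasiRing.induction v (Submodule.zero_mem _) (fun v w => Submodule.add_mem _)
    fun k => ?_
  induction k using Nat.strong_induction_on with
  | _ k ih =>
    intro f
    refine mem_maxGenEigenspace_zero_of_apply ?_
    rcases lt_or_ge k 2 with hk | hk
    · rw [opDelta_ofWeight_of_lt_two hcov hk]
      exact Submodule.zero_mem _
    · obtain ⟨k, rfl⟩ := Nat.exists_eq_add_of_le' hk
      rw [opDelta_ofWeight_add_two]
      exact ih k (by omega) _

/-- The map `M_k(Γ) ⊗ 𝒰_k → M̃_*(Γ)` that sends `f ⊗ x_j` to `D ^ j f`. -/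
noncomputable def pieceMap (k : ℕ) : Isotypic Γ k →ₗ[ℂ] QuasiRing Γ :=
  TensorProduct.lift (lowestWeightMap (opD hcov) k ∘ₗ modularMap k ∘ₗ
    (TrivialLieModule.equiv ℂ SlTwo (modForms Γ (k : ℤ))).toLinearMap)

theorem pieceMap_tmul (k : ℕ) (m : TrivialLieModule ℂ SlTwo (modForms Γ (k : ℤ)))
    (u : LowestWeight k) : pieceMap hcov k (m ⊗ₜ[ℂ] u) =
      lowestWeightMap (opD hcov) k (ofModular k (TrivialLieModule.equiv ℂ SlTwo _ m)) u :=
  TensorProduct.lift.tmul _ _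

theorem pieceMap_isoTensor (k j : ℕ) (f : modForms Γ (k : ℤ)) :
    pieceMap hcov k (isoTensor k j f) = (opD hcov ^ j) (ofModular k f) := by
  rw [isoTensor, pieceMap_tmul, LinearEquiv.apply_symm_apply]
  match k, j with
  | 0, 0 => rw [lowestWeightVec_zero_zero, lowestWeightMap_zero, one_smul, pow_zero,
      Module.End.one_apply]
  | 0, j + 1 => rw [lowestWeightVec_zero_succ, map_zero, pow_succ, Module.End.mul_apply,
      ofModular, opD_ofWeight_zero, map_zero]
  | k + 1, j => rw [lowestWeightVec_succ, lowestWeightMap_succ, orbitMap_single, one_smul]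

theorem pieceMap_lie (k : ℕ) (X : SlTwo) (t : Isotypic Γ k) :
    pieceMap hcov k ⁅X, t⁆ = quasiRep hcov X (pieceMap hcov k t) := by
  induction t using TensorProduct.induction_on with
  | zero => rw [lie_zero, map_zero, map_zero]
  | add x y hx hy => rw [lie_add, map_add, hx, hy, map_add, map_add]
  | tmul m u =>
    rw [lie_tmul_of_trivial, pieceMap_tmul, pieceMap_tmul]
    cases k with
    | zero =>
      obtain ⟨c, rfl⟩ := scalarEquiv.surjective u
      rw [lowestWeightRep_zero, map_zero, lowestWeightMap_zero, map_smul, quasiRep, slRep_zero,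
        smul_zero]
      · rw [ofModular, opD_ofWeight_zero]
      · rw [ofModular, opH_ofWeight, Nat.cast_zero, zero_smul]
      · rw [opDelta_ofModular]
    | succ k =>
      obtain ⟨w, rfl⟩ := (verEquiv k).surjective u
      rw [lowestWeightRep_verEquiv, lowestWeightMap_succ, lowestWeightMap_succ, quasiRep,
        orbitMap_verRep]
      · rw [ofModular, opH_ofWeight]
      · rw [opDelta_ofModular]

/-- The map from the sum of the modules `M_k(Γ) ⊗ 𝒰_k`, over a family of weights. -/
noncomputable def sumMap (σ : ℕ → ℕ) : (⨁ k : ℕ, Isotypic Γ (σ k)) →ₗ[ℂ] QuasiRing Γ :=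
  DirectSum.toModule ℂ ℕ (QuasiRing Γ) fun k => pieceMap hcov (σ k)

theorem sumMap_lof (σ : ℕ → ℕ) (k : ℕ) (t : Isotypic Γ (σ k)) :
    sumMap hcov σ (DirectSum.lof ℂ ℕ (fun k => Isotypic Γ (σ k)) k t) = pieceMap hcov (σ k) t :=
  DirectSum.toModule_lof (M := fun k => Isotypic Γ (σ k)) ℂ k t

omit [Countable Γ] in
theorem lie_lof (σ : ℕ → ℕ) (X : SlTwo) (k : ℕ) (t : Isotypic Γ (σ k)) :
    ⁅X, DirectSum.lof ℂ ℕ (fun k => Isotypic Γ (σ k)) k t⁆ =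
      DirectSum.lof ℂ ℕ (fun k => Isotypic Γ (σ k)) k ⁅X, t⁆ :=
  ((DirectSum.lieModuleOf ℂ ℕ SlTwo (fun k => Isotypic Γ (σ k)) k).map_lie X t).symm

theorem sumMap_lie (σ : ℕ → ℕ) (X : SlTwo) (v : ⨁ k : ℕ, Isotypic Γ (σ k)) :
    sumMap hcov σ ⁅X, v⁆ = quasiRep hcov X (sumMap hcov σ v) := by
  induction v using DirectSum.induction_on with
  | zero => rw [lie_zero, map_zero, map_zero]
  | add x y hx hy => rw [lie_add, map_add, hx, hy, map_add, map_add]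
  | of k t =>
    change sumMap hcov σ ⁅X, DirectSum.lof ℂ ℕ (fun k => Isotypic Γ (σ k)) k t⁆ =
      quasiRep hcov X (sumMap hcov σ (DirectSum.lof ℂ ℕ (fun k => Isotypic Γ (σ k)) k t))
    rw [lie_lof, sumMap_lof, sumMap_lof, pieceMap_lie]

omit [Countable Γ] in
theorem directSum_mem_maxGenEigenspace (σ : ℕ → ℕ) (v : ⨁ k : ℕ, Isotypic Γ (σ k)) :
    v ∈ (LieModule.toEnd ℂ SlTwo (⨁ k : ℕ, Isotypic Γ (σ k)) slDelta).maxGenEigenspace 0 := by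
  induction v using DirectSum.induction_on with
  | zero => exact Submodule.zero_mem _
  | add x y hx hy => exact Submodule.add_mem _ hx hy
  | of k t =>
    obtain ⟨n, hn⟩ := mem_maxGenEigenspace_zero.1 (isotypic_mem_maxGenEigenspace (σ k) t)
    refine mem_maxGenEigenspace_zero.2 ⟨n, ?_⟩
    have key : ∀ n : ℕ, (LieModule.toEnd ℂ SlTwo (⨁ k : ℕ, Isotypic Γ (σ k)) slDelta ^ n)
        (DirectSum.lof ℂ ℕ (fun k => Isotypic Γ (σ k)) k t) =
        DirectSum.lof ℂ ℕ (fun k => Isotypic Γ (σ k)) k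
          ((LieModule.toEnd ℂ SlTwo (Isotypic Γ (σ k)) slDelta ^ n) t) := by
      intro n
      induction n with
      | zero => rfl
      | succ n ih =>
        rw [pow_succ', Module.End.mul_apply, ih, LieModule.toEnd_apply_apply, lie_lof, pow_succ',
          Module.End.mul_apply, LieModule.toEnd_apply_apply]
    exact (key n).trans (by rw [hn, map_zero])

/-- The components of the image of a vector that is annihilated by `δ`. -/
theorem proj_sumMap {σ : ℕ → ℕ} (hσ : σ.Injective) {v : ⨁ k : ℕ, Isotypic Γ (σ k)}
    (hv : ⁅slDelta, v⁆ = 0) : ∃ c : ∀ k, modForms Γ ((σ k : ℕ) : ℤ),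
      (∀ k, v k = isoTensor (σ k) 0 (c k)) ∧
      (∀ k, (QuasiRing.proj (σ k) (sumMap hcov σ v) : ℍ → ℂ) = c k) ∧
      ∀ l ∉ Set.range σ, QuasiRing.proj l (sumMap hcov σ v) = 0 := by
  classical
  have h : ∀ k, ∃ f, v k = isoTensor (σ k) 0 f := fun k =>
    exists_isoTensor_of_lie_slDelta (by rw [← DirectSum.lie_module_bracket_apply, hv]; rfl)
  choose c hc using h
  have hsum : sumMap hcov σ v = ∑ i ∈ v.support, ofModular (σ i) (c i) := by
    conv_lhs => rw [← DirectSum.sum_support_of v]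
    rw [map_sum]
    refine Finset.sum_congr rfl fun i _ => ?_
    refine (sumMap_lof hcov σ i (v i)).trans ?_
    rw [hc, pieceMap_isoTensor, pow_zero, Module.End.one_apply]
  refine ⟨c, hc, fun k => ?_, fun l hl => ?_⟩
  · rw [hsum, map_sum, Finset.sum_eq_single k]
    · exact proj_ofModular _ _
    · exact fun i _ hi => QuasiRing.proj_ofWeight_of_ne (fun e => hi (hσ e)) _
    -- The form c k was chosen also outside the support; there v k = 0, and applying `pieceMap`
    -- shows that its image vanishes.
    · intro hk
      have h0 : v k = 0 := by simpa using hk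
      have h1 := pieceMap_isoTensor hcov (σ k) 0 (c k)
      rw [← hc, h0, map_zero, pow_zero, Module.End.one_apply] at h1
      rw [← h1, map_zero]
  · rw [hsum, map_sum]
    exact Finset.sum_eq_zero fun i _ => QuasiRing.proj_ofWeight_of_ne (fun e => hl ⟨i, e⟩) _

/-- On the kernel of δ the summands map to modular forms of the distinct weights σ k, so no
cancellation can occur. -/
theorem eq_zero_of_sumMap {σ : ℕ → ℕ} (hσ : σ.Injective) {v : ⨁ k : ℕ, Isotypic Γ (σ k)}
    (hv : ⁅slDelta, v⁆ = 0) (h : ∀ k, QuasiRing.proj (σ k) (sumMap hcov σ v) = 0) : v = 0 := by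
  obtain ⟨c, hc, hp, -⟩ := proj_sumMap hcov hσ hv
  refine DirectSum.ext_component ℂ fun k => ?_
  have : c k = 0 := Subtype.ext (by rw [← hp, h]; rfl)
  change v k = 0
  rw [hc, this]
  simp [isoTensor]

theorem sumMap_lof_isoTensor (σ : ℕ → ℕ) (k j : ℕ) (f : modForms Γ ((σ k : ℕ) : ℤ)) :
    sumMap hcov σ (DirectSum.lof ℂ ℕ (fun k => Isotypic Γ (σ k)) k (isoTensor (σ k) j f)) =
      (quasiRep hcov slD ^ j) (ofModular (σ k) f) := by
  rw [sumMap_lof, pieceMap_isoTensor, quasiRep_slD]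

theorem sumMap_slDelta (σ : ℕ → ℕ) (v : ⨁ k : ℕ, Isotypic Γ (σ k)) :
    sumMap hcov σ (LieModule.toEnd ℂ SlTwo _ slDelta v) = opDelta hcov (sumMap hcov σ v) := by
  rw [LieModule.toEnd_apply_apply, sumMap_lie, quasiRep_slDelta]

omit [Countable Γ] in
/-- Modulo the range of `δ`, the sum of the modules `M_k(Γ) ⊗ 𝒰_k` is `M_0(Γ)`. -/
theorem exists_eq_lof_add_lie (s : ⨁ k : ℕ, Isotypic Γ k) : ∃ f r,
    s = DirectSum.lof ℂ ℕ (fun k => Isotypic Γ k) 0 (isoTensor 0 0 f) + ⁅slDelta, r⁆ := by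
  induction s using DirectSum.induction_on with
  | zero => exact ⟨0, 0, by simp [isoTensor]⟩
  | add x y hx hy =>
    obtain ⟨f, r, rfl⟩ := hx
    obtain ⟨g, t, rfl⟩ := hy
    refine ⟨f + g, r + t, ?_⟩
    rw [lie_add, isoTensor, isoTensor, isoTensor, map_add, TensorProduct.add_tmul, map_add]
    abel
  | of k t =>
    cases k with
    | zero =>
      obtain ⟨f, rfl⟩ := exists_isoTensor_zero t
      exact ⟨f, 0, by rw [lie_zero, add_zero]; rfl⟩
    | succ k =>
      obtain ⟨s, rfl⟩ := exists_lie_slDelta_eq t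
      refine ⟨0, DirectSum.lof ℂ ℕ (fun k => Isotypic Γ k) (k + 1) s, ?_⟩
      rw [lie_lof (fun k => k)]
      simp only [isoTensor, map_zero, TensorProduct.zero_tmul, zero_add]
      rfl

omit [Countable Γ] in
theorem exists_lie_slDelta_sum_eq (t : ⨁ k : ℕ, Isotypic Γ (k + 1)) : ∃ s, ⁅slDelta, s⁆ = t := by
  induction t using DirectSum.induction_on with
  | zero => exact ⟨0, lie_zero _⟩
  | add x y hx hy =>
    obtain ⟨x, rfl⟩ := hx
    obtain ⟨y, rfl⟩ := hy
    exact ⟨x + y, lie_add _ _ _⟩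
  | of k t =>
    obtain ⟨s, rfl⟩ := exists_lie_slDelta_eq t
    exact ⟨DirectSum.lof ℂ ℕ (fun k => Isotypic Γ (k + 1)) k s, lie_lof (fun k => k + 1) _ _ _⟩

/-- If `δ` vanishes in weight `2`, then the quasimodular forms are the derivatives of modular
forms. -/
theorem bijective_sumMap (h : ∀ φ ∈ quasiForms Γ 2, IsDelta Γ 2 φ 0) :
    Function.Bijective (sumMap hcov fun k => k) := by
  constructor
  · exact injective_of_intertwining _ (sumMap_slDelta hcov _)
      (directSum_mem_maxGenEigenspace _) fun s hs h0 =>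
        eq_zero_of_sumMap hcov (fun _ _ e => e) hs fun k => by rw [h0, map_zero]
  · refine surjective_of_intertwining _ (sumMap_slDelta hcov _)
      (mem_maxGenEigenspace_opDelta hcov) (fun v hv => ?_) fun s v hs => ?_
    · refine QuasiRing.mem_of_proj_mem (LinearMap.range (sumMap hcov fun k => k)) v fun k => ?_
      obtain ⟨f, hf⟩ := exists_ofModular_of_opDelta_eq_zero hcov hv k
      rw [hf]
      exact ⟨_, sumMap_lof_isoTensor hcov (fun k => k) k 0 f⟩
    -- The obstruction to lying in the range of δ is the weight 0 part f. As the image of s is δ v,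
    -- f is δ of the weight 2 component of an element of the graded space, hence zero by hypothesis.
    · obtain ⟨f, r, rfl⟩ := exists_eq_lof_add_lie s
      have h1 : sumMap hcov (fun k => k)
          (DirectSum.lof ℂ ℕ (fun k => Isotypic Γ k) 0 (isoTensor 0 0 f)) = ofModular 0 f :=
        sumMap_lof_isoTensor hcov (fun k => k) 0 0 f
      rw [map_add, h1, sumMap_lie, quasiRep_slDelta, ← eq_sub_iff_add_eq, ← map_sub] at hs
      have h2 : (f : ℍ → ℂ) = 0 := by
        rw [← proj_ofModular, hs, proj_opDelta]
        exact (isDelta_deltaWeight Γ hcov 0 _).unique hcov (h _ (QuasiRing.proj 2 _).2)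
      have h3 : f = 0 := Subtype.ext h2
      refine ⟨r, ?_⟩
      rw [h3]
      simp [isoTensor]

/-- The map from the sum of the modules `M_k(Γ) ⊗ 𝒰_k`, for `k ≥ 1`, and `Û_2`. -/
noncomputable def extSumMap (φ : quasiForms Γ ((2 : ℕ) : ℤ)) :
    ((⨁ k : ℕ, Isotypic Γ (k + 1)) × ExtTwo) →ₗ[ℂ] QuasiRing Γ :=
  (sumMap hcov fun k => k + 1).coprod
    (extMap (opD hcov) (ofWeight 0 ⟨fun _ => 1, one_mem_quasiForms Γ⟩) (ofWeight 2 φ))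

theorem extSumMap_apply (φ : quasiForms Γ ((2 : ℕ) : ℤ)) (v : ⨁ k : ℕ, Isotypic Γ (k + 1))
    (w : ExtTwo) : extSumMap hcov φ (v, w) = sumMap hcov (fun k => k + 1) v +
      extMap (opD hcov) (ofWeight 0 ⟨fun _ => 1, one_mem_quasiForms Γ⟩) (ofWeight 2 φ) w :=
  LinearMap.coprod_apply _ _ _

theorem extSumMap_lie {φ : quasiForms Γ ((2 : ℕ) : ℤ)} (hφ : IsDelta Γ 2 φ 1) (X : SlTwo)
    (v : ⨁ k : ℕ, Isotypic Γ (k + 1)) (w : ExtTwo) :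
    extSumMap hcov φ (⁅X, v⁆, ⁅X, w⁆) = quasiRep hcov X (extSumMap hcov φ (v, w)) := by
  rw [extSumMap_apply, extSumMap_apply, map_add, sumMap_lie, quasiRep, extMap_lie]
  · exact opD_ofWeight_zero hcov _
  · rw [opH_ofWeight, Nat.cast_zero, zero_smul]
  · exact opDelta_ofWeight_of_lt_two hcov two_pos _
  · rw [opH_ofWeight, Nat.cast_ofNat]
  · rw [opDelta_ofWeight_add_two hcov 0 φ]
    congr 1
    exact Subtype.ext ((isDelta_deltaWeight Γ hcov 0 φ).unique hcov hφ)

theorem extMap_smul_extOne {V : Type*} [AddCommGroup V] [Module ℂ V] (D : Module.End ℂ V)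
    (u v : V) (c : ℂ) : extMap D u v (c • extOne) = c • u := by
  rw [map_smul]
  change c • extMap D u v (extEquiv (1, 0)) = _
  rw [extMap_extEquiv]
  simp

theorem extSumMap_slDelta {φ : quasiForms Γ ((2 : ℕ) : ℤ)} (hφ : IsDelta Γ 2 φ 1)
    (s : (⨁ k : ℕ, Isotypic Γ (k + 1)) × ExtTwo) :
    extSumMap hcov φ ((LieModule.toEnd ℂ SlTwo (⨁ k : ℕ, Isotypic Γ (k + 1)) slDelta).prodMap
      (LieModule.toEnd ℂ SlTwo ExtTwo slDelta) s) = opDelta hcov (extSumMap hcov φ s) := by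
  rw [← quasiRep_slDelta]
  exact extSumMap_lie hcov hφ slDelta s.1 s.2

theorem prod_mem_maxGenEigenspace {S T : Type*} [AddCommGroup S] [Module ℂ S] [AddCommGroup T]
    [Module ℂ T] {d : Module.End ℂ S} {e : Module.End ℂ T} {s : S × T}
    (h1 : s.1 ∈ d.maxGenEigenspace 0) (h2 : s.2 ∈ e.maxGenEigenspace 0) :
    s ∈ Module.End.maxGenEigenspace (d.prodMap e : Module.End ℂ (S × T)) 0 := by
  obtain ⟨m, hm⟩ := mem_maxGenEigenspace_zero.1 h1
  obtain ⟨n, hn⟩ := mem_maxGenEigenspace_zero.1 h2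
  refine mem_maxGenEigenspace_zero.2 ⟨m + n, ?_⟩
  have key : ∀ (n : ℕ) (s : S × T),
      ((d.prodMap e : Module.End ℂ (S × T)) ^ n) s = ((d ^ n) s.1, (e ^ n) s.2) := by
    intro n
    induction n with
    | zero => exact fun s => rfl
    | succ n ih => exact fun s => by simp [pow_succ, ih]
  rw [key]
  refine Prod.ext ?_ ?_
  · change (d ^ (m + n)) s.1 = 0
    rw [add_comm, pow_add, Module.End.mul_apply, hm, map_zero]
  · change (e ^ (m + n)) s.2 = 0
    rw [pow_add, Module.End.mul_apply, hn, map_zero]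

/-- If `δ φ = 1`, then the quasimodular forms are the derivatives of modular forms and of `φ`. -/
theorem bijective_extSumMap {φ : quasiForms Γ ((2 : ℕ) : ℤ)} (hφ : IsDelta Γ 2 φ 1) :
    Function.Bijective (extSumMap hcov φ) := by
  have hone : (⟨fun _ => 1, one_mem_quasiForms Γ⟩ : quasiForms Γ ((0 : ℕ) : ℤ)) ≠ 0 := fun h =>
    one_ne_zero (congr_fun (congr_arg Subtype.val h) UpperHalfPlane.I)
  constructor
  · refine injective_of_intertwining _ (extSumMap_slDelta hcov hφ) (fun s =>
      prod_mem_maxGenEigenspace (directSum_mem_maxGenEigenspace (fun k => k + 1) s.1)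
        (ext_mem_maxGenEigenspace s.2)) ?_
    rintro ⟨v, w⟩ hs h0
    have hv : ⁅slDelta, v⁆ = 0 := congr_arg Prod.fst hs
    obtain ⟨c, rfl⟩ := exists_smul_extOne (congr_arg Prod.snd hs : ⁅slDelta, w⁆ = 0)
    rw [extSumMap_apply, extMap_smul_extOne] at h0
    have hp := fun l => congr_arg (QuasiRing.proj l) h0
    simp only [map_add, map_smul, map_zero] at hp
    -- Weight 0 is not of the form k + 1, so the component of weight 0 isolates the constant c.
    obtain ⟨-, -, -, hl⟩ := proj_sumMap hcov (add_left_injective 1) hv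
    have h1 := hp 0
    rw [hl 0 (by simp), zero_add, QuasiRing.proj_ofWeight] at h1
    have hc : c = 0 := (smul_eq_zero.1 h1).resolve_right hone
    subst hc
    have hv0 : v = 0 := eq_zero_of_sumMap hcov (add_left_injective 1) hv fun k => by
      simpa using hp (k + 1)
    rw [hv0, zero_smul]
    rfl
  · refine surjective_of_intertwining _ (extSumMap_slDelta hcov hφ)
      (mem_maxGenEigenspace_opDelta hcov) (fun v hv => ?_) fun s v hs => ?_
    · refine QuasiRing.mem_of_proj_mem (LinearMap.range (extSumMap hcov φ)) v fun k => ?_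
      cases k with
      | zero =>
        obtain ⟨c, hc⟩ := mem_quasiForms_zero hcov (QuasiRing.proj 0 v).2
        refine ⟨(0, c • extOne), ?_⟩
        rw [extSumMap_apply, map_zero, zero_add, extMap_smul_extOne, ← map_smul]
        congr 1
        refine Subtype.ext ?_
        rw [hc]
        exact funext fun z => mul_one c
      | succ k =>
        obtain ⟨f, hf⟩ := exists_ofModular_of_opDelta_eq_zero hcov hv (k + 1)
        rw [hf]
        refine ⟨(DirectSum.lof ℂ ℕ (fun k => Isotypic Γ (k + 1)) k (isoTensor (k + 1) 0 f), 0), ?_⟩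
        rw [extSumMap_apply, map_zero, add_zero]
        exact sumMap_lof_isoTensor hcov (fun k => k + 1) k 0 f
    -- Here δ is onto the whole source, so every s lifts.
    · obtain ⟨v', hv'⟩ := exists_lie_slDelta_sum_eq s.1
      obtain ⟨w', hw'⟩ := exists_lie_slDelta_ext_eq s.2
      exact ⟨(v', w'), Prod.ext hv' hw'⟩

end Structure

/-- On weight 2 the values of δ are constants, and a nonzero one can be scaled to 1. -/
theorem isDelta_dichotomy {Γ : Subgroup PSL(2, ℝ)} [Countable Γ] (hcov : HasFiniteCovolume Γ) :
    (∀ φ ∈ quasiForms Γ 2, IsDelta Γ 2 φ 0) ∨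
    ∃ φ ∈ quasiForms Γ 2, IsDelta Γ 2 φ 1 := by
  refine or_iff_not_imp_left.2 fun h => ?_
  push Not at h
  obtain ⟨φ, hφ, h0⟩ := h
  obtain ⟨g, hg⟩ := exists_isDelta hφ
  obtain ⟨c, rfl⟩ := mem_quasiForms_zero hcov (by simpa using hg.mem_quasiForms hcov hφ)
  have hc : c ≠ 0 := by
    rintro rfl
    exact h0 hg
  refine ⟨c⁻¹ • φ, Submodule.smul_mem _ _ hφ, ?_⟩
  have := hg.smul c⁻¹
  rwa [show (c⁻¹ • fun _ => c : ℍ → ℂ) = 1 from funext fun z => inv_mul_cancel₀ hc] at this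

theorem theorem3 (Γ : Subgroup PSL(2, ℝ)) (hdisc : DiscreteTopology Γ)
    (hcov : HasFiniteCovolume Γ) :
    ∃ ρ : SlTwo →ₗ⁅ℂ⁆ Module.End ℂ (QuasiRing Γ),
      IsQuasimodularAction Γ ρ ∧
      ((∀ φ ∈ quasiForms Γ 2, IsDelta Γ 2 φ 0) ∨ ∃ φ ∈ quasiForms Γ 2, IsDelta Γ 2 φ 1) ∧
      ((∀ φ ∈ quasiForms Γ 2, IsDelta Γ 2 φ 0) →
        ∃ Φ : (⨁ k : ℕ, Isotypic Γ k) ≃ₗ[ℂ] QuasiRing Γ,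
          (∀ (X : SlTwo) (v : ⨁ k : ℕ, Isotypic Γ k), Φ ⁅X, v⁆ = ρ X (Φ v)) ∧
          ∀ (k j : ℕ) (f : modForms Γ (k : ℤ)),
            Φ (DirectSum.lof ℂ ℕ (Isotypic Γ) k (isoTensor k j f)) =
              (ρ slD ^ j) (ofModular k f)) ∧
      (∀ φ : quasiForms Γ ((2 : ℕ) : ℤ), IsDelta Γ 2 φ 1 →
        ∃ Φ : ((⨁ k : ℕ, Isotypic Γ (k + 1)) × ExtTwo) ≃ₗ[ℂ] QuasiRing Γ,
          (∀ (X : SlTwo) (v : ⨁ k : ℕ, Isotypic Γ (k + 1)) (w : ExtTwo),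
            Φ (⁅X, v⁆, ⁅X, w⁆) = ρ X (Φ (v, w))) ∧
          (∀ (k j : ℕ) (f : modForms Γ ((k + 1 : ℕ) : ℤ)),
            Φ (DirectSum.lof ℂ ℕ (fun k => Isotypic Γ (k + 1)) k (isoTensor (k + 1) j f), 0) =
              (ρ slD ^ j) (ofModular (k + 1) f)) ∧
          Φ (0, extOne) = ofWeight 0 ⟨fun _ => 1, one_mem_quasiForms Γ⟩ ∧
          ∀ j : ℕ, Φ (0, extVec j) = (ρ slD ^ j) (ofWeight 2 φ)) := by
  have := countable_of_discrete Γ hdisc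
  refine ⟨quasiRep hcov, isQuasimodularAction_quasiRep hcov, isDelta_dichotomy hcov, fun h => ?_,
    fun φ hφ => ?_⟩
  · exact ⟨LinearEquiv.ofBijective _ (bijective_sumMap hcov h), sumMap_lie hcov fun k => k,
      sumMap_lof_isoTensor hcov fun k => k⟩
  · refine ⟨LinearEquiv.ofBijective _ (bijective_extSumMap hcov hφ), extSumMap_lie hcov hφ,
      fun k j f => ?_, ?_, fun j => ?_⟩
    · rw [LinearEquiv.ofBijective_apply, extSumMap_apply, map_zero, add_zero]
      exact sumMap_lof_isoTensor hcov (fun k => k + 1) k j f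
    · rw [LinearEquiv.ofBijective_apply, extSumMap_apply, map_zero, zero_add]
      simpa using extMap_smul_extOne (opD hcov) (ofWeight 0 ⟨fun _ => 1, one_mem_quasiForms Γ⟩)
        (ofWeight 2 φ) 1
    · rw [LinearEquiv.ofBijective_apply, extSumMap_apply, map_zero, zero_add, quasiRep_slD]
      refine (extMap_extEquiv _ _ (0, Finsupp.single j 1)).trans ?_
      rw [orbitMap_single, zero_smul, zero_add, one_smul]
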